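/- **Setting (the set theory AS of approximations of sets).** For hereditarily finite $A$ put $F(0,A)=\emptyset$ and $F(n+1,A)=\{F(n,x)\mid x\in A\}$. A *set* of AS is a sequence $A=(A_n)_{n\ge 0}$ of hereditarily finite sets, $A_n$ of rank $\le n$, with $F(n,A_{n+1})=A_n$ for all $n$; $F(n,A):=A_n$ is its $n$-th approximation, and $x\in A$ means $F(n,x)\in F(n+1,A)$ for every $n$. Every property $P$ has a smallest set containing all $x$ with $P(x)$, namely the set $S$ with $F(n+1,S)=\{F(n,x)\mid P(x)\}$ for every $n$. Subsets, (Kuratowski) ordered pairs, products, relations and functions are understood inside this universe; in particular relations and functions are themselves sets of AS. The finite N-ordinals are $0=\emptyset$, $n+1=n\cup\{n\}$; $\omega$ is the smallest set containing all of them (its elements are the finite N-ordinals and $\omega$). The sum is $A+B=(\{1\}\times A)\cup(\{2\}\times B)$. A set is infinite if it is in bijection with a proper subset of itself. $A\le_c B$ means that there is an injection from $A$ into $B$; $A=_cB$ means $A\le_cB$ and $B\le_cA$; $A<_cB$ means $A\le_cB$ and not $A=_cB$. The $n$-th neighbourhood of $x$ is $\{y\mid F(n,y)=F(n,x)\}$;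 $A'$ is the set of accumulation points in $A$. A set $A$ is *well-ordered* by a (non-strict) linear ordering $R$ (a set of AS) if every nonempty subset of $A$ has a minimal element and every $x\in A$ has a neighbourhood that contains no larger element of $A$. An *ordinal* is a well-ordered set $(A,R)$; $\alpha\le_o\beta$ (resp. $\alpha<_o\beta$) means that $\alpha$ is isomorphic to an initial segment (resp. proper initial segment) of $\beta$, initial segments being sets of AS. An ordinal $\alpha$ is a predecessor of $\beta$ if $\beta$ is the union of an initial segment isomorphic to $\alpha$ and a single further point; a limit ordinal is a nonempty ordinal without predecessor. Put $A^{(\emptyset)}=A$, $A^{(\alpha)}=(A^{(p)})'$ if $p$ is a predecessor of $\alpha$, and $A^{(\alpha)}=\{x\mid x\in A^{(\beta)}\text{ for every }\beta<_o\alpha\}$ for a limit ordinal $\alpha$. If $\alpha$ is the smallest ordinal, with regard to $\le_o$, such that $(A^{(\alpha)})'=\emptyset$, then $d_{CB}(A)=A^{(\alpha)}$ is the Cantor–Bendixson degree of the well-ordered set $A$; "$d_{CB}(A)=1$" means $d_{CB}(A)=_c1$. A *well-ordered cardinal* is an ordinal $\kappa$ such that $\kappa=_cS$ for no proper initial segment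 $S$ of $\kappa$; a *cardinal* is a well-ordered cardinal or a set that cannot be well-ordered. A product is called a well-ordered cardinal if it is one with a suitable well-ordering. A cardinal $\kappa$ is a predecessor of a cardinal $\kappa'$ if $\kappa<_c\kappa'$ and no cardinal $\kappa''$ satisfies $\kappa<_c\kappa''<_c\kappa'$; a *limit cardinal* is a nonempty cardinal without predecessor. A cardinal $\kappa$ *follows immediately after* the cardinals $\kappa_0,\kappa_1,\dots$ if $\kappa_i<_c\kappa$ for every $i$, and $\kappa\le_c\kappa'$ for every cardinal $\kappa'$ such that $\kappa_i<_c\kappa'$ for every $i$. **Theorem.** 1. If $\kappa$ is a well-ordered cardinal and $n$ is a finite N-ordinal, then $n\times\kappa$, ordered lexicographically, is a well-ordered cardinal. 2. If $A$ is a well-ordered set with $d_{CB}(A)=1$ and $n>0$ is a finite N-ordinal, then there is no set $B$ with $n\times A<_cB<_c(n+1)\times A$. 3. If $\kappa$ is a well-ordered cardinal with $d_{CB}(\kappa)=1$, then $\omega\times\kappa$ is a well-ordered cardinal, is a limit cardinal, and follows immediately after the cardinals $\kappa,2\times\kappa,3\times\kappa,\dots$. 4. An infinite well-ordered cardinal $\kappa$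 is a limit cardinal if and only if $d_{CB}(\kappa)=1$. 5. Let $\kappa_0<_c\kappa_1<_c\kappa_2<_c\cdots$ be well-ordered cardinals such that $\kappa_i+\kappa_{i+1}=_c\kappa_{i+1}$ for every $i$. Then there is a well-ordered cardinal that follows immediately after $\kappa_0,\kappa_1,\kappa_2,\dots$, and this cardinal is a limit cardinal. -/

import Mathlib

namespace AS

/-! ### The universe of sets determined by their approximations -/

/-- `Approx n` is the type of hereditarily finite sets of rank at most `n`: the only one of rank `0`
is the empty set, and one of rank at most `n + 1` is a set of ones of rank at most `n`.  Each
`Approx n` is a finite type, so that arbitrary subsets of it are finite sets. -/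
def Approx : ℕ → Type
  | 0 => Unit
  | n + 1 => Set (Approx n)

/-- The map `A ↦ F(n, A)` on hereditarily finite sets `A` of rank at most `n + 1`:
`F(0, A) = ∅` and `F(n + 1, A) = {F(n, x) | x ∈ A}`. -/
def trunc : (n : ℕ) → Approx (n + 1) → Approx n
  | 0 => fun _ => ()
  | n + 1 => fun A => (trunc n '' (A : Set (Approx (n + 1))) : Set (Approx n))

/-- A set of AS is a path in the universal tree: a sequence of hereditarily finite sets
`F(0, A), F(1, A), ...` with `F(n, F(n + 1, A)) = F(n, A)`. -/
@[ext] structure ASet where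
  /-- `A.approx n` is the `n`-th approximation `F(n, A)` -/
  approx : (n : ℕ) → Approx n
  coherent : ∀ n, trunc n (approx (n + 1)) = approx n

/-- `x ∈ A` means `F(n, x) ∈ F(n + 1, A)` for every `n`. -/
instance : Membership ASet ASet :=
  ⟨fun A x => ∀ n, (show Set (Approx n) from A.approx (n + 1)) (x.approx n)⟩

/-- The approximations of the smallest set that contains everything satisfying `P`. -/
def hullApprox (P : Set ASet) : (n : ℕ) → Approx n
  | 0 => ()
  | n + 1 => ((fun x : ASet => x.approx n) '' P : Set (Approx n))

/-- The smallest set that contains all `x` with `P x`, given by `F(n + 1, A) = {F(n, x) | P x}`.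
It is `{x | P x}` whenever a set with exactly these elements exists. -/
def hull (P : Set ASet) : ASet where
  approx := hullApprox P
  coherent n := by
    cases n with
    | zero => rfl
    | succ n =>
      change trunc n '' ((fun x : ASet => x.approx (n + 1)) '' P) = (fun x : ASet => x.approx n) '' P
      rw [Set.image_image]
      exact Set.image_congr fun x _ => x.coherent n

def Sub (A B : ASet) : Prop := ∀ x ∈ A, x ∈ B

def empty : ASet := hull ∅

def pair (a b : ASet) : ASet := hull {a, b}

def singleton (a : ASet) : ASet := hull {a}

def union (A B : ASet) : ASet := hull {x | x ∈ A ∨ x ∈ B}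

/-- The ordered pair `{{a}, {a, b}}`. -/
def opair (a b : ASet) : ASet := pair (singleton a) (pair a b)

/-- The cartesian product. -/
def prod (A B : ASet) : ASet := hull {p | ∃ a ∈ A, ∃ b ∈ B, p = opair a b}

/-- The finite von Neumann ordinals `0 = ∅`, `n + 1 = n ∪ {n}`. -/
def natOrd : ℕ → ASet
  | 0 => empty
  | n + 1 => union (natOrd n) (singleton (natOrd n))

/-- The set `ω`, with `F(n + 1, ω) = {F(n, x) | x a finite von Neumann ordinal}`.  Its elements are
the finite von Neumann ordinals and `ω` itself. -/
def omega : ASet := hull (Set.range natOrd)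

/-- The sum `A + B = ({1} × A) ∪ ({2} × B)`. -/
def sum (A B : ASet) : ASet :=
  union (prod (singleton (natOrd 1)) A) (prod (singleton (natOrd 2)) B)

/-! ### Functions, cardinality, accumulation points -/

/-- `f` is an injection from `A` into `B` (as an object of the universe): a total, functional and
injective subset of `A × B`. -/
structure IsInjection (f A B : ASet) : Prop where
  rel : Sub f (prod A B)
  total : ∀ a ∈ A, ∃ b ∈ B, opair a b ∈ f
  functional : ∀ a b c, opair a b ∈ f → opair a c ∈ f → b = c
  injective : ∀ a b c, opair a c ∈ f → opair b c ∈ f → a = b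

structure IsBijection (f A B : ASet) : Prop extends IsInjection f A B where
  surjective : ∀ b ∈ B, ∃ a ∈ A, opair a b ∈ f

/-- `A ≤_c B` -/
def LeC (A B : ASet) : Prop := ∃ f, IsInjection f A B

/-- `A =_c B` -/
def EqC (A B : ASet) : Prop := LeC A B ∧ LeC B A

/-- `A <_c B` -/
def LtC (A B : ASet) : Prop := LeC A B ∧ ¬ EqC A B

/-- A set is infinite if it is in bijection with a proper subset of itself. -/
def IsInfinite (A : ASet) : Prop := ∃ B, Sub B A ∧ B ≠ A ∧ ∃ f, IsBijection f A B

/-- `x` is an accumulation point in `A` in the topology of approximations, in which the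
neighbourhoods of `x` are the sets `{y | F(n, y) = F(n, x)}`. -/
def IsAcc (A x : ASet) : Prop := ∀ n, ∃ y ∈ A, y ≠ x ∧ y.approx n = x.approx n

/-- The derived set: the set of all accumulation points in `A`. -/
def derived (A : ASet) : ASet := hull {x | IsAcc A x}

/-! ### Well-orderings and ordinals -/

/-- The object `R` of the universe is a linear ordering of `A`.  Orderings are sets of ordered pairs,
hence closed relations; they are taken in their non-strict form (the strict part of a
linear ordering of an infinite set is never a set). -/
structure IsLinOrd (A R : ASet) : Prop where
  rel : Sub R (prod A A)
  refl : ∀ x ∈ A, opair x x ∈ R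
  antisymm : ∀ x y, opair x y ∈ R → opair y x ∈ R → x = y
  trans : ∀ x y z, opair x y ∈ R → opair y z ∈ R → opair x z ∈ R
  total : ∀ x ∈ A, ∀ y ∈ A, opair x y ∈ R ∨ opair y x ∈ R

/-- `A` is well-ordered by `R`: every nonempty subset of `A` has a minimal element, and
every point of `A` is upward isolated, i.e. some neighbourhood of it contains no greater point. -/
structure IsWellOrd (A R : ASet) : Prop extends IsLinOrd A R where
  exists_min : ∀ B, Sub B A → (∃ x, x ∈ B) → ∃ m ∈ B, ∀ x ∈ B, opair m x ∈ R
  upward_isolated : ∀ x ∈ A, ∃ n, ∀ y ∈ A, y.approx n = x.approx n → opair x y ∈ R → y = x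

def WellOrderable (A : ASet) : Prop := ∃ R, IsWellOrd A R

/-- An ordinal of AS: a set together with a well-ordering of it. -/
structure Ordn where
  carrier : ASet
  rel : ASet
  wo : IsWellOrd carrier rel

/-- The set `S` is an initial segment of `A` with regard to `R`. -/
def IsInitSeg (S A R : ASet) : Prop :=
  Sub S A ∧ ∀ x ∈ S, ∀ y ∈ A, opair y x ∈ R → y ∈ S

def IsProperInitSeg (S A R : ASet) : Prop := IsInitSeg S A R ∧ S ≠ A

/-- `A` ordered by `R` is isomorphic to `B` ordered by `Q`; only the parts of `R` and `Q`
inside `A` and `B` matter. -/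
def IsoOrd (A R B Q : ASet) : Prop :=
  ∃ f, IsBijection f A B ∧ ∀ x ∈ A, ∀ y ∈ A, ∀ u ∈ B, ∀ v ∈ B,
    opair x u ∈ f → opair y v ∈ f → opair x y ∈ R → opair u v ∈ Q

/-- `α ≤_o β` -/
def LeO (α β : Ordn) : Prop :=
  ∃ S, IsInitSeg S β.carrier β.rel ∧ IsoOrd α.carrier α.rel S β.rel

/-- `α <_o β` -/
def LtO (α β : Ordn) : Prop :=
  ∃ S, IsProperInitSeg S β.carrier β.rel ∧ IsoOrd α.carrier α.rel S β.rel

/-- `α` is a predecessor of `β`: removing the single point `max β` from `β` leaves a set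
that is isomorphic to `α`. -/
def IsPredO (α β : Ordn) : Prop :=
  ∃ S, IsInitSeg S β.carrier β.rel ∧
    (∃ m ∈ β.carrier, m ∉ S ∧ ∀ x ∈ β.carrier, x ∈ S ∨ x = m) ∧
    IsoOrd α.carrier α.rel S β.rel

/-- A limit ordinal: nonempty and without predecessor. -/
def IsLimitO (α : Ordn) : Prop := α.carrier ≠ empty ∧ ¬ ∃ p, IsPredO p α

/-! ### Cantor-Bendixson degree -/

/-- `IterDerived A α D` says that `A^(α) = D`, where `A^(∅) = A`, `A^(α) = (A^(p))'` if `p` is a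
predecessor of `α`, and `A^(α) = {x | x ∈ A^(β) for every β <_o α}` if `α` is a limit ordinal. -/
inductive IterDerived (A : ASet) : Ordn → ASet → Prop
  | zero (α : Ordn) : α.carrier = empty → IterDerived A α A
  | succ (α p : Ordn) (D : ASet) : IsPredO p α → IterDerived A p D → IterDerived A α (derived D)
  | limit (α : Ordn) (f : Ordn → ASet) (D : ASet) : IsLimitO α →
      (∀ β, LtO β α → IterDerived A β (f β)) →
      (∀ x, x ∈ D ↔ ∀ β, LtO β α → x ∈ f β) → IterDerived A α D

/-- `A^(α)` has no accumulation points. -/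
def DerivedVanishes (A : ASet) (α : Ordn) : Prop := ∃ D, IterDerived A α D ∧ derived D = empty

/-- `α` is a Cantor-Bendixson rank of `A`: a smallest ordinal with `(A^(α))' = ∅`. -/
def IsCBRank (A : ASet) (α : Ordn) : Prop :=
  DerivedVanishes A α ∧ ∀ β, DerivedVanishes A β → LeO α β

/-- `D` is the Cantor-Bendixson degree `A^(α)`, `α` a Cantor-Bendixson rank of `A`. -/
def IsCBDegree (A D : ASet) : Prop := ∃ α, IsCBRank A α ∧ IterDerived A α D

/-- `d_CB(A) = 1` -/
def CBDegreeOne (A : ASet) : Prop := ∃ D, IsCBDegree A D ∧ EqC D (natOrd 1)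

/-! ### Cardinals -/

/-- A well-ordered cardinal: an ordinal that is not of the same cardinality as any of its proper
initial segments. -/
def Ordn.IsCardinal (κ : Ordn) : Prop :=
  ∀ S, IsProperInitSeg S κ.carrier κ.rel → ¬ EqC κ.carrier S

/-- The set `A`, with a suitable well-ordering, is a well-ordered cardinal. -/
def IsWOCardinal (A : ASet) : Prop := ∃ κ : Ordn, κ.carrier = A ∧ κ.IsCardinal

/-- `A` is (the underlying set of) a cardinal: a well-ordered one or a set that is not
well-orderable. -/
def IsCardinal (A : ASet) : Prop := IsWOCardinal A ∨ ¬ WellOrderable A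

/-- The cardinal `A` is a predecessor of the cardinal `B`. -/
def IsPredC (A B : ASet) : Prop :=
  LtC A B ∧ ¬ ∃ C, IsCardinal C ∧ LtC A C ∧ LtC C B

/-- A limit cardinal: a nonempty cardinal that has no predecessor. -/
def IsLimitCardinal (A : ASet) : Prop :=
  IsCardinal A ∧ A ≠ empty ∧ ¬ ∃ B, IsCardinal B ∧ IsPredC B A

/-- The cardinal `A` follows immediately after the cardinals `s 0, s 1, s 2, ...`. -/
def FollowsImmediately (A : ASet) (s : ℕ → ASet) : Prop :=
  (∀ i, LtC (s i) A) ∧ ∀ B, IsCardinal B → (∀ i, LtC (s i) B) → LeC A B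

/-- The sequence `A, 2 × A, 3 × A, ...`. -/
def multiples (A : ASet) : ℕ → ASet
  | 0 => A
  | n + 1 => prod (natOrd (n + 2)) A

/-- The ordering of `P` compares elements of `n × κ` lexicographically. -/
def IsLexOrder (n : ℕ) (κ P : Ordn) : Prop :=
  ∀ i < n, ∀ j < n, ∀ a ∈ κ.carrier, ∀ b ∈ κ.carrier,
    (opair (opair (natOrd i) a) (opair (natOrd j) b) ∈ P.rel ↔
      i < j ∨ (i = j ∧ opair a b ∈ κ.rel))

end AS

namespace AS

open Set Topology Filter

/-! ### The topology of approximations -/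

/-! The universe is an inverse limit of finite discrete spaces, hence a compact, metrizable,
zero-dimensional space. Its sets are exactly the closed classes, and a function that is itself a set
has a compact graph, hence is continuous. So `A ≤_c B` means that the closed class of elements of
`A` embeds topologically into that of `B` (`leC_iff`).

Upward isolation makes well-ordered sets countable (`IsWellOrd.countable`). By Baire category and
compactness, a nonempty countable closed class has a last nonempty Cantor-Bendixson derivative, of
some order `b`, with finitely many points, `n` in number (`HasType`). In the spirit of Mazurkiewicz
and Sierpiński, the pair `(b, n)` decides embeddability: it is the lexicographic comparison of pairs
(`HasType.emb_iff`), while an uncountable closed class receives every countable one. Thus cardinal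
comparisons become arithmetic with pairs. Multiplication by a finite `n` multiplies the degree by
`n`; multiplication by `ω` turns `(b, 1)` into `(b + 1, 1)`; the limit pairs are `(b, 1)` with `b ≠
0`; and a sequence that absorbs its predecessors has strictly increasing ranks, with `(sup, 1)`
immediately after it.

A nonempty well-ordered set is a cardinal exactly if its greatest element lies in the last
derivative (`Ordn.isCardinal_of_max_mem`, `Ordn.IsCardinal.max_mem`). Every countable closed class
can be well-ordered (`hasWO_of_countable`), and cutting a well-ordering at a point of a derivative
produces cardinals of prescribed type (`Ordn.exists_cardinal_hasType`).

It remains to match the internal degree, which iterates along ordinals of the universe, with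
derivatives indexed by Mathlib ordinals. Compactness gives a nonempty internal ordinal a greatest
element, so its order type is a successor; `Ordn.IsIndex` corrects for this shift. -/

instance finite_approx : ∀ n, Finite (Approx n)
  | 0 => inferInstanceAs (Finite Unit)
  | n + 1 => by
    have := finite_approx n
    exact inferInstanceAs (Finite (Set (Approx n)))

/-- The members of a hereditarily finite set of rank at most `n + 1`. -/
def Approx.toSet {n : ℕ} (A : Approx (n + 1)) : Set (Approx n) := A

/-- The hereditarily finite set of rank at most `n + 1` with the given members. -/
def Approx.ofSet {n : ℕ} (A : Set (Approx n)) : Approx (n + 1) := A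

theorem Approx.ext {n : ℕ} {A B : Approx (n + 1)} (h : A.toSet = B.toSet) : A = B := h

theorem toSet_hull (P : Set ASet) (n : ℕ) :
    ((hull P).approx (n + 1)).toSet = (fun x : ASet => x.approx n) '' P := rfl

instance (n : ℕ) : TopologicalSpace (Approx n) := ⊥

instance (n : ℕ) : DiscreteTopology (Approx n) := ⟨rfl⟩

instance : TopologicalSpace ASet := TopologicalSpace.induced ASet.approx inferInstance

theorem approx_injective : Function.Injective ASet.approx := fun _ _ h => ASet.ext h

theorem continuous_approx (n : ℕ) : Continuous fun x : ASet => x.approx n :=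
  (continuous_apply n).comp continuous_induced_dom

theorem isClosedEmbedding_approx : IsClosedEmbedding ASet.approx := by
  refine ⟨⟨⟨rfl⟩, approx_injective⟩, ?_⟩
  have : range ASet.approx = ⋂ n, {s : ∀ n, Approx n | trunc n (s (n + 1)) = s n} := by
    ext s
    simp only [mem_range, mem_iInter, mem_ofPred_eq]
    exact ⟨by rintro ⟨x, rfl⟩; exact x.coherent, fun h => ⟨⟨s, h⟩, rfl⟩⟩
  rw [this]
  exact isClosed_iInter fun n => isClosed_eq
    (continuous_of_discreteTopology.comp (continuous_apply (n + 1))) (continuous_apply n)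

instance : CompactSpace ASet := isClosedEmbedding_approx.compactSpace

instance : T2Space ASet := isClosedEmbedding_approx.isEmbedding.t2Space

instance : SecondCountableTopology ASet :=
  isClosedEmbedding_approx.isEmbedding.secondCountableTopology

theorem approx_eq_of_le {x y : ASet} {m n : ℕ} (hmn : m ≤ n) (h : x.approx n = y.approx n) :
    x.approx m = y.approx m := by
  induction n, hmn using Nat.le_induction with
  | base => exact h
  | succ n _ ih => exact ih (by rw [← x.coherent, ← y.coherent, h])

/-- The `n`-th neighbourhood of `x`. -/
def cyl (x : ASet) (n : ℕ) : Set ASet := {y | y.approx n = x.approx n}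

theorem cyl_anti (x : ASet) : Antitone (cyl x) := fun _ _ h _ hy => approx_eq_of_le h hy

theorem isClopen_cyl (x : ASet) (n : ℕ) : IsClopen (cyl x n) :=
  (isClopen_discrete {x.approx n}).preimage (continuous_approx n)

theorem nhds_hasBasis (x : ASet) : (𝓝 x).HasBasis (fun _ => True) (cyl x) := by
  refine ⟨fun t => ⟨fun ht => ?_, fun ⟨n, _, h⟩ =>
    mem_of_superset ((isClopen_cyl x n).isOpen.mem_nhds rfl) h⟩⟩
  rw [nhds_induced, mem_comap] at ht
  obtain ⟨u, hu, hut⟩ := ht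
  rw [nhds_pi, Filter.mem_pi] at hu
  obtain ⟨I, hI, s, hs, hsu⟩ := hu
  obtain ⟨N, hN⟩ := hI.bddAbove
  refine ⟨N, trivial, fun y hy => hut (hsu fun i hi => ?_)⟩
  rw [approx_eq_of_le (hN hi) hy]
  exact mem_of_mem_nhds (hs i)

theorem eq_of_forall_approx {x y : ASet} (h : ∀ n, x.approx n = y.approx n) : x = y :=
  ASet.ext (funext h)

theorem exists_approx_ne {x y : ASet} (h : x ≠ y) : ∃ n, x.approx n ≠ y.approx n := by
  by_contra! hc
  exact h (eq_of_forall_approx hc)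

/-! ### Sets of the universe are the closed classes -/

/-- The class of all elements of a set. -/
def els (A : ASet) : Set ASet := {x | x ∈ A}

@[simp] theorem mem_els {A x : ASet} : x ∈ els A ↔ x ∈ A := Iff.rfl

theorem isClosed_els (A : ASet) : IsClosed (els A) := by
  have : els A = ⋂ n, (fun x : ASet => x.approx n) ⁻¹' (A.approx (n + 1)).toSet := by
    ext x
    simp only [mem_iInter]
    rfl
  rw [this]
  exact isClosed_iInter fun n => (isClosed_discrete _).preimage (continuous_approx n)

theorem mem_hull_iff {P : Set ASet} {x : ASet} :
    x ∈ hull P ↔ ∀ n, ∃ y ∈ P, y.approx n = x.approx n := Iff.rfl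

theorem els_hull (P : Set ASet) : els (hull P) = closure P := by
  ext x
  rw [mem_closure_iff_nhds_basis (nhds_hasBasis x), mem_els, mem_hull_iff]
  exact ⟨fun h n _ => h n, fun h n => h n trivial⟩

theorem mem_hull_of_isClosed {P : Set ASet} (h : IsClosed P) {x : ASet} : x ∈ hull P ↔ x ∈ P := by
  rw [← mem_els, els_hull, h.closure_eq]

/-- A hereditarily finite set of rank at most `n` as a set of the universe. -/
def ofApprox : (n : ℕ) → Approx n → ASet
  | 0 => fun _ => empty
  | n + 1 => fun A => hull (ofApprox n '' A.toSet)

theorem approx_ofApprox : ∀ (n : ℕ) (u : Approx n), (ofApprox n u).approx n = u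
  | 0, _ => rfl
  | n + 1, u => by
    refine Approx.ext ?_
    rw [ofApprox, toSet_hull, image_image]
    simp only [approx_ofApprox n, image_id']

/-- König's lemma, in the form of compactness: every node of the tree of `A` lies on an infinite
branch. This yields extensionality in `els_injective`. -/
theorem exists_mem_approx_eq (A : ASet) (n : ℕ) (u : Approx n)
    (hu : u ∈ (A.approx (n + 1)).toSet) : ∃ x ∈ A, x.approx n = u := by
  -- Points extending `u` that stay in the tree of `A` up to level `n + m`: a decreasing sequence of
  -- nonempty closed classes, a common point of which is the desired element.
  let C : ℕ → Set ASet := fun m =>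
    {x | x.approx n = u} ∩ {x | x.approx (n + m) ∈ (A.approx (n + m + 1)).toSet}
  have hstep : ∀ (m : ℕ) (x : ASet), x.approx (m + 1) ∈ (A.approx (m + 2)).toSet →
      x.approx m ∈ (A.approx (m + 1)).toSet := by
    intro m x hx
    rw [← A.coherent (m + 1), ← x.coherent m]
    exact mem_image_of_mem _ hx
  have hne : ∀ m, (C m).Nonempty := by
    intro m
    induction m with
    | zero => exact ⟨ofApprox n u, approx_ofApprox n u, by
        change (ofApprox n u).approx n ∈ (A.approx (n + 1)).toSet
        rwa [approx_ofApprox n u]⟩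
    | succ m ih =>
      obtain ⟨x, hx1, hx2⟩ := ih
      change x.approx (n + m) ∈ (A.approx (n + m + 1)).toSet at hx2
      rw [← A.coherent (n + m + 1)] at hx2
      obtain ⟨w, hw, hwx⟩ := hx2
      refine ⟨ofApprox (n + m + 1) w, ?_, ?_⟩
      · refine Eq.trans (approx_eq_of_le (Nat.le_add_right n m) ?_) hx1
        rw [← ASet.coherent, approx_ofApprox, hwx]
      · change (ofApprox (n + m + 1) w).approx (n + m + 1) ∈ (A.approx (n + m + 2)).toSet
        rw [approx_ofApprox]
        exact hw
  have hcl : ∀ m, IsClosed (C m) := fun m =>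
    ((isClosed_discrete {u}).preimage (continuous_approx n)).inter
      ((isClosed_discrete _).preimage (continuous_approx (n + m)))
  obtain ⟨x, hx⟩ := IsCompact.nonempty_iInter_of_sequence_nonempty_isCompact_isClosed C
    (fun m x hx => ⟨hx.1, hstep _ x hx.2⟩) hne (hcl 0).isCompact hcl
  rw [mem_iInter] at hx
  refine ⟨x, fun k => ?_, (hx 0).1⟩
  have h : ∀ m k, x.approx (k + m) ∈ (A.approx (k + m + 1)).toSet →
      x.approx k ∈ (A.approx (k + 1)).toSet := by
    intro m k
    induction m with
    | zero => exact id
    | succ m ih => exact fun h => ih (hstep _ x h)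
  have := (hx k).2
  refine h n k ?_
  rw [Nat.add_comm k n]
  exact this

theorem toSet_approx (A : ASet) (n : ℕ) :
    (A.approx (n + 1)).toSet = (fun x : ASet => x.approx n) '' els A := by
  refine Set.ext fun u => ⟨fun hu => ?_, ?_⟩
  · obtain ⟨x, hx, h⟩ := exists_mem_approx_eq A n u hu
    exact ⟨x, hx, h⟩
  · rintro ⟨x, hx, rfl⟩
    exact hx n

theorem els_injective : Function.Injective els := by
  intro A B h
  refine eq_of_forall_approx fun n => ?_
  cases n with
  | zero => rfl
  | succ n => exact Approx.ext (by rw [toSet_approx, toSet_approx, h])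

theorem aset_ext {A B : ASet} (h : ∀ x, x ∈ A ↔ x ∈ B) : A = B := els_injective (Set.ext h)

theorem hull_els (A : ASet) : hull (els A) = A :=
  els_injective (by rw [els_hull, (isClosed_els A).closure_eq])

theorem els_hull_of_isClosed {P : Set ASet} (h : IsClosed P) : els (hull P) = P := by
  rw [els_hull, h.closure_eq]

/-! ### Pairs, products and relations -/

theorem not_mem_empty (x : ASet) : x ∉ empty := fun h =>
  (mem_hull_of_isClosed isClosed_empty).1 h

theorem els_empty : els empty = ∅ := eq_empty_of_forall_notMem not_mem_empty

theorem eq_empty_iff {A : ASet} : A = empty ↔ els A = ∅ :=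
  ⟨fun h => h ▸ els_empty, fun h => els_injective (h.trans els_empty.symm)⟩

theorem ne_empty_iff {A : ASet} : A ≠ empty ↔ (els A).Nonempty := by
  rw [Ne, eq_empty_iff, nonempty_iff_ne_empty]

@[simp] theorem mem_pair {a b x : ASet} : x ∈ pair a b ↔ x = a ∨ x = b :=
  mem_hull_of_isClosed (Set.toFinite _).isClosed

@[simp] theorem mem_singleton {a x : ASet} : x ∈ singleton a ↔ x = a :=
  mem_hull_of_isClosed (Set.toFinite _).isClosed

@[simp] theorem mem_union {A B x : ASet} : x ∈ union A B ↔ x ∈ A ∨ x ∈ B :=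
  mem_hull_of_isClosed ((isClosed_els A).union (isClosed_els B))

theorem singleton_eq_pair (a : ASet) : singleton a = pair a a :=
  aset_ext fun x => by simp

theorem pair_left_injective {a b c : ASet} (h : pair a b = pair a c) : b = c := by
  have h1 : b ∈ pair a c := h ▸ mem_pair.2 (Or.inr rfl)
  have h2 : c ∈ pair a b := h ▸ mem_pair.2 (Or.inr rfl)
  rw [mem_pair] at h1 h2
  grind

theorem opair_inj {a b c d : ASet} : opair a b = opair c d ↔ a = c ∧ b = d := by
  refine ⟨fun h => ?_, fun ⟨h1, h2⟩ => by rw [h1, h2]⟩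
  have hac : a = c := by
    have h1 : singleton c ∈ opair a b := h ▸ mem_pair.2 (Or.inl rfl)
    rcases mem_pair.1 h1 with h2 | h2
    · exact mem_singleton.1 (h2 ▸ mem_singleton.2 rfl : a ∈ singleton c)
    · exact mem_singleton.1 (h2 ▸ mem_pair.2 (Or.inl rfl) : a ∈ singleton c)
  subst hac
  exact ⟨rfl, pair_left_injective (pair_left_injective h)⟩

theorem continuous_iff_approx {X : Type*} [TopologicalSpace X] {f : X → ASet} :
    Continuous f ↔ ∀ n, Continuous fun x => (f x).approx n :=
  continuous_induced_rng.trans continuous_pi_iff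

theorem approx_pair (a b : ASet) (n : ℕ) :
    (pair a b).approx (n + 1) = Approx.ofSet {a.approx n, b.approx n} :=
  image_pair (fun x : ASet => x.approx n) a b

theorem Continuous.pair {X : Type*} [TopologicalSpace X] {f g : X → ASet} (hf : Continuous f)
    (hg : Continuous g) : Continuous fun x => pair (f x) (g x) := by
  refine continuous_iff_approx.2 fun n => ?_
  cases n with
  | zero => exact continuous_const
  | succ n =>
    simp only [approx_pair]
    exact (continuous_of_discreteTopology
      (f := fun p : Approx n × Approx n => Approx.ofSet {p.1, p.2})).comp
      ((continuous_iff_approx.1 hf n).prodMk (continuous_iff_approx.1 hg n))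

theorem Continuous.opair {X : Type*} [TopologicalSpace X] {f g : X → ASet} (hf : Continuous f)
    (hg : Continuous g) : Continuous fun x => opair (f x) (g x) := by
  unfold AS.opair
  simp only [singleton_eq_pair]
  exact Continuous.pair (Continuous.pair hf hf) (Continuous.pair hf hg)

theorem continuous_opair : Continuous fun p : ASet × ASet => opair p.1 p.2 :=
  Continuous.opair continuous_fst continuous_snd

theorem opair_injective : Function.Injective fun p : ASet × ASet => opair p.1 p.2 :=
  fun _ _ h => Prod.ext_iff.2 (opair_inj.1 h)

theorem isClosedEmbedding_opair : IsClosedEmbedding fun p : ASet × ASet => opair p.1 p.2 :=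
  continuous_opair.isClosedEmbedding opair_injective

theorem els_prod (A B : ASet) :
    els (prod A B) = (fun p : ASet × ASet => opair p.1 p.2) '' (els A ×ˢ els B) := by
  have : {p | ∃ a ∈ A, ∃ b ∈ B, p = opair a b} =
      (fun p : ASet × ASet => opair p.1 p.2) '' (els A ×ˢ els B) := by
    ext p
    constructor
    · rintro ⟨a, ha, b, hb, rfl⟩
      exact ⟨(a, b), ⟨ha, hb⟩, rfl⟩
    · rintro ⟨⟨a, b⟩, ⟨ha, hb⟩, rfl⟩
      exact ⟨a, ha, b, hb, rfl⟩
  unfold prod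
  rw [this]
  exact els_hull_of_isClosed (isClosedEmbedding_opair.isClosedMap _
    ((isClosed_els A).prod (isClosed_els B)))

theorem mem_prod {A B p : ASet} : p ∈ prod A B ↔ ∃ a ∈ A, ∃ b ∈ B, p = opair a b := by
  rw [← mem_els, els_prod]
  constructor
  · rintro ⟨⟨a, b⟩, ⟨ha, hb⟩, rfl⟩
    exact ⟨a, ha, b, hb, rfl⟩
  · rintro ⟨a, ha, b, hb, rfl⟩
    exact ⟨(a, b), ⟨ha, hb⟩, rfl⟩

@[simp] theorem opair_mem_prod {A B a b : ASet} : opair a b ∈ prod A B ↔ a ∈ A ∧ b ∈ B := by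
  rw [mem_prod]
  constructor
  · rintro ⟨c, hc, d, hd, h⟩
    obtain ⟨rfl, rfl⟩ := opair_inj.1 h
    exact ⟨hc, hd⟩
  · exact fun ⟨ha, hb⟩ => ⟨a, ha, b, hb, rfl⟩

/-- The relation with the given graph, as a set of the universe. -/
def ofRel (C : Set (ASet × ASet)) : ASet := hull ((fun p : ASet × ASet => opair p.1 p.2) '' C)

theorem mem_ofRel {C : Set (ASet × ASet)} (hC : IsClosed C) {p : ASet} :
    p ∈ ofRel C ↔ ∃ a b, (a, b) ∈ C ∧ p = opair a b := by
  unfold ofRel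
  rw [mem_hull_of_isClosed (isClosedEmbedding_opair.isClosedMap _ hC)]
  constructor
  · rintro ⟨⟨a, b⟩, h, rfl⟩
    exact ⟨a, b, h, rfl⟩
  · rintro ⟨a, b, h, rfl⟩
    exact ⟨(a, b), h, rfl⟩

theorem opair_mem_ofRel {C : Set (ASet × ASet)} (hC : IsClosed C) {a b : ASet} :
    opair a b ∈ ofRel C ↔ (a, b) ∈ C := by
  rw [mem_ofRel hC]
  constructor
  · rintro ⟨c, d, h, he⟩
    obtain ⟨rfl, rfl⟩ := opair_inj.1 he
    exact h
  · exact fun h => ⟨a, b, h, rfl⟩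

theorem isClosed_rel (R : ASet) : IsClosed {p : ASet × ASet | opair p.1 p.2 ∈ R} :=
  (isClosed_els R).preimage continuous_opair

theorem isClosed_graph {S : Set ASet} (hS : IsClosed S) {f : ASet → ASet}
    (hf : ContinuousOn f S) : IsClosed {p : ASet × ASet | p.1 ∈ S ∧ p.2 = f p.1} := by
  have : {p : ASet × ASet | p.1 ∈ S ∧ p.2 = f p.1} = (fun x => (x, f x)) '' S := by
    ext ⟨x, y⟩
    simp only [mem_ofPred_eq, mem_image, Prod.mk.injEq]
    constructor
    · rintro ⟨h, rfl⟩
      exact ⟨x, h, rfl, rfl⟩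
    · rintro ⟨z, hz, rfl, rfl⟩
      exact ⟨hz, rfl⟩
  rw [this]
  exact (hS.isCompact.image_of_continuousOn (continuousOn_id.prodMk hf)).isClosed

/-- `S` embeds topologically into `T`. -/
def Emb (S T : Set ASet) : Prop := ∃ f : ASet → ASet, ContinuousOn f S ∧ MapsTo f S T ∧ InjOn f S

theorem Emb.of_subset {S T : Set ASet} (h : S ⊆ T) : Emb S T :=
  ⟨id, continuousOn_id, h, injOn_id S⟩

theorem Emb.trans {S T U : Set ASet} : Emb S T → Emb T U → Emb S U := by
  rintro ⟨f, hf1, hf2, hf3⟩ ⟨g, hg1, hg2, hg3⟩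
  exact ⟨g ∘ f, hg1.comp hf1 hf2, hg2.comp hf2, hg3.comp hf3 hf2⟩

/-- A total functional relation of the universe is the graph of a continuous function. -/
theorem exists_continuousOn_of_functional {f A : ASet} (tot : ∀ a ∈ A, ∃ b, opair a b ∈ f)
    (fct : ∀ a b c, opair a b ∈ f → opair a c ∈ f → b = c) :
    ∃ g : ASet → ASet, ContinuousOn g (els A) ∧ ∀ a ∈ A, ∀ b, opair a b ∈ f ↔ b = g a := by
  choose! g hg using tot
  have hgf : ∀ a ∈ A, ∀ b, opair a b ∈ f ↔ b = g a := fun a ha b =>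
    ⟨fun h => fct _ _ _ h (hg a ha), fun h => h ▸ hg a ha⟩
  refine ⟨g, ?_, hgf⟩
  rw [continuousOn_iff_isClosed]
  intro t ht
  -- The preimage of a closed class is the projection of a compact part of the graph.
  refine ⟨Prod.fst '' ({p : ASet × ASet | opair p.1 p.2 ∈ f} ∩ Prod.snd ⁻¹' t), ?_, ?_⟩
  · exact (((isClosed_rel f).inter (ht.preimage continuous_snd)).isCompact.image
      continuous_fst).isClosed
  · ext x
    constructor
    · rintro ⟨h1, h2⟩
      exact ⟨⟨(x, g x), ⟨hg x h2, h1⟩, rfl⟩, h2⟩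
    · rintro ⟨⟨⟨y, z⟩, ⟨h1, h2⟩, rfl⟩, h3⟩
      have := (hgf y h3 z).1 h1
      subst this
      exact ⟨h2, h3⟩

/-- Between compact Hausdorff classes, a closed graph and continuity amount to the same; this turns
all cardinal comparisons into topology. -/
theorem leC_iff {A B : ASet} : LeC A B ↔ Emb (els A) (els B) := by
  constructor
  · rintro ⟨f, hf⟩
    obtain ⟨g, hg, hgf⟩ := exists_continuousOn_of_functional
      (fun a ha => (hf.total a ha).imp fun _ h => h.2) hf.functional
    refine ⟨g, hg, fun a ha => ?_, fun a ha b hb h => ?_⟩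
    · exact (opair_mem_prod.1 (hf.rel _ ((hgf a ha _).2 rfl))).2
    · exact hf.injective a b (g a) ((hgf a ha _).2 rfl) ((hgf b hb _).2 h)
  · rintro ⟨g, hg, hm, hi⟩
    have hC := isClosed_graph (isClosed_els A) hg
    refine ⟨ofRel {p | p.1 ∈ els A ∧ p.2 = g p.1}, ⟨?_, ?_, ?_, ?_⟩⟩
    · intro p hp
      obtain ⟨a, b, ⟨h1, h2⟩, rfl⟩ := (mem_ofRel hC).1 hp
      have h2 : b = g a := h2
      exact opair_mem_prod.2 ⟨h1, h2 ▸ hm h1⟩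
    · exact fun a ha => ⟨g a, hm ha, (opair_mem_ofRel hC).2 ⟨ha, rfl⟩⟩
    · intro a b c h1 h2
      have h1 := ((opair_mem_ofRel hC).1 h1).2
      have h2 := ((opair_mem_ofRel hC).1 h2).2
      exact h1.trans h2.symm
    · intro a b c h1 h2
      have h1 := (opair_mem_ofRel hC).1 h1
      have h2 := (opair_mem_ofRel hC).1 h2
      exact hi h1.1 h2.1 (h1.2.symm.trans h2.2)

theorem eqC_iff {A B : ASet} : EqC A B ↔ Emb (els A) (els B) ∧ Emb (els B) (els A) :=
  and_congr leC_iff leC_iff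

theorem ltC_iff {A B : ASet} : LtC A B ↔ Emb (els A) (els B) ∧ ¬ Emb (els B) (els A) := by
  unfold LtC
  rw [leC_iff, eqC_iff]
  tauto

/-! ### Finite ordinals -/

theorem mem_natOrd {n : ℕ} {x : ASet} : x ∈ natOrd n ↔ ∃ k < n, x = natOrd k := by
  induction n with
  | zero => exact ⟨fun h => (not_mem_empty x h).elim, fun ⟨k, hk, _⟩ => by omega⟩
  | succ n ih =>
    rw [natOrd, mem_union, mem_singleton, ih]
    constructor
    · rintro (⟨k, hk, rfl⟩ | rfl)
      · exact ⟨k, by omega, rfl⟩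
      · exact ⟨n, by omega, rfl⟩
    · rintro ⟨k, hk, rfl⟩
      rcases Nat.lt_succ_iff_lt_or_eq.1 hk with h | rfl
      · exact Or.inl ⟨k, h, rfl⟩
      · exact Or.inr rfl

theorem natOrd_not_mem_self (n : ℕ) : natOrd n ∉ natOrd n := by
  induction n using Nat.strong_induction_on with
  | _ n ih =>
    intro h
    obtain ⟨k, hk, he⟩ := mem_natOrd.1 h
    exact ih k hk (he ▸ h)

theorem natOrd_injective : Function.Injective natOrd := by
  have : ∀ i j, i < j → natOrd i ≠ natOrd j := fun i j h he =>
    natOrd_not_mem_self i (he.symm ▸ (mem_natOrd.2 ⟨i, h, rfl⟩ : natOrd i ∈ natOrd j))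
  intro i j h
  rcases lt_trichotomy i j with h1 | h1 | h1
  · exact (this i j h1 h).elim
  · exact h1
  · exact (this j i h1 h.symm).elim

/-- At depth `m` all finite ordinals from `m` on look alike, so the finite ordinals converge. -/
theorem approx_natOrd (m : ℕ) : ∀ n, m ≤ n → (natOrd n).approx m = (natOrd m).approx m := by
  induction m with
  | zero => exact fun _ _ => rfl
  | succ m ih =>
    have key : ∀ n, m + 1 ≤ n → ((natOrd n).approx (m + 1)).toSet =
        (fun k => (natOrd k).approx m) '' {k | k ≤ m} := by
      intro n hn
      rw [toSet_approx]
      refine Set.ext fun u => ⟨?_, ?_⟩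
      · rintro ⟨x, hx, rfl⟩
        obtain ⟨k, hk, rfl⟩ := mem_natOrd.1 hx
        rcases le_total k m with h | h
        · exact ⟨k, h, rfl⟩
        · exact ⟨m, le_refl m, (ih k h).symm⟩
      · rintro ⟨k, hk, rfl⟩
        have hk : k ≤ m := hk
        exact ⟨natOrd k, mem_natOrd.2 ⟨k, by omega, rfl⟩, rfl⟩
    exact fun n hn => Approx.ext ((key n hn).trans (key _ le_rfl).symm)

/-- The limit of the finite ordinals. -/
def natLim : ASet where
  approx m := (natOrd m).approx m
  coherent m := by rw [ASet.coherent, approx_natOrd m (m + 1) (Nat.le_succ m)]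

theorem approx_natLim {m n : ℕ} (h : m ≤ n) : (natOrd n).approx m = natLim.approx m :=
  approx_natOrd m n h

theorem tendsto_natOrd : Tendsto natOrd atTop (𝓝 natLim) :=
  (nhds_hasBasis natLim).tendsto_right_iff.2 fun m _ =>
    (eventually_ge_atTop m).mono fun _ h => approx_natLim h

theorem natOrd_ne_natLim (n : ℕ) : natOrd n ≠ natLim := by
  intro h
  refine natOrd_not_mem_self n ?_
  -- The limit contains every finite ordinal, so equality would make `natOrd n` a member of itself.
  have : natOrd n ∈ natLim := fun m => by
    have := (mem_natOrd.2 ⟨n, by omega, rfl⟩ : natOrd n ∈ natOrd (n + m + 1)) m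
    rwa [approx_natLim (by omega)] at this
  rwa [← h] at this

theorem els_omega : els omega = insert natLim (range natOrd) := by
  unfold omega
  rw [els_hull]
  refine Subset.antisymm (closure_minimal (subset_insert _ _) ?_) (insert_subset ?_ subset_closure)
  · exact tendsto_natOrd.isCompact_insert_range.isClosed
  · exact mem_closure_of_tendsto tendsto_natOrd (Eventually.of_forall mem_range_self)

/-- Finite ordinals are isolated in `ω`. -/
theorem exists_approx_natOrd_isolated (n : ℕ) :
    ∃ m, ∀ x ∈ omega, x.approx m = (natOrd n).approx m → x = natOrd n := by
  obtain ⟨k, hk⟩ := exists_approx_ne (natOrd_ne_natLim n)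
  have h : ∀ j, ∃ m, natOrd j ≠ natOrd n → (natOrd j).approx m ≠ (natOrd n).approx m := fun j => by
    by_cases h : natOrd j = natOrd n
    · exact ⟨0, fun h' => (h' h).elim⟩
    · exact (exists_approx_ne h).imp fun _ h _ => h
  choose g hg using h
  refine ⟨k + (Finset.range k).sup g, fun x hx hxn => ?_⟩
  have hx : x ∈ els omega := hx
  rw [els_omega] at hx
  rcases hx with rfl | ⟨j, rfl⟩
  · exact (hk (approx_eq_of_le (by omega) hxn).symm).elim
  · by_contra hne
    by_cases hj : j < k
    · exact hg j hne (approx_eq_of_le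
        ((Finset.le_sup (f := g) (Finset.mem_range.2 hj)).trans (by omega)) hxn)
    · refine hk ?_
      rw [← approx_natLim (le_of_not_gt hj)]
      exact (approx_eq_of_le (by omega) hxn).symm

/-! ### Iterated derivatives -/

/-- `x` is an accumulation point of the class `S`. -/
def AccIn (S : Set ASet) (x : ASet) : Prop := ∀ n, ∃ y ∈ S, y ≠ x ∧ y ∈ cyl x n

theorem AccIn.mono {S T : Set ASet} (h : S ⊆ T) {x : ASet} (hx : AccIn S x) : AccIn T x :=
  fun n => (hx n).imp fun _ hy => ⟨h hy.1, hy.2⟩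

theorem AccIn.mem {S : Set ASet} (h : IsClosed S) {x : ASet} (hx : AccIn S x) : x ∈ S := by
  rw [← h.closure_eq, mem_closure_iff_nhds_basis (nhds_hasBasis x)]
  exact fun n _ => (hx n).imp fun _ hy => ⟨hy.1, hy.2.2⟩

theorem accIn_iff_accPt {S : Set ASet} {x : ASet} : AccIn S x ↔ AccPt x (𝓟 S) := by
  rw [accPt_iff_nhds]
  constructor
  · intro h U hU
    obtain ⟨n, -, hn⟩ := (nhds_hasBasis x).mem_iff.1 hU
    obtain ⟨y, hy, hne, hyn⟩ := h n
    exact ⟨y, ⟨hn hyn, hy⟩, hne⟩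
  · intro h n
    obtain ⟨y, hy, hne⟩ := h _ ((isClopen_cyl x n).isOpen.mem_nhds rfl)
    exact ⟨y, hy.2, hne, hy.1⟩

theorem exists_cyl_subset {U : Set ASet} (hU : IsOpen U) {x : ASet} (hx : x ∈ U) :
    ∃ n, cyl x n ⊆ U := by
  simpa using (nhds_hasBasis x).mem_iff.1 (hU.mem_nhds hx)

theorem isClosed_accIn (S : Set ASet) : IsClosed {x | AccIn S x} := by
  refine isClosed_of_closure_subset fun x hx n => ?_
  obtain ⟨z, hz, hzn⟩ := (mem_closure_iff_nhds_basis (nhds_hasBasis x)).1 hx n trivial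
  by_cases hzx : z = x
  · exact (hzx ▸ hz : AccIn S x) n
  · obtain ⟨k, hk⟩ := exists_approx_ne hzx
    obtain ⟨y, hy, -, hyz⟩ := hz (max n k)
    refine ⟨y, hy, ?_, ?_⟩
    · rintro rfl
      exact hk (approx_eq_of_le (le_max_right n k) hyz).symm
    · exact (approx_eq_of_le (le_max_left n k) hyz).trans hzn

/-- The iterated Cantor-Bendixson derivatives of a class. -/
def CB (S : Set ASet) (o : Ordinal.{0}) : Set ASet :=
  {x | x ∈ S ∧ ∀ p, p < o → AccIn (CB S p) x}
termination_by o

/-- The recursion demands accumulation of all earlier derivatives, and so treats zero, successor and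
limit stages uniformly. -/
theorem mem_CB {S : Set ASet} {o : Ordinal.{0}} {x : ASet} :
    x ∈ CB S o ↔ x ∈ S ∧ ∀ p < o, AccIn (CB S p) x := by
  rw [CB]
  rfl

theorem CB_subset (S : Set ASet) (o : Ordinal.{0}) : CB S o ⊆ S := fun _ h => (mem_CB.1 h).1

theorem CB_zero (S : Set ASet) : CB S 0 = S :=
  Subset.antisymm (CB_subset S 0) fun _ h => mem_CB.2 ⟨h, fun _ hp => (not_lt_zero hp).elim⟩

theorem CB_anti (S : Set ASet) : Antitone (CB S) := fun _ _ h _ hx =>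
  mem_CB.2 ⟨CB_subset _ _ hx, fun p hp => (mem_CB.1 hx).2 p (hp.trans_le h)⟩

theorem isClosed_CB {S : Set ASet} (hS : IsClosed S) (o : Ordinal.{0}) : IsClosed (CB S o) := by
  have : CB S o = S ∩ ⋂ p, ⋂ _ : p < o, {x | AccIn (CB S p) x} := by
    ext x
    rw [mem_CB, mem_inter_iff, mem_iInter₂]
    rfl
  rw [this]
  exact hS.inter (isClosed_iInter fun p => isClosed_iInter fun _ => isClosed_accIn _)

theorem mem_CB_succ {S : Set ASet} (hS : IsClosed S) {o : Ordinal.{0}} {x : ASet} :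
    x ∈ CB S (o + 1) ↔ AccIn (CB S o) x := by
  rw [mem_CB]
  constructor
  · exact fun h => h.2 o (Order.lt_add_one_iff.2 le_rfl)
  · exact fun h => ⟨CB_subset _ _ (h.mem (isClosed_CB hS o)), fun p hp =>
      h.mono (CB_anti S (Order.lt_add_one_iff.1 hp))⟩

theorem mem_CB_of_isSuccLimit {S : Set ASet} {o : Ordinal.{0}} (ho : Order.IsSuccLimit o)
    {x : ASet} (h : ∀ p < o, x ∈ CB S p) : x ∈ CB S o := by
  refine mem_CB.2 ⟨CB_subset _ _ (h 0 ho.bot_lt), fun p hp => ?_⟩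
  exact (mem_CB.1 (h (p + 1) (by simpa using ho.succ_lt hp))).2 p (Order.lt_add_one_iff.2 le_rfl)

theorem CB_mono {S T : Set ASet} (h : S ⊆ T) (o : Ordinal.{0}) : CB S o ⊆ CB T o := by
  induction o using WellFoundedLT.induction with
  | ind o ih => exact fun x hx => mem_CB.2 ⟨h (CB_subset _ _ hx), 
      fun p hp => ((mem_CB.1 hx).2 p hp).mono (ih p hp)⟩

theorem AccIn.inter_isOpen {S U : Set ASet} (hU : IsOpen U) {x : ASet} (hx : x ∈ U)
    (h : AccIn S x) : AccIn (S ∩ U) x := by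
  intro n
  obtain ⟨k, hk⟩ := exists_cyl_subset hU hx
  obtain ⟨y, hy, hne, hyn⟩ := h (max n k)
  exact ⟨y, ⟨hy, hk (cyl_anti x (le_max_right n k) hyn)⟩, hne, cyl_anti x (le_max_left n k) hyn⟩

/-- Accumulation is a local matter, so derivatives may be computed inside open pieces. This is what
allows embeddings to be built piece by piece. -/
theorem CB_inter_isOpen (S : Set ASet) {U : Set ASet} (hU : IsOpen U) (o : Ordinal.{0}) :
    CB (S ∩ U) o = CB S o ∩ U := by
  refine Subset.antisymm (fun x hx => ⟨CB_mono inter_subset_left o hx, (CB_subset _ _ hx).2⟩) ?_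
  induction o using WellFoundedLT.induction with
  | ind o ih =>
    exact fun x hx => mem_CB.2 ⟨⟨CB_subset _ _ hx.1, hx.2⟩, fun p hp =>
      (((mem_CB.1 hx.1).2 p hp).inter_isOpen hU hx.2).mono (ih p hp)⟩

theorem continuousOn_iff_cyl {f : ASet → ASet} {S : Set ASet} :
    ContinuousOn f S ↔ ∀ x ∈ S, ∀ n, ∃ m, ∀ y ∈ S, y ∈ cyl x m → f y ∈ cyl (f x) n := by
  refine forall₂_congr fun x _ => ?_
  rw [ContinuousWithinAt, (nhdsWithin_hasBasis (nhds_hasBasis x) S).tendsto_iff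
    (nhds_hasBasis (f x))]
  simp only [true_implies, true_and, mem_inter_iff]
  exact forall_congr' fun n => exists_congr fun m =>
    ⟨fun h y h1 h2 => h y ⟨h2, h1⟩, fun h y hy => h y hy.2 hy.1⟩

/-- Continuity keeps the images of nearby points nearby, and injectivity keeps them distinct from
the image of the point. Hence the sizes of derivatives are monotone under embeddings. -/
theorem mapsTo_CB {f : ASet → ASet} {S T : Set ASet} (hf : ContinuousOn f S) (hm : MapsTo f S T)
    (hi : InjOn f S) (o : Ordinal.{0}) : MapsTo f (CB S o) (CB T o) := by
  induction o using WellFoundedLT.induction with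
  | ind o ih =>
    intro x hx
    have hxS := CB_subset _ _ hx
    refine mem_CB.2 ⟨hm hxS, fun p hp n => ?_⟩
    obtain ⟨m, h⟩ := continuousOn_iff_cyl.1 hf x hxS n
    obtain ⟨y, hy, hne, hyx⟩ := (mem_CB.1 hx).2 p hp m
    have hyS := CB_subset _ _ hy
    exact ⟨f y, ih p hp hy, fun he => hne (hi hyS hxS he), h y hyS hyx⟩

theorem Emb.encard_CB_le {S T : Set ASet} (h : Emb S T) (o : Ordinal.{0}) :
    (CB S o).encard ≤ (CB T o).encard := by
  obtain ⟨f, h1, h2, h3⟩ := h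
  exact encard_le_encard_of_injOn (mapsTo_CB h1 h2 h3 o) (h3.mono (CB_subset S o))

/-- Limit derivatives are intersections, so a point can disappear only at a successor stage. -/
theorem exists_last_CB {S : Set ASet} {x : ASet} (hx : x ∈ S) {o : Ordinal.{0}}
    (ho : x ∉ CB S o) : ∃ b < o, x ∈ CB S b ∧ x ∉ CB S (b + 1) := by
  induction o using WellFoundedLT.induction with
  | ind o ih =>
    rcases Ordinal.zero_or_succ_or_isSuccLimit o with rfl | ⟨b, rfl⟩ | hl
    · exact (ho (by rwa [CB_zero])).elim
    · by_cases hb : x ∈ CB S b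
      · exact ⟨b, by simp, hb, ho⟩
      · obtain ⟨c, hc, h⟩ := ih b (by simp) hb
        exact ⟨c, hc.trans (by simp), h⟩
    · by_contra hc
      refine ho (mem_CB_of_isSuccLimit hl fun p hp => ?_)
      by_contra hp'
      obtain ⟨c, hc', h⟩ := ih p hp hp'
      exact hc ⟨c, hc'.trans hp, h⟩

/-! ### Countable closed classes -/

/-- Baire category: a nonempty compact class that is a countable union of singletons has a singleton
with nonempty interior. -/
theorem exists_isolated {K : Set ASet} (hK : IsClosed K) (hc : K.Countable) (hne : K.Nonempty) :
    ∃ z ∈ K, ∃ n, ∀ y ∈ K, y ∈ cyl z n → y = z := by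
  have := hc.to_subtype
  have := hne.to_subtype
  have := isCompact_iff_compactSpace.1 hK.isCompact
  obtain ⟨z, w, hw⟩ := nonempty_interior_of_iUnion_of_closed (X := K) (f := fun z : K => {z})
    (fun _ => isClosed_singleton) (by ext; simp)
  have hzw : w = z := (interior_subset hw : w ∈ ({z} : Set K))
  subst hzw
  obtain ⟨U, hU, hUw⟩ := mem_nhds_subtype K w _ |>.1 (mem_interior_iff_mem_nhds.1 hw)
  obtain ⟨n, -, hn⟩ := (nhds_hasBasis w.1).mem_iff.1 hU
  exact ⟨w, w.2, n, fun y hy hyn => congrArg Subtype.val (hUw (hn hyn) : (⟨y, hy⟩ : K) = w)⟩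

theorem exists_notMem_CB {S : Set ASet} (hS : IsClosed S) (hc : S.Countable) (x : ASet) :
    ∃ o, x ∉ CB S o := by
  by_contra! hx
  obtain ⟨z, hz, n, hn⟩ := exists_isolated (K := ⋂ o, CB S o)
    (isClosed_iInter fun o => isClosed_CB hS o)
    (hc.mono ((iInter_subset _ 0).trans (CB_subset S 0))) ⟨x, mem_iInter.2 hx⟩
  have h : ∀ y : S, ∃ o, y.1 ∉ ⋂ o, CB S o → y.1 ∉ CB S o := by
    intro y
    by_cases hy : y.1 ∈ ⋂ o, CB S o
    · exact ⟨0, fun h => (h hy).elim⟩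
    · rw [mem_iInter, not_forall] at hy
      exact hy.imp fun _ h _ => h
  choose g hg using h
  -- By stage `⨆ y, g y` every point outside the intersection of all derivatives has been removed;
  -- yet `z` still accumulates points there, although it is isolated in that intersection.
  have := (mem_CB_succ hS).1 (mem_iInter.1 hz ((⨆ y, g y) + 1)) n
  obtain ⟨y, hy, hne, hyz⟩ := this
  refine hg ⟨y, CB_subset _ _ hy⟩ (fun h => hne (hn y h hyz))
    (CB_anti S (Ordinal.le_iSup g _) hy)

/-- The class `S` has Cantor-Bendixson rank `b` and its last derivative has `n > 0` points. -/
structure HasType (S : Set ASet) (b : Ordinal.{0}) (n : ℕ) : Prop where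
  encard_eq : (CB S b).encard = n
  pos : 0 < n

theorem HasType.nonempty_CB {S : Set ASet} {b : Ordinal.{0}} {n : ℕ} (h : HasType S b n) :
    (CB S b).Nonempty := by
  rw [← one_le_encard_iff_nonempty, h.encard_eq]
  exact_mod_cast h.pos

theorem HasType.nonempty {S : Set ASet} {b : Ordinal.{0}} {n : ℕ} (h : HasType S b n) :
    S.Nonempty := h.nonempty_CB.mono (CB_subset S b)

theorem HasType.finite {S : Set ASet} {b : Ordinal.{0}} {n : ℕ} (h : HasType S b n) :
    (CB S b).Finite := finite_of_encard_eq_coe h.encard_eq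

theorem finite_isolated {F : Set ASet} (hF : F.Finite) (y : ASet) :
    ∃ m, ∀ z ∈ F, z ∈ cyl y m → z = y := by
  obtain ⟨m, hm⟩ := exists_cyl_subset (U := (F \ {y})ᶜ) (x := y)
    (hF.subset sdiff_subset).isClosed.isOpen_compl (by simp)
  exact ⟨m, fun z hz hzy => by_contra fun hne => hm hzy ⟨hz, hne⟩⟩

theorem finite_not_accIn {F : Set ASet} (hF : F.Finite) (y : ASet) : ¬ AccIn F y := fun h => by
  obtain ⟨m, hm⟩ := finite_isolated hF y
  obtain ⟨z, hz, hne, hzm⟩ := h m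
  exact hne (hm z hz hzm)

theorem CB_succ_eq_empty_iff {S : Set ASet} (hS : IsClosed S) {b : Ordinal.{0}} :
    CB S (b + 1) = ∅ ↔ (CB S b).Finite := by
  constructor
  · intro h
    by_contra hinf
    obtain ⟨x, -, hx⟩ := Set.Infinite.exists_accPt_of_subset_isCompact hinf
      (isClosed_CB hS b).isCompact Subset.rfl
    exact (h ▸ (mem_CB_succ hS).2 (accIn_iff_accPt.2 hx) : x ∈ (∅ : Set ASet))
  · exact fun h => eq_empty_of_forall_notMem fun x hx =>
      finite_not_accIn h x ((mem_CB_succ hS).1 hx)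

theorem CB_encard_eq_top {S : Set ASet} (hS : IsClosed S) {b c : Ordinal.{0}} (hbc : b < c)
    (h : (CB S c).Nonempty) : (CB S b).encard = ⊤ := by
  rw [encard_eq_top_iff, Set.Infinite, ← CB_succ_eq_empty_iff hS]
  exact (h.mono (CB_anti S (Order.add_one_le_of_lt hbc))).ne_empty

theorem exists_hasType {S : Set ASet} (hS : IsClosed S) (hc : S.Countable) (hne : S.Nonempty) :
    ∃ b n, HasType S b n := by
  have hex : ∃ o, CB S o = ∅ := by
    choose g hg using fun y : S => exists_notMem_CB hS hc y.1
    refine ⟨⨆ y, g y, eq_empty_of_forall_notMem fun y hy => ?_⟩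
    exact hg ⟨y, CB_subset _ _ hy⟩ (CB_anti S (Ordinal.le_iSup g _) hy)
  have key : ∀ o, CB S o = ∅ → ∃ b, (CB S b).Nonempty ∧ CB S (b + 1) = ∅ := by
    intro o
    induction o using WellFoundedLT.induction with
    | ind o ih =>
      intro ho
      rcases Ordinal.zero_or_succ_or_isSuccLimit o with rfl | ⟨b, rfl⟩ | hl
      · rw [CB_zero] at ho
        exact (hne.ne_empty ho).elim
      · rcases eq_empty_or_nonempty (CB S b) with hb | hb
        · exact ih b (by simp) hb
        · exact ⟨b, hb, ho⟩
      -- The derivatives cannot first become empty at a limit stage: a decreasing family of nonempty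
      -- compact classes has a common point.
      · by_contra hcon
        have hne' : ∀ p : Iio o, (CB S p).Nonempty := fun p =>
          nonempty_iff_ne_empty.2 fun h => hcon (ih p p.2 h)
        have : Nonempty (Iio o) := ⟨⟨0, hl.bot_lt⟩⟩
        obtain ⟨x, hx⟩ := IsCompact.nonempty_iInter_of_directed_nonempty_isCompact_isClosed
          (fun p : Iio o => CB S p)
          (Antitone.directed_ge fun p q h => CB_anti S h) hne'
          (fun p => (isClosed_CB hS p).isCompact) (fun p => isClosed_CB hS p)
        rw [mem_iInter] at hx
        exact (ho ▸ mem_CB_of_isSuccLimit hl fun p hp => hx ⟨p, hp⟩ : x ∈ (∅ : Set ASet))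
  obtain ⟨o, ho⟩ := hex
  obtain ⟨b, hb, hb'⟩ := key o ho
  have hfin := (CB_succ_eq_empty_iff hS).1 hb'
  refine ⟨b, (CB S b).ncard, hfin.cast_ncard_eq.symm, ?_⟩
  exact (Set.ncard_pos hfin).2 hb

/-! ### Embeddings -/

/-- Only `U` has to be clopen, for continuity of the glued map; disjointness of `V` and its
complement gives injectivity. -/
theorem Emb.of_inter_of_diff {S T U V : Set ASet} (hU : IsClopen U) (h1 : Emb (S ∩ U) (T ∩ V))
    (h2 : Emb (S \ U) (T \ V)) : Emb S T := by
  classical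
  obtain ⟨f, f1, f2, f3⟩ := h1
  obtain ⟨g, g1, g2, g3⟩ := h2
  rw [continuousOn_iff_cyl] at f1 g1
  refine ⟨U.piecewise f g, ?_, ?_, ?_⟩
  · rw [continuousOn_iff_cyl]
    intro x hx n
    by_cases hxU : x ∈ U
    · obtain ⟨m, hm⟩ := f1 x ⟨hx, hxU⟩ n
      obtain ⟨k, hk⟩ := exists_cyl_subset hU.isOpen hxU
      refine ⟨max m k, fun y hy hyx => ?_⟩
      have hyU := hk (cyl_anti x (le_max_right m k) hyx)
      rw [piecewise_eq_of_mem _ _ _ hxU, piecewise_eq_of_mem _ _ _ hyU]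
      exact hm y ⟨hy, hyU⟩ (cyl_anti x (le_max_left m k) hyx)
    · obtain ⟨m, hm⟩ := g1 x ⟨hx, hxU⟩ n
      obtain ⟨k, hk⟩ := exists_cyl_subset hU.compl.isOpen hxU
      refine ⟨max m k, fun y hy hyx => ?_⟩
      have hyU : y ∉ U := hk (cyl_anti x (le_max_right m k) hyx)
      rw [piecewise_eq_of_notMem _ _ _ hxU, piecewise_eq_of_notMem _ _ _ hyU]
      exact hm y ⟨hy, hyU⟩ (cyl_anti x (le_max_left m k) hyx)
  · intro x hx
    by_cases hxU : x ∈ U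
    · rw [piecewise_eq_of_mem _ _ _ hxU]
      exact (f2 ⟨hx, hxU⟩).1
    · rw [piecewise_eq_of_notMem _ _ _ hxU]
      exact (g2 ⟨hx, hxU⟩).1
  · intro x hx y hy hxy
    by_cases hxU : x ∈ U <;> by_cases hyU : y ∈ U <;>
      simp only [piecewise_eq_of_mem, piecewise_eq_of_notMem, hxU, hyU, not_false_iff] at hxy
    · exact f3 ⟨hx, hxU⟩ ⟨hy, hyU⟩ hxy
    · exact ((g2 ⟨hy, hyU⟩).2 (hxy ▸ (f2 ⟨hx, hxU⟩).2)).elim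
    · exact ((g2 ⟨hx, hxU⟩).2 (hxy ▸ (f2 ⟨hy, hyU⟩).2)).elim
    · exact g3 ⟨hx, hxU⟩ ⟨hy, hyU⟩ hxy

/-- If `y` is an accumulation point of every `D k`, then there are pairwise disjoint annuli around
`y` of which the `k`-th meets `D k`. -/
theorem exists_annuli {y : ASet} {D : ℕ → Set ASet} (h : ∀ k, AccIn (D k) y) :
    ∃ M : ℕ → ℕ, StrictMono M ∧ ∀ k, (D k ∩ (cyl y (M k) \ cyl y (M (k + 1)))).Nonempty := by
  have step : ∀ k m, ∃ m', m < m' ∧ (D k ∩ (cyl y m \ cyl y m')).Nonempty := by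
    intro k m
    obtain ⟨w, hw, hne, hwm⟩ := h k m
    obtain ⟨j, hj⟩ := exists_approx_ne hne
    exact ⟨max (m + 1) j, by omega, w, hw, hwm, fun h => hj (cyl_anti y (le_max_right _ j) h)⟩
  choose g hg1 hg2 using step
  -- The radii are chosen recursively: `M 0 = 0` and `M (k + 1) = g k (M k)`.
  refine ⟨fun k => Nat.rec 0 g k, strictMono_nat_of_lt_succ fun k => hg1 k _, fun k => hg2 k _⟩

theorem annulus_disjoint {y : ASet} {M : ℕ → ℕ} (hM : StrictMono M) {j k : ℕ} {z : ASet}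
    (hj : z ∈ cyl y (M j) \ cyl y (M (j + 1))) (hk : z ∈ cyl y (M k) \ cyl y (M (k + 1))) :
    j = k := by
  rcases lt_trichotomy j k with h | h | h
  · exact (hj.2 (cyl_anti y (hM.monotone h) hk.1)).elim
  · exact h
  · exact (hk.2 (cyl_anti y (hM.monotone h) hj.1)).elim

/-- Embeddings of disjoint relatively clopen pieces into annuli around `y` combine to an embedding
of the whole class, a remaining point `x` being mapped to `y`. -/
theorem Emb.of_annuli {S T : Set ASet} {x y : ASet} {W : ℕ → Set ASet} {M : ℕ → ℕ}
    (hW : ∀ k, IsClosed (W k)) (hopen : ∀ k, ∀ z ∈ W k, ∃ n, S ∩ cyl z n ⊆ W k)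
    (hdisj : ∀ j k z, z ∈ W j → z ∈ W k → j = k) (hx : ∀ k, x ∉ W k)
    (hcov : ∀ z ∈ S, z ≠ x → ∃ k, z ∈ W k) (hM : StrictMono M) (hy : y ∈ T)
    (hemb : ∀ k, Emb (W k) (T ∩ (cyl y (M k) \ cyl y (M (k + 1))))) : Emb S T := by
  classical
  choose f f1 f2 f3 using hemb
  let g : ASet → ASet := fun z => if h : ∃ k, z ∈ W k then f h.choose z else y
  have hg : ∀ k, ∀ z ∈ W k, g z = f k z := by
    intro k z hz
    have h : ∃ k, z ∈ W k := ⟨k, hz⟩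
    have hk : h.choose = k := hdisj _ _ z h.choose_spec hz
    simp only [g, dif_pos h, hk]
  have hgx : g x = y := dif_neg (by simpa using hx)
  refine ⟨g, ?_, ?_, ?_⟩
  · rw [continuousOn_iff_cyl]
    intro z hz n
    by_cases hzx : z = x
    · subst hzx
      -- Continuity at `x`: close to `x` the first `n` pieces are avoided, and the remaining annuli
      -- lie in `cyl y n` because `k ≤ M k`.
      have hcl : IsClosed (⋃ k ∈ Finset.range n, W k) :=
        isClosed_biUnion_finset fun k _ => hW k
      obtain ⟨m, hm⟩ := exists_cyl_subset hcl.isOpen_compl (x := z) (by simpa using fun k _ => hx k)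
      refine ⟨m, fun w hw hwm => ?_⟩
      rw [hgx]
      by_cases hwz : w = z
      · rw [hwz, hgx]
        rfl
      · obtain ⟨k, hk⟩ := hcov w hw hwz
        rw [hg k w hk]
        have hnk : n ≤ k := by
          by_contra hlt
          exact hm hwm (mem_biUnion (by simpa using hlt) hk)
        exact cyl_anti y (hnk.trans (hM.id_le k)) (f2 k hk).2.1
    · obtain ⟨k, hk⟩ := hcov z hz hzx
      obtain ⟨m, hm⟩ := continuousOn_iff_cyl.1 (f1 k) z hk n
      obtain ⟨j, hj⟩ := hopen k z hk
      refine ⟨max m j, fun w hw hwz => ?_⟩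
      have hwk := hj ⟨hw, cyl_anti z (le_max_right m j) hwz⟩
      rw [hg k z hk, hg k w hwk]
      exact hm w hwk (cyl_anti z (le_max_left m j) hwz)
  · intro z hz
    by_cases hzx : z = x
    · rw [hzx, hgx]
      exact hy
    · obtain ⟨k, hk⟩ := hcov z hz hzx
      rw [hg k z hk]
      exact (f2 k hk).1
  · have hne : ∀ z ∈ S, z ≠ x → g z ≠ y := by
      intro z hz hzx h
      obtain ⟨k, hk⟩ := hcov z hz hzx
      rw [hg k z hk] at h
      have := (f2 k hk).2.2
      rw [h] at this
      exact this rfl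
    intro z hz w hw h
    by_cases hzx : z = x <;> by_cases hwx : w = x
    · rw [hzx, hwx]
    · rw [hzx, hgx] at h
      exact (hne w hw hwx h.symm).elim
    · rw [hwx, hgx] at h
      exact (hne z hz hzx h).elim
    · obtain ⟨j, hj⟩ := hcov z hz hzx
      obtain ⟨k, hk⟩ := hcov w hw hwx
      rw [hg j z hj, hg k w hk] at h
      have hjk : j = k := annulus_disjoint hM (f2 j hj).2 (h ▸ (f2 k hk).2)
      subst hjk
      exact f3 j hj hk h

/-- The core of the classification. Away from `x` the class splits into countably many relatively
clopen pieces, each having at most one point in some derivative of order `p k < b`. Since `y`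
accumulates every `CB T (p k)`, disjoint annuli shrinking to `y` can be chosen so that the `k`-th
one receives the `k`-th piece by induction; then `x` goes to `y`. -/
theorem emb_of_mem_CB (b : Ordinal.{0}) : ∀ {S T : Set ASet} {x y : ASet}, IsClosed S →
    S.Countable → CB S b ⊆ {x} → y ∈ CB T b → Emb S T := by
  induction b using WellFoundedLT.induction with
  | ind b ih =>
    intro S T x y hS hc hSx hy
    by_cases hne : (S \ {x}).Nonempty
    swap
    · rw [not_nonempty_iff_eq_empty, sdiff_eq_empty] at hne
      exact ⟨fun _ => y, continuousOn_const, fun _ _ => CB_subset _ _ hy,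
        fun z hz w hw _ => (hne hz).trans (hne hw).symm⟩
    obtain ⟨z, hz⟩ := (hc.mono sdiff_subset).exists_eq_range hne
    have hzS : ∀ k, z k ∈ S ∧ z k ≠ x := fun k => by
      have : z k ∈ S \ {x} := hz ▸ mem_range_self k
      exact this
    have hr : ∀ k, ∃ p < b, z k ∈ CB S p ∧ z k ∉ CB S (p + 1) := fun k =>
      exists_last_CB (hzS k).1 fun h => (hzS k).2 (hSx h)
    choose p hpb hp1 hp2 using hr
    have hn : ∀ k, ∃ n, x ∉ cyl (z k) n ∧ CB S (p k) ∩ cyl (z k) n ⊆ {z k} := by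
      intro k
      have hk := hp2 k
      rw [mem_CB_succ hS, AccIn, not_forall] at hk
      obtain ⟨n, hn⟩ := hk
      obtain ⟨m, hm⟩ := exists_approx_ne (hzS k).2.symm
      refine ⟨max n m, fun h => hm (approx_eq_of_le (le_max_right n m) h), fun w hw => ?_⟩
      by_contra hne
      exact hn ⟨w, hw.1, hne, cyl_anti _ (le_max_left n m) hw.2⟩
    choose n hxn hn using hn
    obtain ⟨M, hM, hD⟩ := exists_annuli (y := y) (D := fun k => CB T (p k))
      fun k => (mem_CB.1 hy).2 _ (hpb k)
    -- Removing the finitely many earlier cylinders makes the pieces disjoint and keeps them clopen.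
    have hcl : ∀ k, IsClopen (⋃ j ∈ Finset.range k, cyl (z j) (n j)) := fun k =>
      (Finset.range k).finite_toSet.isClopen_biUnion fun j _ => isClopen_cyl _ _
    have hWo : ∀ k, IsClopen (cyl (z k) (n k) \ ⋃ j ∈ Finset.range k, cyl (z j) (n j)) :=
      fun k => (isClopen_cyl _ _).diff (hcl k)
    refine Emb.of_annuli (x := x) (y := y) (M := M)
      (W := fun k => S ∩ (cyl (z k) (n k) \ ⋃ j ∈ Finset.range k, cyl (z j) (n j)))
      (fun k => hS.inter (hWo k).isClosed) ?_ ?_ (fun k h => hxn k h.2.1) ?_ hM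
      (CB_subset _ _ hy) ?_
    · intro k w hw
      obtain ⟨m, hm⟩ := exists_cyl_subset (hWo k).isOpen hw.2
      exact ⟨m, inter_subset_inter_right S hm⟩
    · have : ∀ j k w, j < k → w ∈ cyl (z j) (n j) →
          w ∉ cyl (z k) (n k) \ ⋃ j ∈ Finset.range k, cyl (z j) (n j) := fun j k w h h1 h2 =>
        h2.2 (mem_biUnion (by simpa using h) h1)
      intro j k w hj hk
      rcases lt_trichotomy j k with h | h | h
      · exact (this j k w h hj.2.1 hk.2).elim
      · exact h
      · exact (this k j w h hk.2.1 hj.2).elim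
    · intro w hw hwx
      have hex : ∃ k, w ∈ cyl (z k) (n k) := by
        obtain ⟨k, hk⟩ : w ∈ range z := hz ▸ ⟨hw, hwx⟩
        exact ⟨k, hk ▸ rfl⟩
      classical
      refine ⟨Nat.find hex, hw, Nat.find_spec hex, fun h => ?_⟩
      obtain ⟨j, hj, hwj⟩ := mem_iUnion₂.1 h
      exact Nat.find_min hex (by simpa using hj) hwj
    · intro k
      obtain ⟨v, hv, hvk⟩ := hD k
      refine @ih (p k) (hpb k) _ _ (z k) v (hS.inter (hWo k).isClosed)
        (hc.mono inter_subset_left) ?_ ?_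
      · rw [CB_inter_isOpen S (hWo k).isOpen]
        exact fun w hw => hn k ⟨hw.1, hw.2.1⟩
      · rw [CB_inter_isOpen T ((isClopen_cyl _ _).diff (isClopen_cyl _ _)).isOpen]
        exact ⟨hv, hvk⟩

/-- Induction on `n`: a clopen cylinder around one point of each derivative is split off and treated
by `emb_of_mem_CB`, leaving one point fewer on both sides. -/
theorem emb_of_encard_le {b : Ordinal.{0}} {n : ℕ} (hn : 0 < n) : ∀ {S T : Set ASet}, IsClosed S →
    S.Countable → (CB S b).encard ≤ n → n ≤ (CB T b).encard → Emb S T := by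
  induction n, hn using Nat.le_induction with
  | base =>
    intro S T hS hc hSn hTn
    obtain ⟨y, hy⟩ := one_le_encard_iff_nonempty.1 (by simpa using hTn)
    have hs : (CB S b).Subsingleton := encard_le_one_iff_subsingleton.1 (by simpa using hSn)
    rcases hs.eq_empty_or_singleton with h | ⟨x, h⟩
    · exact emb_of_mem_CB b (x := y) hS hc (h ▸ empty_subset _) hy
    · exact emb_of_mem_CB b (x := x) hS hc h.subset hy
  | succ n hn ih =>
    intro S T hS hc hSn hTn
    rcases eq_empty_or_nonempty (CB S b) with h0 | ⟨x, hx⟩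
    · exact ih hS hc (by simp [h0]) (le_trans (by simp) hTn)
    -- `CB T b` may be infinite and without isolated points; a finite part `F` of the required size
    -- provides separated targets.
    obtain ⟨F, hFT, hF⟩ := exists_subset_encard_eq hTn
    have hFfin : F.Finite := finite_of_encard_eq_coe hF
    have hSfin : (CB S b).Finite := finite_of_encard_le_coe hSn
    obtain ⟨y, hy⟩ : F.Nonempty := by
      rw [← one_le_encard_iff_nonempty, hF]
      exact_mod_cast Nat.le_add_left 1 n
    obtain ⟨i, hi⟩ := finite_isolated hSfin x
    obtain ⟨j, hj⟩ := finite_isolated hFfin y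
    refine Emb.of_inter_of_diff (isClopen_cyl x i) (V := cyl y j) ?_ ?_
    · refine emb_of_mem_CB b (x := x) (y := y) (hS.inter (isClopen_cyl x i).isClosed)
        (hc.mono inter_subset_left) ?_ ?_
      · rw [CB_inter_isOpen S (isClopen_cyl x i).isOpen]
        exact fun z hz => hi z hz.1 hz.2
      · rw [CB_inter_isOpen T (isClopen_cyl y j).isOpen]
        exact ⟨hFT hy, rfl⟩
    · rw [sdiff_eq, sdiff_eq]
      refine ih (hS.inter (isClopen_cyl x i).compl.isClosed) (hc.mono inter_subset_left) ?_ ?_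
      · rw [CB_inter_isOpen S (isClopen_cyl x i).compl.isOpen]
        have h1 : (CB S b ∩ (cyl x i)ᶜ).encard ≤ (CB S b \ {x}).encard :=
          encard_le_encard fun z hz => ⟨hz.1, fun h => hz.2 (by rw [h]; rfl)⟩
        refine h1.trans ?_
        have h2 := encard_sdiff_singleton_add_one hx
        rw [← h2] at hSn
        push_cast at hSn
        exact (ENat.add_le_add_iff_right (by simp)).1 hSn
      · rw [CB_inter_isOpen T (isClopen_cyl y j).compl.isOpen]
        have h1 : (F \ {y}).encard ≤ (CB T b ∩ (cyl y j)ᶜ).encard :=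
          encard_le_encard fun z hz => ⟨hFT hz.1, fun h => hz.2 (hj z hz.1 h)⟩
        refine le_trans ?_ h1
        have h2 := encard_sdiff_singleton_add_one hy
        rw [hF] at h2
        push_cast at h2
        exact (ENat.add_le_add_iff_right (by simp)).1 h2.ge

/-- Necessity counts points of derivatives. For sufficiency, when `b < c` the derivative of order
`b` of `T` is infinite and has room for any finite number of points. -/
theorem HasType.emb_iff {S T : Set ASet} {b c : Ordinal.{0}} {m n : ℕ} (hS : IsClosed S)
    (hc : S.Countable) (hT : IsClosed T) (h1 : HasType S b m) (h2 : HasType T c n) :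
    Emb S T ↔ b < c ∨ b = c ∧ m ≤ n := by
  constructor
  · intro h
    have hle := h.encard_CB_le b
    rcases lt_trichotomy b c with hbc | rfl | hbc
    · exact Or.inl hbc
    · rw [h1.encard_eq, h2.encard_eq] at hle
      exact Or.inr ⟨rfl, by exact_mod_cast hle⟩
    · have : CB T b = ∅ := subset_empty_iff.1 fun x hx => by
        have := CB_anti T (Order.add_one_le_of_lt hbc) hx
        rwa [(CB_succ_eq_empty_iff hT).2 h2.finite] at this
      rw [this, encard_empty, nonpos_iff_eq_zero, encard_eq_zero] at hle
      exact (h1.nonempty_CB.ne_empty hle).elim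
  · rintro (h | ⟨rfl, h⟩)
    · refine emb_of_encard_le h1.pos hS hc h1.encard_eq.le ?_
      rw [CB_encard_eq_top hT h h2.nonempty_CB]
      exact le_top
    · refine emb_of_encard_le h1.pos hS hc h1.encard_eq.le ?_
      rw [h2.encard_eq]
      exact_mod_cast h

/-- A perfect subclass survives every derivative. -/
theorem exists_forall_mem_CB {T : Set ASet} (hT : IsClosed T) (hc : ¬ T.Countable) :
    ∃ y, ∀ o, y ∈ CB T o := by
  obtain ⟨D, hD, ⟨y, hy⟩, hDT⟩ := exists_perfect_nonempty_of_isClosed_of_not_countable hT hc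
  have : ∀ o, D ⊆ CB T o := by
    intro o
    induction o using WellFoundedLT.induction with
    | ind o ih => exact fun x hx => mem_CB.2 ⟨hDT hx,
        fun p hp => (accIn_iff_accPt.2 (hD.acc x hx)).mono (ih p hp)⟩
  exact ⟨y, fun o => this o hy⟩

theorem Countable.emb_of_not_countable {S T : Set ASet} (hS : IsClosed S) (hc : S.Countable)
    (hT : IsClosed T) (hT' : ¬ T.Countable) : Emb S T := by
  rcases eq_empty_or_nonempty S with rfl | hne
  · exact Emb.of_subset (empty_subset T)
  obtain ⟨b, n, h⟩ := exists_hasType hS hc hne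
  obtain ⟨y, hy⟩ := exists_forall_mem_CB hT hT'
  refine emb_of_encard_le h.pos hS hc h.encard_eq.le ?_
  rw [CB_encard_eq_top hT (Order.lt_add_one_iff.2 le_rfl) ⟨y, hy (b + 1)⟩]
  exact le_top

theorem Emb.countable {S T : Set ASet} (h : Emb S T) (hT : T.Countable) : S.Countable := by
  obtain ⟨f, -, h2, h3⟩ := h
  exact h2.countable_of_injOn h3 hT

theorem Emb.nonempty {S T : Set ASet} (h : Emb S T) (hS : S.Nonempty) : T.Nonempty := by
  obtain ⟨f, -, h2, -⟩ := h
  exact hS.image f |>.mono h2.image_subset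

/-! ### Well-orderings -/

theorem IsWellOrd.exists_min_of_isClosed {A R : ASet} (h : IsWellOrd A R) {B : Set ASet}
    (hB : IsClosed B) (hBA : B ⊆ els A) (hne : B.Nonempty) : ∃ m ∈ B, ∀ x ∈ B, opair m x ∈ R := by
  obtain ⟨m, hm, h⟩ := h.exists_min (hull B) (fun x hx => hBA ((mem_hull_of_isClosed hB).1 hx))
    (hne.imp fun _ hx => (mem_hull_of_isClosed hB).2 hx)
  exact ⟨m, (mem_hull_of_isClosed hB).1 hm, fun x hx => h x ((mem_hull_of_isClosed hB).2 hx)⟩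

/-- A point is determined by a depth isolating it from above and its approximation there: if two
points shared both, the larger one would violate the isolation of the smaller. -/
theorem IsWellOrd.countable {A R : ASet} (h : IsWellOrd A R) : (els A).Countable := by
  choose! n hn using h.upward_isolated
  refine MapsTo.countable_of_injOn (t := univ)
    (f := fun x => (⟨n x, x.approx (n x)⟩ : Σ n, Approx n)) (fun _ _ => mem_univ _) ?_
    (countable_univ)
  intro x hx y hy hxy
  obtain ⟨h1, h2⟩ := Sigma.mk.inj_iff.1 hxy
  have h3 : y.approx (n x) = x.approx (n x) := by
    rw [← h1] at h2
    exact (eq_of_heq h2).symm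
  rcases h.total x hx y hy with h4 | h4
  · exact (hn x hx y hy h3 h4).symm
  · exact hn y hy x hx (h1 ▸ h3.symm) h4

theorem Ordn.countable (α : Ordn) : (els α.carrier).Countable := α.wo.countable

theorem exists_ordn {S : Set ASet} (hS : IsClosed S) {r : ASet → ASet → Prop}
    (hr : IsClosed {p : ASet × ASet | p.1 ∈ S ∧ p.2 ∈ S ∧ r p.1 p.2})
    (refl : ∀ x ∈ S, r x x) (antisymm : ∀ x ∈ S, ∀ y ∈ S, r x y → r y x → x = y)
    (trans : ∀ x ∈ S, ∀ y ∈ S, ∀ z ∈ S, r x y → r y z → r x z)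
    (total : ∀ x ∈ S, ∀ y ∈ S, r x y ∨ r y x)
    (min : ∀ B ⊆ S, IsClosed B → B.Nonempty → ∃ m ∈ B, ∀ x ∈ B, r m x)
    (isol : ∀ x ∈ S, ∃ n, ∀ y ∈ S, y ∈ cyl x n → r x y → y = x) :
    ∃ α : Ordn, els α.carrier = S ∧ ∀ x ∈ S, ∀ y ∈ S, (opair x y ∈ α.rel ↔ r x y) := by
  have hm : ∀ x, x ∈ hull S ↔ x ∈ S := fun x => mem_hull_of_isClosed hS
  have hR : ∀ x y, opair x y ∈ ofRel {p : ASet × ASet | p.1 ∈ S ∧ p.2 ∈ S ∧ r p.1 p.2} ↔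
      x ∈ S ∧ y ∈ S ∧ r x y := fun x y => opair_mem_ofRel hr
  refine ⟨⟨hull S, ofRel {p : ASet × ASet | p.1 ∈ S ∧ p.2 ∈ S ∧ r p.1 p.2},
    ⟨⟨?_, ?_, ?_, ?_, ?_⟩, ?_, ?_⟩⟩, els_hull_of_isClosed hS, fun x hx y hy => ?_⟩
  · intro p hp
    obtain ⟨a, b, ⟨h1, h2, -⟩, rfl⟩ := (mem_ofRel hr).1 hp
    exact opair_mem_prod.2 ⟨(hm _).2 h1, (hm _).2 h2⟩
  · intro x hx
    rw [hm] at hx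
    exact (hR _ _).2 ⟨hx, hx, refl x hx⟩
  · intro x y h1 h2
    rw [hR] at h1 h2
    exact antisymm x h1.1 y h1.2.1 h1.2.2 h2.2.2
  · intro x y z h1 h2
    rw [hR] at h1 h2 ⊢
    exact ⟨h1.1, h2.2.1, trans x h1.1 y h1.2.1 z h2.2.1 h1.2.2 h2.2.2⟩
  · intro x hx y hy
    rw [hm] at hx hy
    rw [hR, hR]
    exact (total x hx y hy).imp (fun h => ⟨hx, hy, h⟩) fun h => ⟨hy, hx, h⟩
  · intro B hB hne
    have hBS : els B ⊆ S := fun x hx => (hm x).1 (hB x hx)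
    obtain ⟨m, hmB, h⟩ := min (els B) hBS (isClosed_els B) hne
    exact ⟨m, hmB, fun x hx => (hR _ _).2 ⟨hBS hmB, hBS hx, h x hx⟩⟩
  · intro x hx
    obtain ⟨n, hn⟩ := isol x ((hm x).1 hx)
    exact ⟨n, fun y hy hyx h => hn y ((hm y).1 hy) hyx ((hR _ _).1 h).2.2⟩
  · rw [hR]
    exact ⟨fun h => h.2.2, fun h => ⟨hx, hy, h⟩⟩

theorem Ordn.exists_restrict (α : Ordn) {S : Set ASet} (hS : IsClosed S)
    (h : S ⊆ els α.carrier) :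
    ∃ β : Ordn, els β.carrier = S ∧ ∀ x ∈ S, ∀ y ∈ S, (opair x y ∈ β.rel ↔ opair x y ∈ α.rel) := by
  refine exists_ordn hS (r := fun x y => opair x y ∈ α.rel) ?_ (fun x hx => α.wo.refl x (h hx))
    (fun x _ y _ => α.wo.antisymm x y) (fun x _ y _ z _ => α.wo.trans x y z)
    (fun x hx y hy => α.wo.total x (h hx) y (h hy))
    (fun B hB hBc hne => α.wo.exists_min_of_isClosed hBc (hB.trans h) hne)
    (fun x hx => (α.wo.upward_isolated x (h hx)).imp fun n hn y hy => hn y (h hy))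
  exact (hS.preimage continuous_fst).inter ((hS.preimage continuous_snd).inter (isClosed_rel _))

/-- The parts of `B` above its points form a directed family of nonempty compact classes; a common
point is the maximum. -/
theorem Ordn.exists_max (α : Ordn) {B : Set ASet} (hB : IsClosed B) (hBA : B ⊆ els α.carrier)
    (hne : B.Nonempty) : ∃ m ∈ B, ∀ x ∈ B, opair x m ∈ α.rel := by
  have := hne.to_subtype
  have hcl : ∀ x : B, IsClosed (B ∩ {y | opair x.1 y ∈ α.rel}) := fun x =>
    hB.inter ((isClosed_els α.rel).preimage (Continuous.opair continuous_const continuous_id))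
  have hdir : Directed (· ⊇ ·) fun x : B => B ∩ {y | opair x.1 y ∈ α.rel} := by
    intro x y
    rcases α.wo.total x (hBA x.2) y (hBA y.2) with h | h
    · exact ⟨y, fun z hz => ⟨hz.1, α.wo.trans _ _ _ h hz.2⟩, Subset.rfl⟩
    · exact ⟨x, Subset.rfl, fun z hz => ⟨hz.1, α.wo.trans _ _ _ h hz.2⟩⟩
  obtain ⟨m, hm⟩ := IsCompact.nonempty_iInter_of_directed_nonempty_isCompact_isClosed
    (fun x : B => B ∩ {y | opair x.1 y ∈ α.rel}) hdir
    (fun x => ⟨x, x.2, α.wo.refl _ (hBA x.2)⟩) (fun x => (hcl x).isCompact) hcl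
  rw [mem_iInter] at hm
  exact ⟨m, (hm ⟨_, hne.some_mem⟩).1, fun x hx => (hm ⟨x, hx⟩).2⟩

/-- The class of all elements of `α` below `t`. -/
def Ordn.below (α : Ordn) (t : ASet) : Set ASet := {x | x ∈ α.carrier ∧ opair x t ∈ α.rel}

theorem Ordn.isClosed_below (α : Ordn) (t : ASet) : IsClosed (α.below t) :=
  (isClosed_els _).inter
    ((isClosed_els α.rel).preimage (Continuous.opair continuous_id continuous_const))

theorem Ordn.below_subset (α : Ordn) (t : ASet) : α.below t ⊆ els α.carrier := fun _ h => h.1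

theorem Ordn.isInitSeg_below (α : Ordn) (t : ASet) :
    IsInitSeg (hull (α.below t)) α.carrier α.rel := by
  have h : ∀ x, x ∈ hull (α.below t) ↔ x ∈ α.below t :=
    fun x => mem_hull_of_isClosed (α.isClosed_below t)
  refine ⟨fun x hx => ((h x).1 hx).1, fun x hx y hy hyx => (h y).2 ⟨hy, ?_⟩⟩
  exact α.wo.trans _ _ _ hyx ((h x).1 hx).2

/-- Upward isolation surrounds each point with a neighbourhood free of larger points, so segments
are relatively open as well as closed and their derivatives are obtained by restriction. -/
theorem Ordn.exists_isOpen_below (α : Ordn) (t : ASet) :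
    ∃ U, IsOpen U ∧ α.below t = els α.carrier ∩ U := by
  choose! n hn using α.wo.upward_isolated
  refine ⟨⋃ x ∈ α.below t, cyl x (n x), isOpen_biUnion fun x _ => (isClopen_cyl _ _).isOpen,
    Subset.antisymm (fun x hx => ⟨hx.1, mem_biUnion hx rfl⟩) ?_⟩
  rintro y ⟨hy, hyU⟩
  obtain ⟨x, hx, hyx⟩ := mem_iUnion₂.1 hyU
  rcases α.wo.total x hx.1 y hy with h | h
  · exact hn x hx.1 y hy hyx h ▸ hx
  · exact ⟨hy, α.wo.trans _ _ _ h hx.2⟩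

theorem isClosed_of_cyl {C : Set (ASet × ASet)} (h : ∀ x y, (x, y) ∉ C →
    ∃ n, ∀ x' ∈ cyl x n, ∀ y' ∈ cyl y n, (x', y') ∉ C) : IsClosed C := by
  rw [← isOpen_compl_iff, isOpen_iff_mem_nhds]
  rintro ⟨x, y⟩ hxy
  obtain ⟨n, hn⟩ := h x y hxy
  rw [nhds_prod_eq]
  exact mem_of_superset (prod_mem_prod ((isClopen_cyl x n).isOpen.mem_nhds rfl)
    ((isClopen_cyl y n).isOpen.mem_nhds rfl)) fun p hp => hn p.1 hp.1 p.2 hp.2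

/-- `h` is a continuous function from the class `S` to `ℕ ∪ {∞}`. -/
structure IsLevel (S : Set ASet) (h : ASet → ℕ∞) : Prop where
  locallyConst : ∀ x ∈ S, h x ≠ ⊤ → ∃ n, ∀ y ∈ S, y ∈ cyl x n → h y = h x
  top : ∀ x ∈ S, h x = ⊤ → ∀ k : ℕ, ∃ n, ∀ y ∈ S, y ∈ cyl x n → (k : ℕ∞) < h y

theorem IsLevel.exists_gt {S : Set ASet} {h : ASet → ℕ∞} (hh : IsLevel S h) {x : ASet}
    (hx : x ∈ S) {k : ℕ∞} (hk : k < h x) : ∃ n, ∀ y ∈ S, y ∈ cyl x n → k < h y := by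
  by_cases ht : h x = ⊤
  · lift k to ℕ using hk.ne_top
    exact hh.top x hx ht k
  · obtain ⟨n, hn⟩ := hh.locallyConst x hx ht
    exact ⟨n, fun y hy hyx => hn y hy hyx ▸ hk⟩

theorem IsLevel.isClosed_fibre {S : Set ASet} (hS : IsClosed S) {h : ASet → ℕ∞}
    (hh : IsLevel S h) (k : ℕ∞) : IsClosed {x | x ∈ S ∧ h x = k} := by
  refine isClosed_of_closure_subset fun x hx => ?_
  have hx' := fun n => (mem_closure_iff_nhds_basis (nhds_hasBasis x)).1 hx n trivial
  have hxS : x ∈ S := hS.closure_subset_iff.2 (fun _ h => h.1) hx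
  refine ⟨hxS, ?_⟩
  by_cases ht : h x = ⊤
  · by_contra hne
    rw [ht] at hne
    obtain ⟨n, hn⟩ := hh.exists_gt hxS (k := k) (ht ▸ Ne.lt_top (Ne.symm hne))
    obtain ⟨y, hy, hyx⟩ := hx' n
    exact (hn y hy.1 hyx).ne' hy.2
  · obtain ⟨n, hn⟩ := hh.locallyConst x hxS ht
    obtain ⟨y, hy, hyx⟩ := hx' n
    exact (hn y hy.1 hyx).symm.trans hy.2

/-- Well-orderings of the fibres of a continuous function to `ℕ ∪ {∞}` combine to a well-ordering,
provided that the fibre at infinity has at most one point. -/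
theorem exists_ordn_lex {S : Set ASet} (hS : IsClosed S) {h : ASet → ℕ∞} (hh : IsLevel S h)
    (htop : ∀ x ∈ S, ∀ y ∈ S, h x = ⊤ → h y = ⊤ → x = y)
    (α : ℕ∞ → Ordn) (hα : ∀ k, els (α k).carrier = {x | x ∈ S ∧ h x = k}) :
    ∃ β : Ordn, els β.carrier = S ∧ ∀ x ∈ S, ∀ y ∈ S, (opair x y ∈ β.rel ↔
      h x < h y ∨ h x = h y ∧ opair x y ∈ (α (h x)).rel) := by
  have hmem : ∀ x k, x ∈ (α k).carrier ↔ x ∈ S ∧ h x = k := fun x k => by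
    rw [← mem_els, hα]
    rfl
  refine exists_ordn hS
    (r := fun x y => h x < h y ∨ h x = h y ∧ opair x y ∈ (α (h x)).rel) ?_ ?_ ?_ ?_ ?_ ?_ ?_
  · refine isClosed_of_cyl fun x y hxy => ?_
    by_cases hx : x ∈ S
    swap
    · obtain ⟨n, hn⟩ := exists_cyl_subset hS.isOpen_compl hx
      exact ⟨n, fun x' hx' y' _ hc => hn hx' hc.1⟩
    by_cases hy : y ∈ S
    swap
    · obtain ⟨n, hn⟩ := exists_cyl_subset hS.isOpen_compl hy
      exact ⟨n, fun x' _ y' hy' hc => hn hy' hc.2.1⟩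
    have hr : ¬ (h x < h y ∨ h x = h y ∧ opair x y ∈ (α (h x)).rel) := fun hr => hxy ⟨hx, hy, hr⟩
    rw [not_or, not_and] at hr
    rcases (not_lt.1 hr.1).lt_or_eq with hlt | heq
    · obtain ⟨n, hn⟩ := hh.locallyConst y hy hlt.ne_top
      obtain ⟨m, hm⟩ := hh.exists_gt hx hlt
      refine ⟨max n m, fun x' hx' y' hy' hc => ?_⟩
      have h1 := hn y' hc.2.1 (cyl_anti y (le_max_left n m) hy')
      have h2 := hm x' hc.1 (cyl_anti x (le_max_right n m) hx')
      rw [← h1] at h2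
      rcases hc.2.2 with hc | hc
      · exact lt_asymm h2 hc
      · exact h2.ne' hc.1
    -- On equal levels: at infinity the two points coincide; at a finite level both stay in the
    -- fibre locally, and the ordering of that fibre is closed.
    · have hrel := hr.2 heq.symm
      by_cases ht : h x = ⊤
      · have hxy' := htop x hx y hy ht (heq.trans ht)
        rw [hxy'] at hrel
        exact (hrel ((α (h y)).wo.refl y ((hmem _ _).2 ⟨hy, rfl⟩))).elim
      · obtain ⟨n, hn⟩ := hh.locallyConst x hx ht
        obtain ⟨m, hm⟩ := hh.locallyConst y hy (heq ▸ ht)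
        have hop := (isClosed_rel (α (h x)).rel).isOpen_compl.mem_nhds (x := (x, y)) hrel
        rw [nhds_prod_eq] at hop
        obtain ⟨k, -, hk⟩ := ((nhds_hasBasis x).prod_same_index_anti (nhds_hasBasis y)
          (fun _ _ _ _ h => cyl_anti x h) (fun _ _ _ _ h => cyl_anti y h)).mem_iff.1 hop
        refine ⟨max k (max n m), fun x' hx' y' hy' hc => ?_⟩
        have h1 := hn x' hc.1 (cyl_anti x (by simp) hx')
        have h2 := hm y' hc.2.1 (cyl_anti y (by simp) hy')
        rcases hc.2.2 with hc | hc
        · rw [h1, h2, heq] at hc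
          exact lt_irrefl _ hc
        · rw [h1] at hc
          exact hk (⟨cyl_anti x (by simp) hx', cyl_anti y (by simp) hy'⟩ :
            (x', y') ∈ cyl x k ×ˢ cyl y k) hc.2
  · exact fun x hx => Or.inr ⟨rfl, (α (h x)).wo.refl x ((hmem _ _).2 ⟨hx, rfl⟩)⟩
  · rintro x hx y hy (h1 | ⟨h1, h1'⟩) (h2 | ⟨h2, h2'⟩)
    · exact (lt_asymm h1 h2).elim
    · exact (h1.ne' h2).elim
    · exact (h2.ne' h1).elim
    · rw [← h1] at h2'
      exact (α (h x)).wo.antisymm x y h1' h2'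
  · rintro x hx y hy z hz (h1 | ⟨h1, h1'⟩) (h2 | ⟨h2, h2'⟩)
    · exact Or.inl (h1.trans h2)
    · exact Or.inl (h2 ▸ h1)
    · exact Or.inl (h1 ▸ h2)
    · rw [← h1] at h2'
      exact Or.inr ⟨h1.trans h2, (α (h x)).wo.trans x y z h1' h2'⟩
  · intro x hx y hy
    rcases lt_trichotomy (h x) (h y) with hl | he | hl
    · exact Or.inl (Or.inl hl)
    · rcases (α (h x)).wo.total x ((hmem _ _).2 ⟨hx, rfl⟩) y ((hmem _ _).2 ⟨hy, he.symm⟩)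
        with h1 | h1
      · exact Or.inl (Or.inr ⟨he, h1⟩)
      · exact Or.inr (Or.inr ⟨he.symm, he ▸ h1⟩)
    · exact Or.inr (Or.inl hl)
  · intro B hB hBc hne
    obtain ⟨w, hw, hmin⟩ := exists_minimalFor_of_wellFoundedLT (· ∈ B) h hne
    have hmin : ∀ y ∈ B, h w ≤ h y := fun y hy => by
      rcases le_total (h w) (h y) with h1 | h1
      · exact h1
      · exact hmin hy h1
    obtain ⟨m, hm, hmm⟩ := (α (h w)).wo.exists_min_of_isClosed
      (B := B ∩ {x | x ∈ S ∧ h x = h w}) (hBc.inter (hh.isClosed_fibre hS _))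
      (by rw [hα]; exact inter_subset_right) ⟨w, hw, hB hw, rfl⟩
    refine ⟨m, hm.1, fun x hx => ?_⟩
    have hmw : h m = h w := hm.2.2
    rcases (hmin x hx).lt_or_eq with hl | he
    · exact Or.inl (by rwa [hmw])
    · exact Or.inr ⟨hmw.trans he, by rw [hmw]; exact hmm x ⟨hx, hB hx, he.symm⟩⟩
  · intro x hx
    -- Nothing lies above the only possible point at infinity, so any depth isolates it.
    by_cases ht : h x = ⊤
    · refine ⟨0, fun y hy _ hxy => ?_⟩
      rcases hxy with hl | ⟨he, -⟩
      · exact (not_top_lt (ht ▸ hl)).elim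
      · exact htop y hy x hx (he ▸ ht) ht
    · obtain ⟨n, hn⟩ := hh.locallyConst x hx ht
      obtain ⟨m, hm⟩ := (α (h x)).wo.upward_isolated x ((hmem _ _).2 ⟨hx, rfl⟩)
      refine ⟨max n m, fun y hy hyx hxy => ?_⟩
      have h1 := hn y hy (cyl_anti x (le_max_left n m) hyx)
      rcases hxy with hl | ⟨-, hr⟩
      · exact (hl.ne' h1).elim
      · exact hm y ((hmem _ _).2 ⟨hy, h1⟩) (cyl_anti x (le_max_right n m) hyx) hr

/-- A class that carries a well-ordering. -/
def HasWO (S : Set ASet) : Prop := ∃ α : Ordn, els α.carrier = S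

theorem HasWO.subset {S T : Set ASet} (hT : HasWO T) (hS : IsClosed S) (h : S ⊆ T) : HasWO S := by
  obtain ⟨α, rfl⟩ := hT
  obtain ⟨β, hβ, -⟩ := α.exists_restrict hS h
  exact ⟨β, hβ⟩

theorem hasWO_of_subsingleton {S : Set ASet} (h : S.Subsingleton) : HasWO S := by
  have hS : IsClosed S := h.finite.isClosed
  obtain ⟨α, hα, -⟩ := exists_ordn (S := S) (r := fun _ _ => True) hS
    (by
      simp only [and_true]
      exact (hS.preimage continuous_fst).inter (hS.preimage continuous_snd))
    (fun _ _ => trivial) (fun x hx y hy _ _ => h hx hy) (fun _ _ _ _ _ _ _ _ => trivial)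
    (fun _ _ _ _ => Or.inl trivial) (fun B _ _ hne => hne.imp fun _ hx => ⟨hx, fun _ _ => trivial⟩)
    (fun x hx => ⟨0, fun y hy _ _ => h hy hx⟩)
  exact ⟨α, hα⟩

theorem HasWO.of_locally {S : Set ASet} (hS : IsClosed S)
    (h : ∀ x ∈ S, ∃ n, HasWO (S ∩ cyl x n)) : HasWO S := by
  choose! n hn using h
  obtain ⟨t, ht, htS⟩ := hS.isCompact.elim_nhds_subcover (fun x => cyl x (n x))
    fun x _ => (isClopen_cyl x (n x)).isOpen.mem_nhds rfl
  let N := t.sup n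
  -- Approximations at depth `N` cut the class into finitely many clopen pieces, each inside a
  -- member of the subcover; their numbers serve as levels.
  obtain ⟨e, he⟩ := exists_injective_nat (Approx N)
  have hlev : IsLevel S fun x => (e (x.approx N) : ℕ∞) :=
    ⟨fun x _ _ => ⟨N, fun y _ hy => by rw [show y.approx N = x.approx N from hy]⟩,
      fun x _ hx => (ENat.natCast_ne_top _ hx).elim⟩
  have hfib : ∀ k : ℕ∞, HasWO {x | x ∈ S ∧ (e (x.approx N) : ℕ∞) = k} := by
    intro k
    have hcl := hlev.isClosed_fibre hS k
    rcases eq_empty_or_nonempty {x | x ∈ S ∧ (e (x.approx N) : ℕ∞) = k} with h0 | ⟨x, hx⟩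
    · rw [h0]
      exact hasWO_of_subsingleton subsingleton_empty
    · obtain ⟨z, hz, hxz⟩ := mem_iUnion₂.1 (htS hx.1)
      refine (hn z (ht z hz)).subset hcl fun y hy => ⟨hy.1, ?_⟩
      have hyx : y.approx N = x.approx N := he (by exact_mod_cast hy.2.trans hx.2.symm)
      exact (approx_eq_of_le (Finset.le_sup hz) hyx).trans hxz
  choose α hα using hfib
  obtain ⟨β, hβ, -⟩ := exists_ordn_lex hS hlev
    (fun x _ _ _ hx => (ENat.natCast_ne_top _ hx).elim) α hα
  exact ⟨β, hβ⟩

/-- The class is sliced into shells around `x`, which are well-ordered separately and stacked with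
`x` on top. -/
theorem exists_ordn_max {S : Set ASet} (hS : IsClosed S) {x : ASet} (hx : x ∈ S)
    (h : ∀ W ⊆ S, IsClosed W → x ∉ W → HasWO W) :
    ∃ α : Ordn, els α.carrier = S ∧ ∀ y ∈ S, opair y x ∈ α.rel := by
  classical
  have hex : ∀ y, y ≠ x → ∃ n, y.approx n ≠ x.approx n := fun y hy => exists_approx_ne hy
  -- The level of `y` is the first depth at which `y` differs from `x`; it tends to infinity exactly
  -- towards `x`.
  let l : ASet → ℕ∞ := fun y => if hy : y = x then ⊤ else (Nat.find (hex y hy) : ℕ)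
  have hlx : l x = ⊤ := dif_pos rfl
  have hl : ∀ y (hy : y ≠ x), l y = (Nat.find (hex y hy) : ℕ) := fun y hy => dif_neg hy
  have hltop : ∀ y, l y = ⊤ → y = x := by
    intro y hy
    by_contra hne
    rw [hl y hne] at hy
    exact ENat.natCast_ne_top _ hy
  have hlev : IsLevel S l := by
    constructor
    · intro y _ hy
      have hne : y ≠ x := fun h => hy (h ▸ hlx)
      refine ⟨Nat.find (hex y hne), fun w _ hw => ?_⟩
      have hw' : ∀ m ≤ Nat.find (hex y hne), w.approx m = y.approx m :=
        fun m hm => approx_eq_of_le hm hw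
      have hwx : w ≠ x := by
        rintro rfl
        exact Nat.find_spec (hex y hne) (hw' _ le_rfl).symm
      rw [hl y hne, hl w hwx, Nat.cast_inj, Nat.find_eq_iff]
      refine ⟨by rw [hw' _ le_rfl]; exact Nat.find_spec (hex y hne), fun m hm => ?_⟩
      rw [hw' m hm.le]
      exact Nat.find_min (hex y hne) hm
    · intro y _ hy k
      have := hltop y hy
      subst this
      refine ⟨k, fun w _ hw => ?_⟩
      by_cases hwy : w = y
      · rw [hwy, hlx]
        exact ENat.natCast_lt_top k
      · rw [hl w hwy, Nat.cast_lt]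
        by_contra hle
        exact Nat.find_spec (hex w hwy) (approx_eq_of_le (not_lt.1 hle) hw)
  have hfib : ∀ k : ℕ∞, HasWO {y | y ∈ S ∧ l y = k} := by
    intro k
    by_cases hk : k = ⊤
    · subst hk
      exact hasWO_of_subsingleton fun y hy z hz => (hltop y hy.2).trans (hltop z hz.2).symm
    · exact h _ (fun _ h => h.1) (hlev.isClosed_fibre hS k) fun hx => hk (hx.2.symm.trans hlx)
  choose α hα using hfib
  obtain ⟨β, hβ, hβ'⟩ := exists_ordn_lex hS hlev
    (fun y _ z _ hy hz => (hltop y hy).trans (hltop z hz).symm) α hα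
  refine ⟨β, hβ, fun y hy => (hβ' y hy x hx).2 ?_⟩
  by_cases hyx : y = x
  · subst hyx
    exact Or.inr ⟨rfl, (α (l y)).wo.refl y (by
      have : y ∈ els (α (l y)).carrier := by
        rw [hα]
        exact ⟨hy, rfl⟩
      exact this)⟩
  · rw [hlx]
    exact Or.inl (Ne.lt_top fun h => hyx (hltop y h))

/-- The points without a well-orderable neighbourhood form a countable closed class. If it were
nonempty, it would have an isolated point `z`; near `z` every closed part avoiding `z` is locally
well-orderable, so `z` could be put on top of them. -/
theorem hasWO_of_countable {S : Set ASet} (hS : IsClosed S) (hc : S.Countable) : HasWO S := by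
  refine HasWO.of_locally hS ?_
  by_contra! hcon
  have hKS : {x | x ∈ S ∧ ∀ n, ¬ HasWO (S ∩ cyl x n)} ⊆ S := fun _ h => h.1
  have hK : IsClosed {x | x ∈ S ∧ ∀ n, ¬ HasWO (S ∩ cyl x n)} := by
    refine isClosed_of_closure_subset fun x hx => ⟨hS.closure_subset_iff.2 hKS hx, fun n hn => ?_⟩
    obtain ⟨y, hy, hyx⟩ := (mem_closure_iff_nhds_basis (nhds_hasBasis x)).1 hx n trivial
    refine hy.2 n (hn.subset (hS.inter (isClopen_cyl y n).isClosed) fun z hz => ⟨hz.1, ?_⟩)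
    exact (hz.2 : z.approx n = y.approx n).trans hyx
  obtain ⟨z, hz, n, hn⟩ := exists_isolated hK (hc.mono hKS) hcon
  obtain ⟨α, hα, -⟩ := exists_ordn_max (S := S ∩ cyl z n) (hS.inter (isClopen_cyl z n).isClosed)
    ⟨hz.1, rfl⟩ (fun W hW hWc hzW => by
      refine HasWO.of_locally hWc fun x hx => ?_
      have hxK : ¬ (∀ m, ¬ HasWO (S ∩ cyl x m)) := fun h =>
        hzW (hn x ⟨(hW hx).1, h⟩ (hW hx).2 ▸ hx)
      push Not at hxK
      exact hxK.imp fun m hm => hm.subset (hWc.inter (isClopen_cyl x m).isClosed)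
        (inter_subset_inter_left _ fun y hy => (hW hy).1))
  exact hz.2 n ⟨α, hα⟩

/-! ### Well-ordered cardinals -/

/-- A proper initial segment misses the greatest element `t`, so its derivative of order `b` has
fewer points, which rules out an embedding. -/
theorem Ordn.isCardinal_of_max_mem {α : Ordn} {b : Ordinal.{0}} {n : ℕ}
    (h : HasType (els α.carrier) b n) {t : ASet} (ht : t ∈ CB (els α.carrier) b)
    (hmax : ∀ x ∈ α.carrier, opair x t ∈ α.rel) : α.IsCardinal := by
  intro S hS heq
  have htS : t ∉ S := fun htS => hS.2 <| aset_ext fun x =>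
    ⟨hS.1.1 x, fun hx => hS.1.2 t htS x hx (hmax x hx)⟩
  have h1 := (eqC_iff.1 heq).1.encard_CB_le b
  have h2 : CB (els S) b ⊆ CB (els α.carrier) b \ {t} := fun x hx =>
    ⟨CB_mono hS.1.1 b hx, fun hxt => htS (hxt ▸ CB_subset _ _ hx)⟩
  have h3 := h1.trans (encard_le_encard h2)
  exact ((h.finite.subset sdiff_subset).encard_lt_encard (sdiff_singleton_ssubset.2 ht)).not_ge h3

/-- Otherwise the segment below the greatest point `s` of the last derivative is proper, yet being
relatively open it keeps that whole derivative, so the entire ordinal embeds into it. -/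
theorem Ordn.IsCardinal.max_mem {α : Ordn} (hα : α.IsCardinal) {b : Ordinal.{0}} {n : ℕ}
    (h : HasType (els α.carrier) b n) {t : ASet} (ht : t ∈ α.carrier)
    (hmax : ∀ x ∈ α.carrier, opair x t ∈ α.rel) : t ∈ CB (els α.carrier) b := by
  by_contra hcon
  obtain ⟨s, hs, hsmax⟩ := α.exists_max (isClosed_CB (isClosed_els _) b)
    (CB_subset _ _) h.nonempty_CB
  have hm : ∀ x, x ∈ hull (α.below s) ↔ x ∈ α.below s :=
    fun x => mem_hull_of_isClosed (α.isClosed_below s)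
  refine hα (hull (α.below s)) ⟨α.isInitSeg_below s, fun heq => ?_⟩ ?_
  · have hts : t ∈ α.below s := (hm t).1 (heq ▸ ht)
    exact hcon (α.wo.antisymm _ _ hts.2 (hmax s (CB_subset _ _ hs)) ▸ hs)
  · rw [eqC_iff, els_hull_of_isClosed (α.isClosed_below s)]
    refine ⟨emb_of_encard_le h.pos (isClosed_els _) α.countable h.encard_eq.le ?_,
      Emb.of_subset (α.below_subset s)⟩
    obtain ⟨U, hU, hUs⟩ := α.exists_isOpen_below s
    rw [hUs, CB_inter_isOpen _ hU, ← h.encard_eq]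
    refine encard_le_encard fun x hx => ⟨hx, ?_⟩
    have : x ∈ α.below s := ⟨CB_subset _ _ hx, hsmax x hx⟩
    rw [hUs] at this
    exact this.2

/-- The `k`-th point of the derivative, found by taking repeatedly the least point not yet covered;
such a point exists because the remainder is closed. -/
theorem Ordn.exists_below_encard (α : Ordn) (b : Ordinal.{0}) {k : ℕ} (hk : 0 < k)
    (h : k ≤ (CB (els α.carrier) b).encard) :
    ∃ t ∈ CB (els α.carrier) b, (CB (els α.carrier) b ∩ α.below t).encard = k := by
  have hcl := isClosed_CB (isClosed_els α.carrier) b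
  have hsub := CB_subset (els α.carrier) b
  induction k, hk using Nat.le_induction with
  | base =>
    obtain ⟨t, ht, hmin⟩ := α.wo.exists_min_of_isClosed hcl hsub
      (one_le_encard_iff_nonempty.1 (by simpa using h))
    refine ⟨t, ht, ?_⟩
    have : CB (els α.carrier) b ∩ α.below t = {t} := Subset.antisymm
      (fun x hx => α.wo.antisymm _ _ hx.2.2 (hmin x hx.1))
      (singleton_subset_iff.2 ⟨ht, hsub ht, α.wo.refl t (hsub ht)⟩)
    rw [this, encard_singleton]
    rfl
  | succ k hk ih =>
    obtain ⟨s, hs, hsk⟩ := ih (le_trans (by simp) h)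
    obtain ⟨U, hU, hUs⟩ := α.exists_isOpen_below s
    have hUs' : ∀ x ∈ CB (els α.carrier) b, x ∈ α.below s ↔ x ∈ U := fun x hx => by
      rw [hUs]
      exact ⟨fun h => h.2, fun h => ⟨hsub hx, h⟩⟩
    have hne : (CB (els α.carrier) b ∩ Uᶜ).Nonempty := by
      by_contra hemp
      have : CB (els α.carrier) b ⊆ CB (els α.carrier) b ∩ α.below s := fun x hx =>
        ⟨hx, (hUs' x hx).2 (by_contra fun hxU => hemp ⟨x, hx, hxU⟩)⟩
      have := h.trans (encard_le_encard this)
      rw [hsk] at this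
      exact absurd (by exact_mod_cast this : k + 1 ≤ k) (by omega)
    obtain ⟨t, ht, hmin⟩ := α.wo.exists_min_of_isClosed (hcl.inter hU.isClosed_compl)
      (inter_subset_left.trans hsub) hne
    have hts : t ∉ α.below s := fun hc => ht.2 ((hUs' t ht.1).1 hc)
    have hst : opair s t ∈ α.rel := (α.wo.total s (hsub hs) t (hsub ht.1)).resolve_right
      fun hc => hts ⟨hsub ht.1, hc⟩
    refine ⟨t, ht.1, ?_⟩
    have : CB (els α.carrier) b ∩ α.below t =
        insert t (CB (els α.carrier) b ∩ α.below s) := by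
      ext x
      constructor
      · rintro ⟨hx, hxt⟩
        by_cases hxU : x ∈ U
        · exact Or.inr ⟨hx, (hUs' x hx).2 hxU⟩
        · exact Or.inl (α.wo.antisymm _ _ hxt.2 (hmin x ⟨hx, hxU⟩))
      · rintro (rfl | ⟨hx, hxs⟩)
        · exact ⟨ht.1, hsub ht.1, α.wo.refl _ (hsub ht.1)⟩
        · exact ⟨hx, hxs.1, α.wo.trans _ _ _ hxs.2 hst⟩
    rw [this, encard_insert_of_notMem fun hc => hts hc.2, hsk]
    rfl

/-- A well-ordered set whose derivative of order `b` has at least `k > 0` points contains a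
well-ordered cardinal of rank `b` and degree `k`. -/
theorem Ordn.exists_cardinal_hasType (α : Ordn) (b : Ordinal.{0}) {k : ℕ} (hk : 0 < k)
    (h : k ≤ (CB (els α.carrier) b).encard) :
    ∃ β : Ordn, β.IsCardinal ∧ HasType (els β.carrier) b k := by
  obtain ⟨t, ht, htk⟩ := α.exists_below_encard b hk h
  have htA := CB_subset _ _ ht
  obtain ⟨β, hβ, hβ'⟩ := α.exists_restrict (α.isClosed_below t) (α.below_subset t)
  obtain ⟨U, hU, hUt⟩ := α.exists_isOpen_below t
  have htt : t ∈ α.below t := ⟨htA, α.wo.refl t htA⟩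
  have hCB : CB (els β.carrier) b = CB (els α.carrier) b ∩ α.below t := by
    rw [hβ, hUt, CB_inter_isOpen _ hU, ← inter_assoc, inter_eq_left.2 (CB_subset _ b)]
  have htype : HasType (els β.carrier) b k := ⟨hCB ▸ htk, hk⟩
  refine ⟨β, Ordn.isCardinal_of_max_mem htype (t := t) (hCB ▸ ⟨ht, htt⟩) fun x hx => ?_, htype⟩
  have hx : x ∈ α.below t := hβ ▸ hx
  exact (hβ' x hx t htt).2 hx.2

/-! ### Order types -/

/-- The type of all elements of an ordinal. -/
abbrev Ordn.Pts (α : Ordn) : Type := els α.carrier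

namespace Ordn

variable (α β : Ordn)

instance : CompactSpace α.Pts := isCompact_iff_compactSpace.1 (isClosed_els α.carrier).isCompact

noncomputable instance : LinearOrder α.Pts where
  le x y := opair x.1 y.1 ∈ α.rel
  le_refl x := α.wo.refl x.1 x.2
  le_trans x y z := α.wo.trans x.1 y.1 z.1
  le_antisymm x y h1 h2 := Subtype.ext (α.wo.antisymm x.1 y.1 h1 h2)
  le_total x y := α.wo.total x.1 x.2 y.1 y.2
  toDecidableLE := Classical.decRel _

variable {α β}

theorem le_def {x y : α.Pts} : x ≤ y ↔ opair x.1 y.1 ∈ α.rel := Iff.rfl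

instance : OrderClosedTopology α.Pts :=
  ⟨(isClosed_els α.rel).preimage (Continuous.opair
    (continuous_subtype_val.comp continuous_fst) (continuous_subtype_val.comp continuous_snd))⟩

/-- The order topology is Hausdorff and coarser than a compact topology, hence equal to it. -/
instance : OrderTopology α.Pts := by
  have h1 : (inferInstance : TopologicalSpace α.Pts) ≤ Preorder.topology α.Pts := by
    refine le_generateFrom ?_
    rintro s ⟨a, rfl | rfl⟩
    · exact isOpen_Ioi
    · exact isOpen_Iio
  refine ⟨le_antisymm h1 ?_⟩
  have h2 : @T2Space α.Pts (Preorder.topology α.Pts) := by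
    let _ : TopologicalSpace α.Pts := Preorder.topology α.Pts
    have : OrderTopology α.Pts := ⟨rfl⟩
    infer_instance
  have h3 := @Continuous.isClosedMap α.Pts α.Pts inferInstance (Preorder.topology α.Pts)
    inferInstance h2 id (continuous_id_of_le h1)
  intro U hU
  have h4 := h3 Uᶜ hU.isClosed_compl
  rw [image_id] at h4
  exact (@isClosed_compl_iff _ (Preorder.topology α.Pts) U).1 h4

/-- Internal minima exist only for closed classes. The minimum of the closure of `s` belongs to `s`,
since upward isolation lets no larger point come near it. -/
instance : WellFoundedLT α.Pts := by
  refine ⟨WellFounded.wellFounded_iff_has_min.2 fun s hs => ?_⟩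
  have hsub : closure (Subtype.val '' s) ⊆ els α.carrier :=
    closure_minimal (by rintro _ ⟨x, -, rfl⟩; exact x.2) (isClosed_els α.carrier)
  obtain ⟨m, hm, hmin⟩ := α.wo.exists_min_of_isClosed isClosed_closure hsub
    (hs.image _).closure
  obtain ⟨n, hn⟩ := α.wo.upward_isolated m (hsub hm)
  obtain ⟨_, ⟨y, hy, rfl⟩, hyn⟩ :=
    (mem_closure_iff_nhds_basis (nhds_hasBasis m)).1 hm n trivial
  have hym := hn y.1 y.2 hyn (hmin _ (subset_closure ⟨y, hy, rfl⟩))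
  refine ⟨y, hy, fun x hx => not_lt.2 ?_⟩
  rw [le_def, hym]
  exact hmin _ (subset_closure ⟨x, hx, rfl⟩)

variable (α) in
/-- The order type of an ordinal. -/
noncomputable def otype : Ordinal.{0} := Ordinal.type (α := α.Pts) (· < ·)

/-- The position of an element in an ordinal. -/
noncomputable def pos (x : α.Pts) : Ordinal.{0} := Ordinal.typein (α := α.Pts) (· < ·) x

theorem pos_lt_pos {x y : α.Pts} : pos x < pos y ↔ x < y := Ordinal.typein_lt_typein (· < ·)

theorem pos_le_pos {x y : α.Pts} : pos x ≤ pos y ↔ x ≤ y := by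
  rw [← not_lt, pos_lt_pos, not_lt]

theorem pos_lt_otype (x : α.Pts) : pos x < α.otype := Ordinal.typein_lt_type _ x

theorem exists_pos_eq {o : Ordinal.{0}} (h : o < α.otype) : ∃ x : α.Pts, pos x = o :=
  Ordinal.typein_surj (· < ·) h

theorem otype_eq_of_max {t : α.Pts} (ht : ∀ x, x ≤ t) : α.otype = pos t + 1 := by
  refine le_antisymm (le_of_forall_lt fun o ho => ?_) (Order.add_one_le_of_lt (pos_lt_otype t))
  obtain ⟨x, rfl⟩ := exists_pos_eq ho
  exact Order.lt_add_one_iff.2 (pos_le_pos.2 (ht x))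

theorem otype_eq_zero_iff : α.otype = 0 ↔ α.carrier = empty := by
  rw [otype, Ordinal.type_eq_zero_iff_isEmpty, eq_empty_iff, ← isEmpty_coe_sort]

theorem exists_isMax (h : α.otype ≠ 0) : ∃ t : α.Pts, ∀ x, x ≤ t := by
  rw [Ne, otype_eq_zero_iff, ← Ne, ne_empty_iff] at h
  obtain ⟨m, hm, hmax⟩ := Ordn.exists_max α (isClosed_els _) Subset.rfl h
  exact ⟨⟨m, hm⟩, fun x => hmax x.1 x.2⟩

theorem pos_apply (g : α.Pts ≤i β.Pts) (x : α.Pts) : pos (g x) = pos x := by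
  induction x using WellFoundedLT.induction with
  | ind x ih =>
    refine le_antisymm (le_of_forall_lt fun o ho => ?_) (le_of_forall_lt fun o ho => ?_)
    · obtain ⟨y, rfl⟩ := exists_pos_eq (ho.trans (pos_lt_otype (g x)))
      obtain ⟨z, rfl⟩ := g.mem_range_of_rel (pos_lt_pos.1 ho)
      have hz : z < x := g.map_rel_iff.1 (pos_lt_pos.1 ho)
      rw [ih z hz]
      exact pos_lt_pos.2 hz
    · obtain ⟨z, rfl⟩ := exists_pos_eq (ho.trans (pos_lt_otype x))
      have hz : z < x := pos_lt_pos.1 ho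
      rw [← ih z hz]
      exact pos_lt_pos.2 (g.map_rel_iff.2 hz)

theorem initialSeg_of_isoOrd {S : ASet} (hS : IsInitSeg S β.carrier β.rel)
    (h : IsoOrd α.carrier α.rel S β.rel) :
    ∃ g : α.Pts ≤i β.Pts, ∀ y : β.Pts, y.1 ∈ S ↔ y ∈ range g := by
  obtain ⟨f, hf, hmono⟩ := h
  choose! g hg using hf.total
  have hgf : ∀ a ∈ α.carrier, ∀ b, opair a b ∈ f ↔ b = g a := fun a ha b =>
    ⟨fun h => hf.functional _ _ _ h (hg a ha).2, fun h => h ▸ (hg a ha).2⟩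
  let G : α.Pts → β.Pts := fun x => ⟨g x.1, hS.1 _ (hg x.1 x.2).1⟩
  have hG : StrictMono G := by
    intro x y hxy
    refine lt_of_le_of_ne (hmono x.1 x.2 y.1 y.2 _ (hg x.1 x.2).1 _ (hg y.1 y.2).1
      (hg x.1 x.2).2 (hg y.1 y.2).2 hxy.le) fun he => hxy.ne (Subtype.ext ?_)
    have he : g x.1 = g y.1 := congrArg Subtype.val he
    exact hf.injective x.1 y.1 (g x.1) (hg x.1 x.2).2 (he ▸ (hg y.1 y.2).2)
  have hr : ∀ y : β.Pts, y.1 ∈ S ↔ y ∈ range G := by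
    intro y
    constructor
    · intro hy
      obtain ⟨a, ha, hab⟩ := hf.surjective y.1 hy
      exact ⟨⟨a, ha⟩, Subtype.ext ((hgf a ha _).1 hab).symm⟩
    · rintro ⟨x, rfl⟩
      exact (hg x.1 x.2).1
  refine ⟨⟨(OrderEmbedding.ofStrictMono G hG).ltEmbedding, fun a b hba => ?_⟩, hr⟩
  exact (hr b).1 (hS.2 _ ((hr _).2 ⟨a, rfl⟩) b.1 b.2 hba.le)

theorem isoOrd_of_initialSeg (g : α.Pts ≤i β.Pts) :
    ∃ S, IsInitSeg S β.carrier β.rel ∧ IsoOrd α.carrier α.rel S β.rel ∧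
      ∀ y : β.Pts, y.1 ∈ S ↔ y ∈ range g := by
  have hmono : StrictMono g := fun x y h => g.map_rel_iff.2 h
  have hlow : ∀ x y, y ≤ g x → y ∈ range g := fun x y h =>
    h.lt_or_eq.elim (fun h => g.mem_range_of_rel h) fun h => ⟨x, h.symm⟩
  -- An order embedding with order-connected range is continuous for the order topologies, so its
  -- graph is compact and hence a set of the universe.
  have hcont : Continuous g := (hmono.isEmbedding_of_ordConnected
    ⟨fun _ _ y hy z hz => by
      obtain ⟨w, rfl⟩ := hy
      exact hlow w z hz.2⟩).continuous
  have hcv : Continuous fun x : α.Pts => (g x).1 := continuous_subtype_val.comp hcont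
  have hcl : IsClosed (range fun x : α.Pts => (g x).1) := (isCompact_range hcv).isClosed
  have hclC : IsClosed (range fun x : α.Pts => (x.1, (g x).1)) :=
    (isCompact_range (continuous_subtype_val.prodMk hcv)).isClosed
  have hS : ∀ y, y ∈ hull (range fun x : α.Pts => (g x).1) ↔ ∃ x, (g x).1 = y :=
    fun y => mem_hull_of_isClosed hcl
  have hf : ∀ a b, opair a b ∈ ofRel (range fun x : α.Pts => (x.1, (g x).1)) ↔
      ∃ x : α.Pts, x.1 = a ∧ (g x).1 = b := fun a b => by
    rw [opair_mem_ofRel hclC, mem_range]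
    simp only [Prod.mk.injEq]
  refine ⟨hull (range fun x : α.Pts => (g x).1), ⟨?_, ?_⟩, ⟨ofRel (range fun x : α.Pts =>
    (x.1, (g x).1)), ⟨⟨?_, ?_, ?_, ?_⟩, ?_⟩, ?_⟩, ?_⟩
  · intro y hy
    obtain ⟨x, rfl⟩ := (hS y).1 hy
    exact (g x).2
  · intro y hy z hz hzy
    obtain ⟨x, rfl⟩ := (hS y).1 hy
    obtain ⟨w, hw⟩ := hlow x ⟨z, hz⟩ hzy
    exact (hS z).2 ⟨w, congrArg Subtype.val hw⟩
  · intro p hp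
    obtain ⟨a, b, ⟨x, hx⟩, rfl⟩ := (mem_ofRel hclC).1 hp
    obtain ⟨rfl, rfl⟩ := Prod.mk.inj hx
    exact opair_mem_prod.2 ⟨x.2, (hS _).2 ⟨x, rfl⟩⟩
  · exact fun a ha => ⟨_, (hS _).2 ⟨⟨a, ha⟩, rfl⟩, (hf _ _).2 ⟨⟨a, ha⟩, rfl, rfl⟩⟩
  · intro a b c hab hac
    obtain ⟨x, rfl, rfl⟩ := (hf _ _).1 hab
    obtain ⟨y, hy, rfl⟩ := (hf _ _).1 hac
    rw [show y = x from Subtype.ext hy]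
  · intro a b c hac hbc
    obtain ⟨x, rfl, rfl⟩ := (hf _ _).1 hac
    obtain ⟨y, rfl, hy⟩ := (hf _ _).1 hbc
    rw [hmono.injective (Subtype.ext hy)]
  · intro b hb
    obtain ⟨x, rfl⟩ := (hS b).1 hb
    exact ⟨x.1, x.2, (hf _ _).2 ⟨x, rfl, rfl⟩⟩
  · intro x hx y hy u _ v _ hxu hyv hxy
    obtain ⟨x, rfl, rfl⟩ := (hf _ _).1 hxu
    obtain ⟨y, rfl, rfl⟩ := (hf _ _).1 hyv
    exact hmono.monotone hxy
  · exact fun y => (hS y.1).trans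
      ⟨fun ⟨x, hx⟩ => ⟨x, Subtype.ext hx⟩, fun ⟨x, hx⟩ => ⟨x, congrArg Subtype.val hx⟩⟩

theorem leO_of_otype_le (h : α.otype ≤ β.otype) : LeO α β := by
  obtain ⟨g⟩ := Ordinal.type_le_iff.1 h
  obtain ⟨S, h1, h2, -⟩ := isoOrd_of_initialSeg g
  exact ⟨S, h1, h2⟩

theorem mem_range_iff_lt (g : α.Pts ≤i β.Pts) {m : β.Pts}
    (hm : pos m = α.otype) (y : β.Pts) : y ∈ range g ↔ y < m := by
  constructor
  · rintro ⟨x, rfl⟩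
    rw [← pos_lt_pos, pos_apply, hm]
    exact pos_lt_otype x
  · intro hy
    rw [← pos_lt_pos, hm] at hy
    obtain ⟨x, hx⟩ := exists_pos_eq hy
    exact ⟨x, (Ordinal.typein_inj (· < ·)).1 ((pos_apply g x).trans hx)⟩

theorem ltO_iff : LtO α β ↔ α.otype < β.otype := by
  constructor
  · rintro ⟨S, hS, hiso⟩
    obtain ⟨g, hg⟩ := initialSeg_of_isoOrd hS.1 hiso
    have hns : ¬ Function.Surjective g := fun hs => hS.2 <| aset_ext fun x =>
      ⟨hS.1.1 x, fun hx => (hg ⟨x, hx⟩).2 (hs _)⟩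
    exact (g.toPrincipalSeg hns).ordinal_type_lt
  · intro h
    obtain ⟨g⟩ := Ordinal.type_le_iff.1 h.le
    obtain ⟨S, h1, h2, h3⟩ := isoOrd_of_initialSeg g
    obtain ⟨m, hm⟩ := exists_pos_eq h
    refine ⟨S, ⟨h1, fun hS => ?_⟩, h2⟩
    have := (h3 m).1 (hS ▸ m.2)
    exact lt_irrefl m ((mem_range_iff_lt g hm m).1 this)

theorem isPredO_iff : IsPredO α β ↔ β.otype = α.otype + 1 := by
  constructor
  · rintro ⟨S, hS, ⟨m, hm, hmS, hmax⟩, hiso⟩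
    obtain ⟨g, hg⟩ := initialSeg_of_isoOrd hS hiso
    have hns : ¬ Function.Surjective g := fun hs => hmS ((hg ⟨m, hm⟩).2 (hs _))
    have hlt : α.otype < β.otype := (g.toPrincipalSeg hns).ordinal_type_lt
    refine le_antisymm (le_of_forall_lt fun o ho => ?_) (Order.add_one_le_of_lt hlt)
    obtain ⟨x, rfl⟩ := exists_pos_eq ho
    rw [Order.lt_add_one_iff]
    obtain ⟨k, hk⟩ := exists_pos_eq hlt
    have hrange := mem_range_iff_lt g hk
    rw [← hk, pos_le_pos]
    by_contra hcon
    rw [not_le] at hcon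
    have h1 : x.1 = m := (hmax x.1 x.2).resolve_left fun h =>
      lt_asymm hcon ((hrange x).1 ((hg x).1 h))
    have h2 : k.1 = m := (hmax k.1 k.2).resolve_left fun h =>
      lt_irrefl k ((hrange k).1 ((hg k).1 h))
    exact hcon.ne (Subtype.ext (h2.trans h1.symm))
  · intro h
    have hlt : α.otype < β.otype := h ▸ Order.lt_add_one_iff.2 le_rfl
    obtain ⟨g⟩ := Ordinal.type_le_iff.1 hlt.le
    obtain ⟨S, h1, h2, h3⟩ := isoOrd_of_initialSeg g
    obtain ⟨m, hm⟩ := exists_pos_eq hlt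
    have hrange := mem_range_iff_lt g hm
    refine ⟨S, h1, ⟨m.1, m.2, fun hc => lt_irrefl m ((hrange m).1 ((h3 m).1 hc)), ?_⟩, h2⟩
    intro x hx
    have hxm : (⟨x, hx⟩ : β.Pts) ≤ m := by
      rw [← pos_le_pos, hm, ← Order.lt_add_one_iff, ← h]
      exact pos_lt_otype _
    rcases hxm.lt_or_eq with hl | he
    · exact Or.inl ((h3 ⟨x, hx⟩).2 ((hrange _).2 hl))
    · exact Or.inr (congrArg Subtype.val he)

theorem exists_otype_eq_add_one {o : Ordinal.{0}} (h : o < α.otype) :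
    ∃ γ : Ordn, γ.otype = o + 1 := by
  obtain ⟨z, rfl⟩ := exists_pos_eq h
  obtain ⟨γ, hγ, hrel⟩ := α.exists_restrict (α.isClosed_below z.1) (α.below_subset z.1)
  have hmem : ∀ x, x ∈ γ.carrier ↔ x ∈ α.below z.1 := fun x => by rw [← mem_els, hγ]
  let G : γ.Pts → α.Pts := fun x => ⟨x.1, ((hmem x.1).1 x.2).1⟩
  have hG : StrictMono G := fun x y hxy => lt_of_le_of_ne
    ((hrel x.1 ((hmem _).1 x.2) y.1 ((hmem _).1 y.2)).1 hxy.le)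
    fun he => hxy.ne (Subtype.ext (congrArg Subtype.val he : (G x).1 = (G y).1))
  let g : γ.Pts ≤i α.Pts := ⟨(OrderEmbedding.ofStrictMono G hG).ltEmbedding, fun a b hba =>
    ⟨⟨b.1, (hmem _).2 ⟨b.2, α.wo.trans _ _ _ hba.le ((hmem a.1).1 a.2).2⟩⟩, rfl⟩⟩
  have hz : z.1 ∈ α.below z.1 := ⟨z.2, α.wo.refl _ z.2⟩
  let t : γ.Pts := ⟨z.1, (hmem _).2 hz⟩
  have ht : ∀ x, x ≤ t := fun x =>
    (hrel x.1 ((hmem _).1 x.2) z.1 hz).2 ((hmem x.1).1 x.2).2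
  refine ⟨γ, ?_⟩
  rw [otype_eq_of_max ht, ← pos_apply g]
  rfl

theorem exists_otype_eq_zero : ∃ γ : Ordn, γ.otype = 0 := by
  obtain ⟨γ, hγ⟩ := hasWO_of_subsingleton subsingleton_empty
  exact ⟨γ, otype_eq_zero_iff.2 (eq_empty_iff.2 hγ)⟩

/-- The ordinals of the universe have the order types `0` and `δ + 1`; as an index of iterated
derivatives, the former stands for `0` and the latter for `1 + δ`. -/
def IsIndex (α : Ordn) (i : Ordinal.{0}) : Prop :=
  α.otype = 0 ∧ i = 0 ∨ ∃ δ, α.otype = δ + 1 ∧ i = 1 + δ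

variable (α) in
theorem exists_isIndex : ∃ i, α.IsIndex i := by
  by_cases h : α.otype = 0
  · exact ⟨0, Or.inl ⟨h, rfl⟩⟩
  · obtain ⟨t, ht⟩ := exists_isMax h
    exact ⟨_, Or.inr ⟨_, otype_eq_of_max ht, rfl⟩⟩

theorem IsIndex.otype_le_otype_iff {i j : Ordinal.{0}} (hi : α.IsIndex i) (hj : β.IsIndex j) :
    α.otype ≤ β.otype ↔ i ≤ j := by
  rcases hi with ⟨h1, rfl⟩ | ⟨δ, h1, rfl⟩ <;> rcases hj with ⟨h2, rfl⟩ | ⟨ε, h2, rfl⟩ <;>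
    rw [h1, h2]
  · simp
  · simp
  · simp

theorem IsIndex.otype_lt_otype_iff {i j : Ordinal.{0}} (hi : α.IsIndex i) (hj : β.IsIndex j) :
    α.otype < β.otype ↔ i < j := by
  rw [← not_le, hj.otype_le_otype_iff hi, not_le]

theorem IsIndex.eq {i j : Ordinal.{0}} (hi : α.IsIndex i) (hj : α.IsIndex j) : i = j :=
  le_antisymm ((hi.otype_le_otype_iff hj).1 le_rfl) ((hj.otype_le_otype_iff hi).1 le_rfl)

theorem IsIndex.add_one {i : Ordinal.{0}} (hi : α.IsIndex i) (h : IsPredO α β) :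
    β.IsIndex (i + 1) := by
  rw [isPredO_iff] at h
  rcases hi with ⟨h1, rfl⟩ | ⟨δ, h1, rfl⟩
  · exact Or.inr ⟨0, by rw [h, h1], by simp⟩
  · exact Or.inr ⟨δ + 1, by rw [h, h1], by rw [add_assoc]⟩

theorem exists_isIndex_of_le {i : Ordinal.{0}} (h : i < α.otype) : ∃ γ : Ordn, γ.IsIndex i := by
  by_cases h0 : i = 0
  · obtain ⟨γ, hγ⟩ := exists_otype_eq_zero
    exact ⟨γ, Or.inl ⟨hγ, h0⟩⟩
  · have h1 : 1 + (i - 1) = i := Ordinal.add_sub_cancel_of_le (Order.one_le_iff_pos.2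
      (pos_iff_ne_zero.2 h0))
    obtain ⟨γ, hγ⟩ := exists_otype_eq_add_one ((Ordinal.sub_le_self i 1).trans_lt h)
    exact ⟨γ, Or.inr ⟨_, hγ, h1.symm⟩⟩

/-- An internal limit has order type `δ + 1` with `δ` a limit, since otherwise a segment would be a
predecessor. Then `1 + δ = δ`, so the index is `δ` itself. -/
theorem IsIndex.isSuccLimit {i : Ordinal.{0}} (hi : α.IsIndex i) (h : IsLimitO α) :
    Order.IsSuccLimit i ∧ i < α.otype := by
  have h0 : α.otype ≠ 0 := fun h0 => h.1 (otype_eq_zero_iff.1 h0)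
  rcases hi with ⟨h1, -⟩ | ⟨δ, h1, rfl⟩
  · exact (h0 h1).elim
  · rcases Ordinal.zero_or_succ_or_isSuccLimit δ with rfl | ⟨ε, rfl⟩ | hl
    · obtain ⟨γ, hγ⟩ := exists_otype_eq_zero
      exact (h.2 ⟨γ, isPredO_iff.2 (by rw [h1, hγ])⟩).elim
    · obtain ⟨γ, hγ⟩ := exists_otype_eq_add_one (α := α) (o := ε) (by
        rw [h1]
        exact lt_trans (by simp) (Order.lt_add_one_iff.2 le_rfl))
      exact (h.2 ⟨γ, isPredO_iff.2 (by rw [h1, hγ]; simp)⟩).elim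
    · refine ⟨Ordinal.isSuccLimit_add 1 hl, ?_⟩
      rw [h1, Ordinal.one_add_of_omega0_le (Ordinal.omega0_le_of_isSuccLimit hl)]
      exact Order.lt_add_one_iff.2 le_rfl

end Ordn

/-! ### The Cantor-Bendixson degree -/

theorem els_derived {A : ASet} : els (derived A) = {x | AccIn (els A) x} :=
  els_hull_of_isClosed (isClosed_accIn (els A))

theorem els_derived_of_els_eq {A D : ASet} {i : Ordinal.{0}} (h : els D = CB (els A) i) :
    els (derived D) = CB (els A) (i + 1) := by
  rw [els_derived, h]
  exact Set.ext fun x => (mem_CB_succ (isClosed_els A)).symm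

theorem IterDerived.els_eq {A D : ASet} {α : Ordn} (h : IterDerived A α D) :
    ∀ {i}, α.IsIndex i → els D = CB (els A) i := by
  induction h with
  | zero α h0 =>
    intro i hi
    rcases hi with ⟨-, rfl⟩ | ⟨δ, h1, -⟩
    · rw [CB_zero]
    · rw [Ordn.otype_eq_zero_iff.2 h0] at h1
      exact (Order.succ_ne_bot δ h1.symm).elim
  | succ α p D hp _ ih =>
    intro i hi
    obtain ⟨j, hj⟩ := p.exists_isIndex
    rw [hi.eq (hj.add_one hp)]
    exact els_derived_of_els_eq (ih hj)
  | limit α f D hα hf hD ih =>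
    intro i hi
    obtain ⟨hl, hlt⟩ := hi.isSuccLimit hα
    refine Subset.antisymm (fun x hx => mem_CB_of_isSuccLimit hl fun j hj => ?_)
      fun x hx => (hD x).2 fun β hβ => ?_
    · obtain ⟨β, hβ⟩ := Ordn.exists_isIndex_of_le (hj.trans hlt)
      have hβα : LtO β α := Ordn.ltO_iff.2 ((hβ.otype_lt_otype_iff hi).2 hj)
      rw [← ih β hβα hβ]
      exact (hD x).1 hx β hβα
    · obtain ⟨j, hj⟩ := β.exists_isIndex
      rw [← mem_els, ih β hβ hj]
      exact CB_anti _ ((hj.otype_lt_otype_iff hi).1 (Ordn.ltO_iff.1 hβ)).le hx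

/-- Existence of the internal iterated derivatives; `IterDerived.els_eq` gives their uniqueness. -/
theorem iterDerived_hull (A : ASet) (α : Ordn) : ∀ {i}, α.IsIndex i →
    IterDerived A α (hull (CB (els A) i)) := by
  induction hα : α.otype using WellFoundedLT.induction generalizing α with
  | ind o ih =>
    intro i hi
    have hcl := fun j => isClosed_CB (isClosed_els A) j
    by_cases h0 : α.carrier = empty
    · have h := IterDerived.zero (A := A) α h0
      rwa [← h.els_eq hi, hull_els]
    by_cases hp : ∃ p, IsPredO p α
    · obtain ⟨p, hp⟩ := hp
      obtain ⟨j, hj⟩ := p.exists_isIndex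
      have hlt : p.otype < o := by
        rw [← hα, Ordn.isPredO_iff.1 hp]
        exact Order.lt_add_one_iff.2 le_rfl
      have h := IterDerived.succ α p _ hp (ih _ hlt p rfl hj)
      rwa [← h.els_eq hi, hull_els]
    · choose idx hidx using fun β : Ordn => β.exists_isIndex
      have hlim : IsLimitO α := ⟨h0, hp⟩
      obtain ⟨hl, hlt⟩ := hi.isSuccLimit hlim
      refine IterDerived.limit α (fun β => hull (CB (els A) (idx β))) _ hlim (fun β hβ =>
        ih _ (hα ▸ Ordn.ltO_iff.1 hβ) β rfl (hidx β)) fun x => ?_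
      simp only [mem_hull_of_isClosed (hcl _)]
      constructor
      · exact fun hx β hβ => CB_anti _
          (((hidx β).otype_lt_otype_iff hi).1 (Ordn.ltO_iff.1 hβ)).le hx
      · intro h
        refine mem_CB_of_isSuccLimit hl fun j hj => ?_
        obtain ⟨β, hβ⟩ := Ordn.exists_isIndex_of_le (hj.trans hlt)
        rw [hβ.eq (hidx β)]
        exact h β (Ordn.ltO_iff.2 ((hβ.otype_lt_otype_iff hi).2 hj))

theorem els_natOrd_one : els (natOrd 1) = {natOrd 0} := by
  ext x
  rw [mem_els, mem_natOrd, mem_singleton_iff]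
  exact ⟨fun ⟨k, hk, h⟩ => by rwa [Nat.lt_one_iff.1 hk] at h, fun h => ⟨0, one_pos, h⟩⟩

theorem eqC_natOrd_one_iff {D : ASet} : EqC D (natOrd 1) ↔ (els D).encard = 1 := by
  rw [eqC_iff, els_natOrd_one]
  constructor
  · rintro ⟨h1, h2⟩
    have h1 := h1.encard_CB_le 0
    have h2 := h2.encard_CB_le 0
    rw [CB_zero, CB_zero, encard_singleton] at h1 h2
    exact le_antisymm h1 h2
  · intro h
    obtain ⟨x, hx⟩ := encard_eq_one.1 h
    rw [hx]
    exact ⟨⟨fun _ => natOrd 0, continuousOn_const, fun _ _ => rfl, injOn_singleton _ _⟩,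
      ⟨fun _ => x, continuousOn_const, fun _ _ => rfl, injOn_singleton _ _⟩⟩

theorem CBDegreeOne.exists_hasType {A : ASet} (h : CBDegreeOne A) : ∃ b, HasType (els A) b 1 := by
  obtain ⟨D, ⟨α, -, hD⟩, h1⟩ := h
  obtain ⟨i, hi⟩ := α.exists_isIndex
  exact ⟨i, by rw [← hD.els_eq hi, eqC_natOrd_one_iff.1 h1]; rfl, one_pos⟩

/-- By upward isolation a point is approached only from below, so its rank cannot exceed its
position. Hence an internal ordinal with the rank of `α` as index can be found by cutting `α`
itself. -/
theorem Ordn.le_pos {α : Ordn} (x : α.Pts) : ∀ o, x.1 ∈ CB (els α.carrier) o → o ≤ pos x := by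
  induction x using WellFoundedLT.induction with
  | ind x ih =>
    refine fun o hx => le_of_forall_lt fun p hp => ?_
    obtain ⟨n, hn⟩ := α.wo.upward_isolated x.1 x.2
    obtain ⟨y, hy, hne, hyx⟩ := (mem_CB.1 hx).2 p hp n
    have hyA : y ∈ α.carrier := CB_subset _ _ hy
    have hlt : (⟨y, hyA⟩ : α.Pts) < x := by
      rw [← not_le]
      exact fun hle => hne (hn y hyA hyx hle)
    exact (ih _ hlt p hy).trans_lt (pos_lt_pos.2 hlt)

theorem Ordn.cbDegreeOne_of_hasType {α : Ordn} {b : Ordinal.{0}}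
    (h : HasType (els α.carrier) b 1) : CBDegreeOne α.carrier := by
  have hcl := fun j => isClosed_CB (isClosed_els α.carrier) j
  obtain ⟨x, hx⟩ := h.nonempty_CB
  obtain ⟨γ, hγ⟩ := exists_isIndex_of_le (α := α) (i := b)
    ((Ordn.le_pos ⟨x, CB_subset _ _ hx⟩ b hx).trans_lt (pos_lt_otype _))
  have hit := iterDerived_hull α.carrier γ hγ
  have hempty : CB (els α.carrier) (b + 1) = ∅ :=
    (CB_succ_eq_empty_iff (isClosed_els _)).2 h.finite
  refine ⟨_, ⟨γ, ⟨⟨_, hit, ?_⟩, fun β hβ => ?_⟩, hit⟩, ?_⟩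
  · rw [eq_empty_iff, els_derived_of_els_eq (els_hull_of_isClosed (hcl b)), hempty]
  · obtain ⟨D, hD, hD0⟩ := hβ
    obtain ⟨j, hj⟩ := β.exists_isIndex
    rw [eq_empty_iff, els_derived_of_els_eq (hD.els_eq hj)] at hD0
    refine leO_of_otype_le ((hγ.otype_le_otype_iff hj).2 ?_)
    by_contra hlt
    have := CB_anti _ (Order.add_one_le_of_lt (not_le.1 hlt)) hx
    rw [hD0] at this
    exact this
  · rw [eqC_natOrd_one_iff, els_hull_of_isClosed (hcl b), h.encard_eq]
    rfl

/-! ### Continuous injective images -/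

theorem exists_cyl_of_image {f : ASet → ASet} {S : Set ASet} (hS : IsClosed S)
    (hf : ContinuousOn f S) (hi : InjOn f S) {x : ASet} (hx : x ∈ S) (n : ℕ) :
    ∃ m, ∀ y ∈ S, f y ∈ cyl (f x) m → y ∈ cyl x n := by
  have hcl : IsClosed (f '' (S \ cyl x n)) :=
    ((hS.inter (isClopen_cyl x n).compl.isClosed).isCompact.image_of_continuousOn
      (hf.mono inter_subset_left)).isClosed
  obtain ⟨m, hm⟩ := exists_cyl_subset hcl.isOpen_compl (x := f x) (by
    rintro ⟨y, hy, hyx⟩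
    exact hy.2 (hi hy.1 hx hyx ▸ rfl))
  exact ⟨m, fun y hy hyx => by_contra fun hc => hm hyx ⟨y, ⟨hy, hc⟩, rfl⟩⟩

theorem AccIn.of_image {f : ASet → ASet} {S T : Set ASet} (hS : IsClosed S)
    (hf : ContinuousOn f S) (hi : InjOn f S) (hT : T ⊆ S) {x : ASet} (hx : x ∈ S)
    (h : AccIn (f '' T) (f x)) : AccIn T x := by
  intro n
  obtain ⟨m, hm⟩ := exists_cyl_of_image hS hf hi hx n
  obtain ⟨_, ⟨y, hy, rfl⟩, hne, hyx⟩ := h m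
  exact ⟨y, hy, fun he => hne (he ▸ rfl), hm y (hT hy) hyx⟩

/-- By compactness a continuous injection is a homeomorphism onto its image, so derivatives are
transported exactly. -/
theorem CB_image {f : ASet → ASet} {S : Set ASet} (hS : IsClosed S) (hf : ContinuousOn f S)
    (hi : InjOn f S) (o : Ordinal.{0}) : CB (f '' S) o = f '' CB S o := by
  refine Subset.antisymm ?_ (mapsTo_CB hf (mapsTo_image f S) hi o).image_subset
  induction o using WellFoundedLT.induction with
  | ind o ih =>
    intro z hz
    obtain ⟨x, hx, rfl⟩ := CB_subset _ _ hz
    exact ⟨x, mem_CB.2 ⟨hx, fun p hp =>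
      (((mem_CB.1 hz).2 p hp).mono (ih p hp)).of_image hS hf hi (CB_subset S p) hx⟩, rfl⟩

theorem Ordn.exists_image (α : Ordn) {f : ASet → ASet} (hf : ContinuousOn f (els α.carrier))
    (hi : InjOn f (els α.carrier)) : ∃ β : Ordn, els β.carrier = f '' els α.carrier ∧
      ∀ x ∈ α.carrier, ∀ y ∈ α.carrier, (opair (f x) (f y) ∈ β.rel ↔ opair x y ∈ α.rel) := by
  have hA := isClosed_els α.carrier
  let r : ASet → ASet → Prop := fun u v =>
    ∃ x ∈ α.carrier, ∃ y ∈ α.carrier, u = f x ∧ v = f y ∧ opair x y ∈ α.rel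
  have hr : ∀ x ∈ α.carrier, ∀ y ∈ α.carrier, r (f x) (f y) ↔ opair x y ∈ α.rel := by
    intro x hx y hy
    constructor
    · rintro ⟨x', hx', y', hy', h1, h2, h⟩
      rwa [hi hx hx' h1, hi hy hy' h2]
    · exact fun h => ⟨x, hx, y, hy, rfl, rfl, h⟩
  have hcl : IsClosed {p : ASet × ASet | p.1 ∈ f '' els α.carrier ∧ p.2 ∈ f '' els α.carrier ∧
      r p.1 p.2} := by
    have : {p : ASet × ASet | p.1 ∈ f '' els α.carrier ∧ p.2 ∈ f '' els α.carrier ∧ r p.1 p.2} =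
        Prod.map f f '' ((els α.carrier ×ˢ els α.carrier) ∩ {p | opair p.1 p.2 ∈ α.rel}) := by
      ext ⟨u, v⟩
      constructor
      · rintro ⟨-, -, x, hx, y, hy, rfl, rfl, h⟩
        exact ⟨(x, y), ⟨⟨hx, hy⟩, h⟩, rfl⟩
      · rintro ⟨⟨x, y⟩, ⟨⟨hx, hy⟩, h⟩, he⟩
        obtain ⟨rfl, rfl⟩ := Prod.mk.inj he
        exact ⟨⟨x, hx, rfl⟩, ⟨y, hy, rfl⟩, x, hx, y, hy, rfl, rfl, h⟩
    rw [this]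
    exact (((hA.prod hA).inter (isClosed_rel α.rel)).isCompact.image_of_continuousOn
      ((hf.prodMap hf).mono inter_subset_left)).isClosed
  refine (exists_ordn (S := f '' els α.carrier) (r := r)
    (hA.isCompact.image_of_continuousOn hf).isClosed hcl ?_ ?_ ?_ ?_ ?_ ?_).imp fun β hβ =>
    ⟨hβ.1, fun x hx y hy => (hβ.2 _ (mem_image_of_mem f hx) _ (mem_image_of_mem f hy)).trans
      (hr x hx y hy)⟩
  · rintro _ ⟨x, hx, rfl⟩
    exact (hr x hx x hx).2 (α.wo.refl x hx)
  · rintro _ ⟨x, hx, rfl⟩ _ ⟨y, hy, rfl⟩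
    rw [hr x hx y hy, hr y hy x hx]
    exact fun h1 h2 => congrArg f (α.wo.antisymm x y h1 h2)
  · rintro _ ⟨x, hx, rfl⟩ _ ⟨y, hy, rfl⟩ _ ⟨z, hz, rfl⟩
    rw [hr x hx y hy, hr y hy z hz, hr x hx z hz]
    exact α.wo.trans x y z
  · rintro _ ⟨x, hx, rfl⟩ _ ⟨y, hy, rfl⟩
    rw [hr x hx y hy, hr y hy x hx]
    exact α.wo.total x hx y hy
  · intro B hB hBc hne
    obtain ⟨m, hm, hmin⟩ := α.wo.exists_min_of_isClosed (B := els α.carrier ∩ f ⁻¹' B)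
      (hf.preimage_isClosed_of_isClosed hA hBc) inter_subset_left (by
        obtain ⟨u, hu⟩ := hne
        obtain ⟨x, hx, rfl⟩ := hB hu
        exact ⟨x, hx, hu⟩)
    refine ⟨f m, hm.2, fun u hu => ?_⟩
    obtain ⟨x, hx, rfl⟩ := hB hu
    exact (hr m hm.1 x hx).2 (hmin x ⟨hx, hu⟩)
  · rintro _ ⟨x, hx, rfl⟩
    obtain ⟨n, hn⟩ := α.wo.upward_isolated x hx
    obtain ⟨m, hm⟩ := exists_cyl_of_image hA hf hi hx n
    refine ⟨m, ?_⟩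
    rintro _ ⟨y, hy, rfl⟩ hyx h
    exact congrArg f (hn y hy (hm y hy hyx) ((hr x hx y hy).1 h))

/-! ### Products -/

/-- The class of all ordered pairs of elements of two classes. -/
def rect (N S : Set ASet) : Set ASet := (fun p : ASet × ASet => opair p.1 p.2) '' (N ×ˢ S)

theorem opair_mem_rect {N S : Set ASet} {a b : ASet} :
    opair a b ∈ rect N S ↔ a ∈ N ∧ b ∈ S :=
  (opair_injective.mem_set_image (a := (a, b))).trans Iff.rfl

theorem isClosed_rect {N S : Set ASet} (hN : IsClosed N) (hS : IsClosed S) :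
    IsClosed (rect N S) :=
  isClosedEmbedding_opair.isClosedMap _ (hN.prod hS)

theorem countable_rect {N S : Set ASet} (hN : N.Countable) (hS : S.Countable) :
    (rect N S).Countable := (hN.prod hS).image _

theorem encard_rect (N S : Set ASet) : (rect N S).encard = N.encard * S.encard := by
  rw [rect, opair_injective.encard_image, encard_prod]

theorem mem_rect {N S : Set ASet} {x : ASet} :
    x ∈ rect N S ↔ ∃ a ∈ N, ∃ b ∈ S, x = opair a b := by
  constructor
  · rintro ⟨⟨a, b⟩, ⟨ha, hb⟩, rfl⟩
    exact ⟨a, ha, b, hb, rfl⟩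
  · rintro ⟨a, ha, b, hb, rfl⟩
    exact opair_mem_rect.2 ⟨ha, hb⟩

theorem continuous_opair_left (c : ASet) : Continuous (opair c) :=
  Continuous.opair continuous_const continuous_id

theorem injective_opair_left (c : ASet) : Function.Injective (opair c) :=
  fun _ _ h => (opair_inj.1 h).2

theorem exists_isOpen_slice {N S : Set ASet} (hS : IsClosed S) {c : ASet} (hc : c ∈ N)
    (hN : IsClosed (N \ {c})) : ∃ U, IsOpen U ∧ rect N S ∩ U = opair c '' S := by
  refine ⟨(rect (N \ {c}) S)ᶜ, (isClosed_rect hN hS).isOpen_compl, Set.ext fun x => ⟨?_, ?_⟩⟩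
  · rintro ⟨h1, h2⟩
    obtain ⟨a, ha, b, hb, rfl⟩ := mem_rect.1 h1
    have : a = c := by_contra fun hne => h2 (opair_mem_rect.2 ⟨⟨ha, hne⟩, hb⟩)
    exact ⟨b, hb, this ▸ rfl⟩
  · rintro ⟨b, hb, rfl⟩
    exact ⟨opair_mem_rect.2 ⟨hc, hb⟩, fun h => (opair_mem_rect.1 h).1.2 rfl⟩

theorem opair_mem_CB_rect_of_mem {N S : Set ASet} {c a : ASet} (hc : c ∈ N) {o : Ordinal.{0}}
    (h : a ∈ CB S o) : opair c a ∈ CB (rect N S) o :=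
  mapsTo_CB (continuous_opair_left c).continuousOn (fun _ hb => opair_mem_rect.2 ⟨hc, hb⟩)
    (injective_opair_left c).injOn o h

/-- An isolated first coordinate gives an open slice homeomorphic to `S`. -/
theorem opair_mem_CB_rect {N S : Set ASet} (hS : IsClosed S) {c a : ASet} (hc : c ∈ N)
    (hN : IsClosed (N \ {c})) {o : Ordinal.{0}} :
    opair c a ∈ CB (rect N S) o ↔ a ∈ CB S o := by
  refine ⟨fun h => ?_, opair_mem_CB_rect_of_mem hc⟩
  obtain ⟨U, hU, hUc⟩ := exists_isOpen_slice hS hc hN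
  have ha : opair c a ∈ opair c '' S := ⟨a, (opair_mem_rect.1 (CB_subset _ _ h)).2, rfl⟩
  have h2 : opair c a ∈ CB (rect N S ∩ U) o := by
    rw [CB_inter_isOpen _ hU]
    exact ⟨h, (hUc ▸ ha : opair c a ∈ rect N S ∩ U).2⟩
  rw [hUc, CB_image hS (continuous_opair_left c).continuousOn (injective_opair_left c).injOn] at h2
  obtain ⟨b, hb, he⟩ := h2
  exact injective_opair_left c he ▸ hb

theorem CB_rect_of_finite {N S : Set ASet} (hN : N.Finite) (hS : IsClosed S) (o : Ordinal.{0}) :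
    CB (rect N S) o = rect N (CB S o) := by
  have key : ∀ c ∈ N, ∀ a, opair c a ∈ CB (rect N S) o ↔ a ∈ CB S o := fun c hc a =>
    opair_mem_CB_rect hS hc (hN.subset sdiff_subset).isClosed
  ext x
  constructor
  · intro h
    obtain ⟨c, hc, a, -, rfl⟩ := mem_rect.1 (CB_subset _ _ h)
    exact opair_mem_rect.2 ⟨hc, (key c hc a).1 h⟩
  · intro h
    obtain ⟨c, hc, a, ha, rfl⟩ := mem_rect.1 h
    exact (key c hc a).2 ha

theorem els_prod_eq (A B : ASet) : els (prod A B) = rect (els A) (els B) := els_prod A B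

theorem els_natOrd (n : ℕ) : els (natOrd n) = natOrd '' Iio n := by
  ext x
  rw [mem_els, mem_natOrd]
  exact ⟨fun ⟨k, hk, h⟩ => ⟨k, hk, h.symm⟩, fun ⟨k, hk, h⟩ => ⟨k, hk, h.symm⟩⟩

theorem finite_els_natOrd (n : ℕ) : (els (natOrd n)).Finite := by
  rw [els_natOrd]
  exact (finite_Iio n).image _

theorem encard_els_natOrd (n : ℕ) : (els (natOrd n)).encard = n := by
  rw [els_natOrd, natOrd_injective.encard_image, ← Finset.coe_Iio, encard_coe_eq_coe_finsetCard]
  simp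

theorem natOrd_mem_natOrd {i n : ℕ} : natOrd i ∈ natOrd n ↔ i < n := by
  rw [mem_natOrd]
  exact ⟨fun ⟨k, hk, h⟩ => natOrd_injective h ▸ hk, fun h => ⟨i, h, rfl⟩⟩

theorem countable_prod {A B : ASet} (hA : (els A).Countable) (hB : (els B).Countable) :
    (els (prod A B)).Countable := by
  rw [els_prod_eq]
  exact countable_rect hA hB

theorem HasType.natOrd_prod {A : ASet} {b : Ordinal.{0}} {m n : ℕ} (h : HasType (els A) b m)
    (hn : 0 < n) : HasType (els (prod (natOrd n) A)) b (n * m) := by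
  refine ⟨?_, Nat.mul_pos hn h.pos⟩
  rw [els_prod_eq, CB_rect_of_finite (finite_els_natOrd n) (isClosed_els A), encard_rect,
    encard_els_natOrd, h.encard_eq]
  push_cast
  rfl

/-- The sum contains disjoint copies of both summands; this lower bound suffices to force ranks to
grow in absorbing sequences. -/
theorem encard_CB_sum_ge (A B : ASet) (o : Ordinal.{0}) :
    (CB (els A) o).encard + (CB (els B) o).encard ≤ (CB (els (sum A B)) o).encard := by
  have h1 : opair (natOrd 1) '' CB (els A) o ⊆ CB (els (sum A B)) o := by
    refine (mapsTo_CB (continuous_opair_left _).continuousOn (fun a ha => ?_)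
      (injective_opair_left _).injOn o).image_subset
    exact mem_union.2 (Or.inl (opair_mem_prod.2 ⟨mem_singleton.2 rfl, ha⟩))
  have h2 : opair (natOrd 2) '' CB (els B) o ⊆ CB (els (sum A B)) o := by
    refine (mapsTo_CB (continuous_opair_left _).continuousOn (fun a ha => ?_)
      (injective_opair_left _).injOn o).image_subset
    exact mem_union.2 (Or.inr (opair_mem_prod.2 ⟨mem_singleton.2 rfl, ha⟩))
  have hd : Disjoint (opair (natOrd 1) '' CB (els A) o) (opair (natOrd 2) '' CB (els B) o) := by
    rw [Set.disjoint_left]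
    rintro _ ⟨a, -, rfl⟩ ⟨b, -, he⟩
    exact absurd (natOrd_injective (opair_inj.1 he).1) (by decide)
  rw [← (injective_opair_left (natOrd 1)).encard_image, ← (injective_opair_left
    (natOrd 2)).encard_image (CB (els B) o), ← encard_union_eq hd]
  exact encard_le_encard (union_subset h1 h2)

/-! ### The product with `ω` -/

theorem isClosed_omega_diff (n : ℕ) : IsClosed (els omega \ {natOrd n}) := by
  obtain ⟨m, hm⟩ := exists_approx_natOrd_isolated n
  have : els omega \ {natOrd n} = els omega ∩ (cyl (natOrd n) m)ᶜ := by
    ext x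
    exact and_congr_right fun hx => not_congr ⟨fun h => h ▸ rfl, hm x hx⟩
  rw [this]
  exact (isClosed_els _).inter (isClopen_cyl _ _).compl.isClosed

theorem natOrd_mem_omega (n : ℕ) : natOrd n ∈ els omega := by
  rw [els_omega]
  exact Or.inr ⟨n, rfl⟩

theorem countable_omega : (els omega).Countable := by
  rw [els_omega]
  exact (countable_range natOrd).insert _

theorem AccIn.of_union {S T : Set ASet} {x : ASet} (h : AccIn (S ∪ T) x) :
    AccIn S x ∨ AccIn T x := by
  by_contra! hc
  unfold AccIn at hc
  push Not at hc
  obtain ⟨⟨m, hm⟩, n, hn⟩ := hc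
  obtain ⟨y, hy, hne, hyx⟩ := h (max m n)
  rcases hy with hy | hy
  · exact hm y hy hne (cyl_anti x (le_max_left m n) hyx)
  · exact hn y hy hne (cyl_anti x (le_max_right m n) hyx)

theorem mem_CB_of_natLim_mem {S : Set ASet} (hS : IsClosed S) (o : Ordinal.{0}) : ∀ a,
    opair natLim a ∈ CB (rect (els omega) S) o → ∀ p < o, a ∈ CB S p := by
  induction o using WellFoundedLT.induction with
  | ind o ih =>
    intro a ha p hp
    have haS : a ∈ S := (opair_mem_rect.1 (CB_subset _ _ ha)).2
    -- Over finite ordinals slices are open and ranks are those of `S`; over the limit the induction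
    -- hypothesis applies. Accumulation from either part puts `a` into `CB S p`.
    have hsub : CB (rect (els omega) S) p ⊆ rect univ (CB S p) ∪
        opair natLim '' {b | b ∈ S ∧ ∀ q < p, b ∈ CB S q} := by
      intro x hx
      obtain ⟨c, hc, b, hb, rfl⟩ := mem_rect.1 (CB_subset _ _ hx)
      have hc' := hc
      rw [els_omega] at hc'
      rcases hc' with rfl | ⟨n, rfl⟩
      · exact Or.inr ⟨b, ⟨hb, ih p hp b hx⟩, rfl⟩
      · exact Or.inl (opair_mem_rect.2 ⟨mem_univ _,
          (opair_mem_CB_rect hS hc (isClosed_omega_diff n)).1 hx⟩)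
    rcases (((mem_CB.1 ha).2 p hp).mono hsub).of_union with h | h
    · exact (opair_mem_rect.1 (h.mem (isClosed_rect isClosed_univ (isClosed_CB hS p)))).2
    · have h := h.of_image isClosed_univ (continuous_opair_left _).continuousOn
        (injective_opair_left _).injOn (subset_univ _) (mem_univ a)
      exact mem_CB.2 ⟨haS, fun q hq => h.mono fun b hb => hb.2 q hq⟩

/-- The points `(n, t)` all survive to stage `b` and converge to `(natLim, t)`, which gains exactly
one rank; every other point is gone by then. -/
theorem CB_omega_prod {A : ASet} {b : Ordinal.{0}} {t : ASet} (h : CB (els A) b = {t}) :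
    CB (els (prod omega A)) (b + 1) = {opair natLim t} := by
  have hA := isClosed_els A
  have hR := isClosed_rect (isClosed_els omega) hA
  have hempty : CB (els A) (b + 1) = ∅ := (CB_succ_eq_empty_iff hA).2 (h ▸ finite_singleton t)
  rw [els_prod_eq]
  refine Subset.antisymm (fun x hx => ?_) (singleton_subset_iff.2 ?_)
  · obtain ⟨c, hc, a, -, rfl⟩ := mem_rect.1 (CB_subset _ _ hx)
    have hc' := hc
    rw [els_omega] at hc'
    rcases hc' with rfl | ⟨n, rfl⟩
    · have := mem_CB_of_natLim_mem hA _ a hx b (Order.lt_add_one_iff.2 le_rfl)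
      rw [h] at this
      exact congrArg (opair natLim) this
    · have := (opair_mem_CB_rect hA hc (isClosed_omega_diff n)).1 hx
      rw [hempty] at this
      exact this.elim
  · rw [mem_CB_succ hR]
    have ht : t ∈ CB (els A) b := h ▸ rfl
    have htend : Tendsto (fun n => opair (natOrd n) t) atTop (𝓝 (opair natLim t)) :=
      ((Continuous.opair continuous_id continuous_const).tendsto natLim).comp tendsto_natOrd
    intro n
    obtain ⟨k, hk⟩ := (htend.eventually_mem ((isClopen_cyl _ n).isOpen.mem_nhds rfl)).exists
    exact ⟨_, opair_mem_CB_rect_of_mem (natOrd_mem_omega k) ht,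
      fun he => natOrd_ne_natLim k (opair_inj.1 he).1, hk⟩

/-! ### Comparing cardinalities -/

theorem exists_hasType_of_leC {A B : ASet} (h : LeC A B) (hA : (els A).Nonempty)
    (hB : (els B).Countable) : (els A).Countable ∧ ∃ b n, HasType (els A) b n := by
  have hc := (leC_iff.1 h).countable hB
  exact ⟨hc, exists_hasType (isClosed_els A) hc hA⟩

theorem leC_iff_of_hasType {A B : ASet} {b c : Ordinal.{0}} {m n : ℕ} (hc : (els A).Countable)
    (hA : HasType (els A) b m) (hB : HasType (els B) c n) : LeC A B ↔ b < c ∨ b = c ∧ m ≤ n :=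
  leC_iff.trans (hA.emb_iff (isClosed_els A) hc (isClosed_els B) hB)

theorem ltC_iff_leC {A B : ASet} : LtC A B ↔ LeC A B ∧ ¬ LeC B A := by
  unfold LtC EqC
  tauto

theorem ltC_iff_of_hasType {A B : ASet} {b c : Ordinal.{0}} {m n : ℕ} (hcA : (els A).Countable)
    (hcB : (els B).Countable) (hA : HasType (els A) b m) (hB : HasType (els B) c n) :
    LtC A B ↔ b < c ∨ b = c ∧ m < n := by
  rw [ltC_iff_leC, leC_iff_of_hasType hcA hA hB, leC_iff_of_hasType hcB hB hA]
  rcases lt_trichotomy b c with h | rfl | h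
  · simp [h, h.not_gt, h.ne']
  · simp only [lt_irrefl, true_and, false_or, not_le]
    omega
  · simp [h, h.not_gt, h.ne']

theorem LeC.trans {A B C : ASet} (h1 : LeC A B) (h2 : LeC B C) : LeC A C :=
  leC_iff.2 ((leC_iff.1 h1).trans (leC_iff.1 h2))

theorem LtC.nonempty {A B : ASet} (h : LtC A B) : (els B).Nonempty := by
  rw [nonempty_iff_ne_empty]
  intro h0
  rw [ltC_iff, h0] at h
  exact h.2 (Emb.of_subset (empty_subset _))

/-- There is no cardinality between those of rank `b` and degrees `n` and `n + 1`. -/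
theorem not_between {A B C : ASet} {b : Ordinal.{0}} {n : ℕ} (hA : HasType (els A) b n)
    (hcA : (els A).Countable) (hB : HasType (els B) b (n + 1)) (hcB : (els B).Countable)
    (h1 : LtC A C) (h2 : LtC C B) : False := by
  obtain ⟨hc, c, k, hC⟩ := exists_hasType_of_leC h2.1 h1.nonempty hcB
  rw [ltC_iff_of_hasType hcA hc hA hC] at h1
  rw [ltC_iff_of_hasType hc hcB hC hB] at h2
  rcases h1 with h1 | ⟨rfl, h1⟩
  · rcases h2 with h2 | ⟨rfl, -⟩
    · exact lt_asymm h1 h2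
    · exact lt_irrefl _ h1
  · rcases h2 with h2 | ⟨-, h2⟩
    · exact lt_irrefl _ h2
    · omega

theorem Ordn.IsCardinal.isWOCardinal {κ : Ordn} (h : κ.IsCardinal) : IsWOCardinal κ.carrier :=
  ⟨κ, rfl, h⟩

/-- A smaller nonempty set has type `(c, m)` with `c < b`, as no positive degree is below `1`, and
type `(c, m + 1)` still lies in between. Above the empty set there is a single point, which is
smaller than `A` because `b ≠ 0`. -/
theorem IsWOCardinal.isLimitCardinal {A : ASet} (hA : IsWOCardinal A) {b : Ordinal.{0}}
    (h : HasType (els A) b 1) (hb : b ≠ 0) : IsLimitCardinal A := by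
  refine ⟨Or.inl hA, ne_empty_iff.2 h.nonempty, ?_⟩
  rintro ⟨B, -, hBA, hcon⟩
  obtain ⟨α, rfl, -⟩ := hA
  have hcB := (leC_iff.1 hBA.1).countable α.countable
  have hb0 : 0 < b := pos_iff_ne_zero.2 hb
  rcases eq_empty_or_nonempty (els B) with h0 | hne
  · obtain ⟨γ, hγ, hγt⟩ := α.exists_cardinal_hasType 0 one_pos (by
      rw [CB_zero]
      simpa using one_le_encard_iff_nonempty.2 h.nonempty)
    refine hcon ⟨γ.carrier, Or.inl hγ.isWOCardinal, ?_,
      (ltC_iff_of_hasType γ.countable α.countable hγt h).2 (Or.inl hb0)⟩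
    rw [ltC_iff, h0]
    exact ⟨Emb.of_subset (empty_subset _), fun he => not_nonempty_empty (he.nonempty hγt.nonempty)⟩
  · obtain ⟨-, c, m, hB⟩ := exists_hasType_of_leC hBA.1 hne α.countable
    have hcb : c < b := by
      rcases (ltC_iff_of_hasType hcB α.countable hB h).1 hBA with h1 | ⟨-, h1⟩
      · exact h1
      · exact absurd hB.pos (by omega)
    obtain ⟨γ, hγ, hγt⟩ := α.exists_cardinal_hasType c (Nat.succ_pos m) (by
      rw [CB_encard_eq_top (isClosed_els _) hcb h.nonempty_CB]
      exact le_top)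
    exact hcon ⟨γ.carrier, Or.inl hγ.isWOCardinal,
      (ltC_iff_of_hasType hcB γ.countable hB hγt).2 (Or.inr ⟨rfl, Nat.lt_succ_self m⟩),
      (ltC_iff_of_hasType γ.countable α.countable hγt h).2 (Or.inl hcb)⟩

theorem leC_of_not_countable {A B : ASet} (hA : (els A).Countable) (hB : ¬ (els B).Countable) :
    LeC A B :=
  leC_iff.2 (Countable.emb_of_not_countable (isClosed_els A) hA (isClosed_els B) hB)

/-! ### Finite multiples -/

theorem Ordn.isCardinal_of_empty {κ : Ordn} (h : els κ.carrier = ∅) : κ.IsCardinal :=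
  fun _ hS _ => hS.2 <| els_injective <| (subset_empty_iff.1 (h ▸ hS.1.1)).trans h.symm

theorem Ordn.exists_isLexOrder (κ : Ordn) (n : ℕ) :
    ∃ P : Ordn, P.carrier = prod (natOrd n) κ.carrier ∧ IsLexOrder n κ P := by
  classical
  have hA := isClosed_els κ.carrier
  have hN := finite_els_natOrd n
  -- The level is the index of the first coordinate; the default `0` is never used on the product.
  let h : ASet → ℕ∞ := fun x => if hx : ∃ i a, x = opair (natOrd i) a then (hx.choose : ℕ) else 0
  have hh : ∀ i a, h (opair (natOrd i) a) = (i : ℕ) := by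
    intro i a
    have hx : ∃ j b, opair (natOrd i) a = opair (natOrd j) b := ⟨i, a, rfl⟩
    have hi : hx.choose = i :=
      (natOrd_injective (opair_inj.1 hx.choose_spec.choose_spec).1).symm
    simp only [h, dif_pos hx, hi]
  have hS : ∀ x ∈ rect (els (natOrd n)) (els κ.carrier), ∃ i < n, ∃ a ∈ els κ.carrier, x = opair (natOrd i) a := by
    intro x hx
    obtain ⟨c, hc, a, ha, rfl⟩ := mem_rect.1 hx
    obtain ⟨i, hi, rfl⟩ := mem_natOrd.1 hc
    exact ⟨i, hi, a, ha, rfl⟩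
  have hlev : IsLevel (rect (els (natOrd n)) (els κ.carrier)) h := by
    constructor
    · intro x hx _
      obtain ⟨i, hi, a, ha, rfl⟩ := hS x hx
      obtain ⟨U, hU, hUi⟩ := exists_isOpen_slice hA (natOrd_mem_natOrd.2 hi : natOrd i ∈ els _)
        (hN.subset sdiff_subset).isClosed
      have hxU : opair (natOrd i) a ∈ opair (natOrd i) '' els κ.carrier := ⟨a, ha, rfl⟩
      rw [← hUi] at hxU
      obtain ⟨m, hm⟩ := exists_cyl_subset hU hxU.2
      refine ⟨m, fun y hy hyx => ?_⟩
      have hyU : y ∈ opair (natOrd i) '' els κ.carrier := hUi ▸ ⟨hy, hm hyx⟩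
      obtain ⟨b, -, rfl⟩ := hyU
      rw [hh, hh]
    · intro x hx ht
      obtain ⟨i, hi, a, ha, rfl⟩ := hS x hx
      rw [hh] at ht
      exact (ENat.natCast_ne_top i ht).elim
  have hfib : ∀ k : ℕ∞, ∃ α : Ordn, els α.carrier = {x | x ∈ rect (els (natOrd n)) (els κ.carrier) ∧ h x = k} ∧
      ∀ i < n, (i : ℕ) = k → ∀ a ∈ κ.carrier, ∀ b ∈ κ.carrier,
        (opair (opair (natOrd i) a) (opair (natOrd i) b) ∈ α.rel ↔ opair a b ∈ κ.rel) := by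
    intro k
    by_cases hk : ∃ i < n, (i : ℕ) = k
    · obtain ⟨i, hi, rfl⟩ := hk
      obtain ⟨α, hα, hrel⟩ := κ.exists_image (continuous_opair_left (natOrd i)).continuousOn
        (injective_opair_left _).injOn
      refine ⟨α, ?_, fun j _ hj => ?_⟩
      · rw [hα]
        ext x
        constructor
        · rintro ⟨a, ha, rfl⟩
          exact ⟨opair_mem_rect.2 ⟨natOrd_mem_natOrd.2 hi, ha⟩, hh i a⟩
        · rintro ⟨hx, hxi⟩
          obtain ⟨j, -, a, ha, rfl⟩ := hS x hx
          rw [hh, Nat.cast_inj] at hxi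
          exact ⟨a, ha, hxi ▸ rfl⟩
      · rw [Nat.cast_inj] at hj
        subst hj
        exact hrel
    · obtain ⟨α, hα⟩ := hasWO_of_subsingleton subsingleton_empty
      refine ⟨α, hα.trans (eq_empty_of_forall_notMem ?_).symm, fun i hi hik =>
        (hk ⟨i, hi, hik⟩).elim⟩
      rintro x ⟨hx, hxk⟩
      obtain ⟨i, hi, a, -, rfl⟩ := hS x hx
      exact hk ⟨i, hi, (hh i a).symm.trans hxk⟩
  choose α hα hrel using hfib
  have htop : ∀ x ∈ rect (els (natOrd n)) (els κ.carrier), h x ≠ ⊤ := by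
    intro x hx
    obtain ⟨i, -, a, -, rfl⟩ := hS x hx
    rw [hh]
    exact ENat.natCast_ne_top i
  obtain ⟨P, hP, hPrel⟩ := exists_ordn_lex (isClosed_rect (isClosed_els _) hA) hlev
    (fun x hx _ _ ht => (htop x hx ht).elim) α hα
  refine ⟨P, els_injective (hP.trans (els_prod_eq _ _).symm), fun i hi j hj a ha b hb => ?_⟩
  rw [hPrel _ (opair_mem_rect.2 ⟨natOrd_mem_natOrd.2 hi, ha⟩) _
    (opair_mem_rect.2 ⟨natOrd_mem_natOrd.2 hj, hb⟩), hh, hh, Nat.cast_lt, Nat.cast_inj]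
  refine or_congr_right (and_congr_right fun hij => ?_)
  subst hij
  exact hrel i i hi rfl a ha b hb

theorem Ordn.IsCardinal.of_isLexOrder {κ P : Ordn} (hκ : κ.IsCardinal) {n : ℕ}
    (hP : P.carrier = prod (natOrd n) κ.carrier) (hlex : IsLexOrder n κ P) : P.IsCardinal := by
  have hels : els P.carrier = rect (els (natOrd n)) (els κ.carrier) := by rw [hP, els_prod_eq]
  by_cases hne : (els P.carrier).Nonempty
  swap
  · exact isCardinal_of_empty (not_nonempty_iff_eq_empty.1 hne)
  obtain ⟨x, hx⟩ := hne
  rw [hels] at hx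
  obtain ⟨c, hc, a, ha, rfl⟩ := mem_rect.1 hx
  obtain ⟨i, hi, rfl⟩ := mem_natOrd.1 hc
  obtain ⟨b, m, htype⟩ := exists_hasType (isClosed_els κ.carrier) κ.countable ⟨a, ha⟩
  obtain ⟨t, ht, hmax⟩ := κ.exists_max (isClosed_els _) Subset.rfl ⟨a, ha⟩
  -- The product is nonempty, so `0 < n` and the top copy of `κ` has index `n - 1`; its greatest
  -- element is that of the product.
  have hn : n - 1 < n := by omega
  refine isCardinal_of_max_mem (b := b) (n := n * m) (t := opair (natOrd (n - 1)) t) ?_ ?_ ?_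
  · rw [hP]
    exact htype.natOrd_prod (by omega)
  · rw [hels]
    exact opair_mem_CB_rect_of_mem (natOrd_mem_natOrd.2 hn) (hκ.max_mem htype ht hmax)
  · intro x hx
    rw [← mem_els, hels] at hx
    obtain ⟨c, hc, a, ha, rfl⟩ := mem_rect.1 hx
    obtain ⟨i, hi, rfl⟩ := mem_natOrd.1 hc
    refine (hlex i hi (n - 1) hn a ha t ht).2 ?_
    rcases lt_or_eq_of_le (Nat.le_sub_one_of_lt hi) with h | h
    · exact Or.inl h
    · exact Or.inr ⟨h, hmax a ha⟩

theorem countable_natOrd_prod {A : ASet} (h : (els A).Countable) (n : ℕ) :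
    (els (prod (natOrd n) A)).Countable :=
  countable_prod (finite_els_natOrd n).countable h

theorem countable_multiples {A : ASet} (h : (els A).Countable) :
    ∀ i, (els (multiples A i)).Countable
  | 0 => h
  | i + 1 => countable_natOrd_prod h (i + 2)

theorem HasType.multiples {A : ASet} {b : Ordinal.{0}} (h : HasType (els A) b 1) :
    ∀ i, HasType (els (multiples A i)) b (i + 1)
  | 0 => h
  | i + 1 => by
    have := h.natOrd_prod (Nat.succ_pos (i + 1))
    rwa [mul_one] at this

theorem infinite_of_isInfinite {A : ASet} (h : IsInfinite A) : (els A).Infinite := by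
  obtain ⟨B, hBA, hne, f, hf⟩ := h
  intro hfin
  have h1 := (leC_iff.1 ⟨f, hf.toIsInjection⟩).encard_CB_le 0
  rw [CB_zero, CB_zero] at h1
  have h2 : els B ⊂ els A := ssubset_of_subset_of_ne hBA fun he => hne (els_injective he)
  exact ((hfin.subset hBA).encard_lt_encard h2).not_ge h1

/-! ### Suprema -/

/-- Finite ordinals are isolated in `ω`, so a hull of finite ordinals remembers which of them were
put in; Cantor's theorem applies. -/
theorem not_countable_univ : ¬ (univ : Set ASet).Countable := by
  intro h
  have hinj : Function.Injective fun P : Set ℕ => hull (natOrd '' P) := by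
    have key : ∀ (P : Set ℕ) (k : ℕ), natOrd k ∈ hull (natOrd '' P) ↔ k ∈ P := by
      intro P k
      constructor
      · intro hk
        obtain ⟨m, hm⟩ := exists_approx_natOrd_isolated k
        obtain ⟨_, ⟨j, hj, rfl⟩, hjk⟩ := mem_hull_iff.1 hk m
        exact natOrd_injective (hm _ (natOrd_mem_omega j) hjk) ▸ hj
      · exact fun hk => mem_hull_iff.2 fun m => ⟨_, ⟨k, hk, rfl⟩, rfl⟩
    intro P Q hPQ
    ext k
    rw [← key P, ← key Q]
    exact iff_of_eq (congrArg (natOrd k ∈ ·) hPQ)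
  have : Countable ASet := countable_univ_iff.1 h
  have : Countable (Set ℕ) := hinj.countable
  obtain ⟨g, hg⟩ := exists_injective_nat (Set ℕ)
  exact Function.cantor_injective g hg

/-- Given countable closed classes of ranks `β k`, there is a countable closed class whose
derivative of order `⨆ k, β k` is nonempty. -/
theorem exists_CB_iSup_nonempty {β : ℕ → Ordinal.{0}} (hβ : StrictMono β) {S : ℕ → Set ASet}
    {n : ℕ → ℕ} (hS : ∀ k, IsClosed (S k)) (hc : ∀ k, (S k).Countable)
    (ht : ∀ k, HasType (S k) (β k) (n k)) :
    ∃ K : Set ASet, IsClosed K ∧ K.Countable ∧ (CB K (⨆ k, β k)).Nonempty := by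
  obtain ⟨y, hy⟩ := exists_forall_mem_CB isClosed_univ not_countable_univ
  -- A point of order `β k + 1` in the `k`-th annulus makes the derivative of order `β k` infinite
  -- there, leaving room for all of `S k`.
  obtain ⟨M, hM, hD⟩ := exists_annuli (y := y) (D := fun k => CB univ (β k + 1))
    fun k => (mem_CB.1 (hy (β k + 1 + 1))).2 _ (Order.lt_add_one_iff.2 le_rfl)
  have hclo : ∀ k, IsClopen (cyl y (M k) \ cyl y (M (k + 1))) := fun k =>
    (isClopen_cyl _ _).diff (isClopen_cyl _ _)
  have hemb : ∀ k, Emb (S k) (cyl y (M k) \ cyl y (M (k + 1))) := by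
    intro k
    refine emb_of_encard_le (ht k).pos (hS k) (hc k) (ht k).encard_eq.le ?_
    rw [CB_encard_eq_top (hclo k).isClosed (Order.lt_add_one_iff.2 (le_refl (β k)))]
    · exact le_top
    · have := CB_inter_isOpen univ (hclo k).isOpen (β k + 1)
      rw [univ_inter] at this
      rw [this]
      exact hD k
  choose f f1 f2 f3 using hemb
  have hI : ∀ k, IsClosed (f k '' S k) := fun k =>
    ((hS k).isCompact.image_of_continuousOn (f1 k)).isClosed
  have hsub : ∀ k, f k '' S k ⊆ insert y (⋃ k, f k '' S k) := fun k =>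
    (subset_iUnion (fun k => f k '' S k) k).trans (subset_insert _ _)
  refine ⟨insert y (⋃ k, f k '' S k), ?_, (countable_iUnion fun k => (hc k).image _).insert y,
    y, mem_CB.2 ⟨mem_insert _ _, fun p hp m => ?_⟩⟩
  · refine isClosed_of_closure_subset fun z hz => ?_
    by_contra hzK
    have hzy : z ≠ y := fun h => hzK (h ▸ mem_insert _ _)
    obtain ⟨j, hj⟩ := exists_approx_ne hzy
    have hcl : IsClosed (⋃ k ∈ Finset.range j, f k '' S k) :=
      isClosed_biUnion_finset fun k _ => hI k
    obtain ⟨i, hi⟩ := exists_cyl_subset hcl.isOpen_compl (x := z) (by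
      intro h
      obtain ⟨k, -, hk⟩ := mem_iUnion₂.1 h
      exact hzK (hsub k hk))
    obtain ⟨w, hw, hwz⟩ := (mem_closure_iff_nhds_basis (nhds_hasBasis z)).1 hz (max i j) trivial
    have hwy : w ∉ cyl y j := fun h =>
      hj ((approx_eq_of_le (le_max_right i j) hwz).symm.trans h)
    rcases hw with rfl | hw
    · exact hwy rfl
    · obtain ⟨k, hk⟩ := mem_iUnion.1 hw
      by_cases hkj : k < j
      · exact hi (cyl_anti z (le_max_left i j) hwz) (mem_biUnion (by simpa using hkj) hk)
      · obtain ⟨v, hv, rfl⟩ := hk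
        exact hwy (cyl_anti y ((not_lt.1 hkj).trans (hM.id_le k)) (f2 k hv).1)
  · obtain ⟨k, hk⟩ := (Ordinal.lt_iSup_iff).1 hp
    -- Index `k` ensures sufficient rank and index `m` sufficient closeness to `y`; the maximum
    -- ensures both.
    obtain ⟨v, hv⟩ := (ht (max k m)).nonempty_CB
    have hvm := f2 _ (CB_subset _ _ hv)
    refine ⟨f (max k m) v, CB_mono (hsub _) p (CB_anti _ (hk.le.trans (hβ.monotone
      (le_max_left k m))) (mapsTo_CB (f1 _) (mapsTo_image _ _) (f3 _) _ hv)), fun h => ?_,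
      cyl_anti y ((le_max_right k m).trans (hM.id_le _)) hvm.1⟩
    exact hvm.2 (h ▸ rfl)

/-! ### The five statements -/

theorem no_cardinality_between_multiples (A : Ordn) (hA : CBDegreeOne A.carrier) (n : ℕ)
    (hn : 0 < n) : ¬ ∃ B : ASet, LtC (prod (natOrd n) A.carrier) B ∧
      LtC B (prod (natOrd (n + 1)) A.carrier) := by
  obtain ⟨b, hb⟩ := hA.exists_hasType
  rintro ⟨B, h1, h2⟩
  have t1 := hb.natOrd_prod hn
  have t2 := hb.natOrd_prod (Nat.succ_pos n)
  rw [mul_one] at t1 t2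
  exact not_between t1 (countable_natOrd_prod A.countable n) t2
    (countable_natOrd_prod A.countable _) h1 h2

theorem omega_prod_follows (κ : Ordn) (h : CBDegreeOne κ.carrier) :
    IsWOCardinal (prod omega κ.carrier) ∧ IsLimitCardinal (prod omega κ.carrier) ∧
      FollowsImmediately (prod omega κ.carrier) (multiples κ.carrier) := by
  obtain ⟨b, hb⟩ := h.exists_hasType
  obtain ⟨t, ht⟩ := encard_eq_one.1 (hb.encard_eq.trans Nat.cast_one)
  have hCB := CB_omega_prod ht
  have htype : HasType (els (prod omega κ.carrier)) (b + 1) 1 :=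
    ⟨by rw [hCB, encard_singleton, Nat.cast_one], one_pos⟩
  have hc : (els (prod omega κ.carrier)).Countable := countable_prod countable_omega κ.countable
  have hmem : opair natLim t ∈ CB (els (prod omega κ.carrier)) (b + 1) := hCB ▸ rfl
  -- The ordering is chosen with the only point of the last derivative on top, which makes it a
  -- cardinal.
  obtain ⟨α, hα, hmax⟩ := exists_ordn_max (isClosed_els _) (CB_subset _ _ hmem)
    fun W hW hWc _ => hasWO_of_countable hWc (hc.mono hW)
  have hα' : α.carrier = prod omega κ.carrier := els_injective hα
  have hWO : IsWOCardinal (prod omega κ.carrier) := by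
    refine ⟨α, hα', Ordn.isCardinal_of_max_mem (hα.symm ▸ htype) (hα.symm ▸ hmem) fun x hx => ?_⟩
    exact hmax x (hα' ▸ hx)
  refine ⟨hWO, hWO.isLimitCardinal htype (Order.succ_ne_bot b), fun i => ?_, fun B _ hB => ?_⟩
  · exact (ltC_iff_of_hasType (countable_multiples κ.countable i) hc (hb.multiples i) htype).2
      (Or.inl (Order.lt_add_one_iff.2 le_rfl))
  · by_cases hBc : (els B).Countable
    swap
    · exact leC_of_not_countable hc hBc
    obtain ⟨c, m, hBt⟩ := exists_hasType (isClosed_els B) hBc (hB 0).nonempty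
    -- The multiple with index `m` has degree `m + 1`, so a set of degree `m` above it must have
    -- larger rank.
    have hlt : b < c := by
      rcases (ltC_iff_of_hasType (countable_multiples κ.countable m) hBc
        (hb.multiples m) hBt).1 (hB m) with h1 | ⟨-, h1⟩
      · exact h1
      · omega
    rw [leC_iff_of_hasType hc htype hBt]
    rcases (Order.add_one_le_of_lt hlt).lt_or_eq with h1 | h1
    · exact Or.inl h1
    · exact Or.inr ⟨h1, hBt.pos⟩

theorem isLimitCardinal_iff_cbDegreeOne (κ : Ordn) (hκ : κ.IsCardinal)
    (hinf : IsInfinite κ.carrier) : IsLimitCardinal κ.carrier ↔ CBDegreeOne κ.carrier := by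
  have hinf := infinite_of_isInfinite hinf
  have hne : ∀ {b n}, HasType (els κ.carrier) b n → b ≠ 0 := by
    rintro b n h rfl
    have := h.finite
    rw [CB_zero] at this
    exact hinf this
  constructor
  · intro hlim
    obtain ⟨b, n, h⟩ := exists_hasType (isClosed_els _) κ.countable hinf.nonempty
    obtain ⟨m, rfl⟩ : ∃ m, n = m + 1 := ⟨n - 1, by have := h.pos; omega⟩
    rcases Nat.eq_zero_or_pos m with rfl | hm
    · exact Ordn.cbDegreeOne_of_hasType h
    -- For degree `m + 1 > 1`, a cardinal of the same rank and degree `m` is a predecessor.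
    · obtain ⟨γ, hγ, hγt⟩ := κ.exists_cardinal_hasType b hm (by
        rw [h.encard_eq]
        exact_mod_cast Nat.le_succ m)
      refine (hlim.2.2 ⟨γ.carrier, Or.inl hγ.isWOCardinal, ?_, ?_⟩).elim
      · exact (ltC_iff_of_hasType γ.countable κ.countable hγt h).2
          (Or.inr ⟨rfl, Nat.lt_succ_self m⟩)
      · rintro ⟨C, -, h1, h2⟩
        exact not_between hγt γ.countable h κ.countable h1 h2
  · intro h
    obtain ⟨b, hb⟩ := h.exists_hasType
    exact hκ.isWOCardinal.isLimitCardinal hb (hne hb)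

theorem exists_limit_of_sequence (κ : ℕ → Ordn)
    (hlt : ∀ i, LtC (κ i).carrier (κ (i + 1)).carrier)
    (hsum : ∀ i, EqC (sum (κ i).carrier (κ (i + 1)).carrier) (κ (i + 1)).carrier) :
    ∃ K : Ordn, K.IsCardinal ∧ FollowsImmediately K.carrier (fun i => (κ i).carrier) ∧
      IsLimitCardinal K.carrier := by
  -- The indices are shifted by one because `κ 0` may be empty and then has no type.
  choose β n ht using fun i =>
    exists_hasType (isClosed_els (κ (i + 1)).carrier) (κ (i + 1)).countable (hlt i).nonempty
  have hβ : StrictMono β := by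
    refine strictMono_nat_of_lt_succ fun i => ?_
    -- If the rank did not grow, the smaller summand would contribute a point to the last derivative
    -- of the larger one, and the sum could not be absorbed.
    have h1 := (encard_CB_sum_ge _ _ (β (i + 1))).trans
      ((eqC_iff.1 (hsum (i + 1))).1.encard_CB_le (β (i + 1)))
    rw [(ht (i + 1)).encard_eq] at h1
    by_contra hle
    have h2 : 1 ≤ (CB (els (κ (i + 1)).carrier) (β (i + 1))).encard :=
      one_le_encard_iff_nonempty.2 ((ht i).nonempty_CB.mono (CB_anti _ (not_lt.1 hle)))
    have h3 : (1 : ℕ∞) + n (i + 1) ≤ n (i + 1) := (add_le_add_left h2 _).trans h1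
    exact absurd (by exact_mod_cast h3 : 1 + n (i + 1) ≤ n (i + 1)) (by omega)
  obtain ⟨L, hL, hLc, hLne⟩ := exists_CB_iSup_nonempty hβ
    (fun k => isClosed_els (κ (k + 1)).carrier) (fun k => (κ (k + 1)).countable) ht
  obtain ⟨α, rfl⟩ := hasWO_of_countable hL hLc
  -- Degree `1` at the supremum of the ranks is the least type above all members of the sequence.
  obtain ⟨K, hK, hKt⟩ := α.exists_cardinal_hasType (⨆ k, β k) one_pos
    (by simpa using one_le_encard_iff_nonempty.2 hLne)
  have hβlt : ∀ k, β k < ⨆ k, β k := fun k =>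
    (hβ (Nat.lt_succ_self k)).trans_le (Ordinal.le_iSup β (k + 1))
  refine ⟨K, hK, ⟨fun i => ?_, fun B _ hB => ?_⟩,
    hK.isWOCardinal.isLimitCardinal hKt (zero_le.trans_lt (hβlt 0)).ne'⟩
  · have h1 := ltC_iff_leC.1 (hlt i)
    have h2 := ltC_iff_leC.1 ((ltC_iff_of_hasType (κ (i + 1)).countable K.countable (ht i) hKt).2
      (Or.inl (hβlt i)))
    exact ltC_iff_leC.2 ⟨h1.1.trans h2.1, fun h => h2.2 (h.trans h1.1)⟩
  · by_cases hBc : (els B).Countable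
    swap
    · exact leC_of_not_countable K.countable hBc
    obtain ⟨c, m, hBt⟩ := exists_hasType (isClosed_els B) hBc (hB 0).nonempty
    have hle : ⨆ k, β k ≤ c := Ordinal.iSup_le fun k => by
      rcases (ltC_iff_of_hasType (κ (k + 1)).countable hBc (ht k) hBt).1 (hB (k + 1))
        with h1 | ⟨h1, -⟩
      · exact h1.le
      · exact h1.le
    rw [leC_iff_of_hasType K.countable hKt hBt]
    rcases hle.lt_or_eq with h1 | h1
    · exact Or.inl h1
    · exact Or.inr ⟨h1, hBt.pos⟩

end AS

theorem theorem11p8 :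
    -- `n × κ`, ordered lexicographically, is a cardinal
    (∀ (κ : AS.Ordn) (n : ℕ), κ.IsCardinal →
      ∃ P : AS.Ordn, P.carrier = AS.prod (AS.natOrd n) κ.carrier ∧
        AS.IsLexOrder n κ P ∧ P.IsCardinal) ∧
    -- no set is strictly between `n × A` and `(n + 1) × A` if `d_CB(A) = 1`
    (∀ A : AS.Ordn, AS.CBDegreeOne A.carrier → ∀ n : ℕ, 0 < n →
      ¬ ∃ B : AS.ASet, AS.LtC (AS.prod (AS.natOrd n) A.carrier) B ∧
        AS.LtC B (AS.prod (AS.natOrd (n + 1)) A.carrier)) ∧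
    -- `ω × κ` is a limit well-ordered cardinal immediately after `κ, 2 × κ, 3 × κ, ...`
    (∀ κ : AS.Ordn, κ.IsCardinal → AS.CBDegreeOne κ.carrier →
      AS.IsWOCardinal (AS.prod AS.omega κ.carrier) ∧
      AS.IsLimitCardinal (AS.prod AS.omega κ.carrier) ∧
      AS.FollowsImmediately (AS.prod AS.omega κ.carrier) (AS.multiples κ.carrier)) ∧
    -- an infinite well-ordered cardinal is a limit cardinal exactly when its degree is 1
    (∀ κ : AS.Ordn, κ.IsCardinal → AS.IsInfinite κ.carrier →
      (AS.IsLimitCardinal κ.carrier ↔ AS.CBDegreeOne κ.carrier)) ∧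
    -- limits of increasing sequences
    (∀ κ : ℕ → AS.Ordn, (∀ i, (κ i).IsCardinal) →
      (∀ i, AS.LtC (κ i).carrier (κ (i + 1)).carrier) →
      (∀ i, AS.EqC (AS.sum (κ i).carrier (κ (i + 1)).carrier) (κ (i + 1)).carrier) →
      ∃ K : AS.Ordn, K.IsCardinal ∧
        AS.FollowsImmediately K.carrier (fun i => (κ i).carrier) ∧
        AS.IsLimitCardinal K.carrier) := by
  refine ⟨fun κ n hκ => ?_, AS.no_cardinality_between_multiples,
    fun κ _ h => AS.omega_prod_follows κ h, AS.isLimitCardinal_iff_cbDegreeOne,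
    fun κ _ => AS.exists_limit_of_sequence κ⟩
  obtain ⟨P, hP, hlex⟩ := κ.exists_isLexOrder n
  exact ⟨P, hP, hlex, hκ.of_isLexOrder hP hlex⟩
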